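/- Consider the infinite chain $\mathbb Z$ with local space $\mathbb C^d$ ($1\le d<\infty$) at each site; let $\mathcal B$ be the operators on $\mathbb C^d$ and $\mathcal B_0\subset\mathcal B$ the traceless ones. A formal operator is a family $\Phi=\sum_A\Phi(A)$, $\Phi(A)\in\mathcal B_0^{\otimes A}$, indexed by the finite sets $A\subset\mathbb Z$ (with $\mathcal B_0^{\otimes\emptyset}=\mathbb C$). Its range is the supremum of $\max A-\min A+1$ over the nonempty $A$ with $\Phi(A)\ne0$ (and $0$ if there are none); $\Phi$ is local if its range is finite, $k$-local if its range is $k$, and at most $k$-local if its range is at most $k$. For local $\Phi$ and arbitrary $\Psi$ put $[\Phi,\Psi](A)=\bigl[\Phi|_B,\Psi|_B\bigr]_A$ for any sufficiently large finite $B\supset A$, where $\Phi|_B=\sum_{A'\subset B}\Phi(A')$ and $Y_A$ is the component of $Y$ in $\mathcal B^{\otimes B}=\bigoplus_{A\subset B}\mathcal B_0^{\otimes A}$. A conserved quantity of $H$ is a $\Psi$ with $[H,\Psi]=0$. Let $H=\sum_{i}h^{(2)}_i+\sum_i h^{(1)}_i$ be Hermitian and translation invariant, with $h^{(2)}_i\in\mathcal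 B_{0}\otimes\mathcal B_{0}$ on the sites $i,i+1$ and $h^{(1)}_i\in\mathcal B_{0}$ on the site $i$. Assume: (i) for every $a\in\mathcal B_0$, $[I\otimes a,h^{(2)}_1]=0$ implies $a=0$, and $[a\otimes I,h^{(2)}_1]=0$ implies $a=0$; (ii) for every family $(a_i)_{i\in\mathbb Z}$ of operators $a_i\in\mathcal B_{0}\otimes\mathcal B_{0}$ on the sites $i,i+1$: if $[h^{(2)}_i,a_{i+1}]=[a_i,h^{(2)}_{i+1}]$ for all $i$, then there is $\alpha\in\mathbb C$ with $a_i=\alpha h^{(2)}_i$ for all $i$. Let $C$ be a translation-invariant, at most one-local operator, $B_H=\sum_j j\,(h^{(2)}_j+h^{(1)}_j)+C$ and $Q^{(3)}=[B_H,H]$. Assume moreover: (A) if there is an at most two-local operator $R^{(2)}$ such that $[H,Q^{(3)}+R^{(2)}]$ is at most two-local, then $[H,Q^{(3)}]=0$. Then exactly one of the following holds. (1) $H$ is integrable: there are operators $Q_k$ ($k\ge2$), each $Q_k$ being a $k$-local conserved quantity of $H$, such that $[Q_k,Q_l]=0$ for all $k,l\ge2$. (2) $H$ is nonintegrable: every local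 conserved quantity of $H$ (translation invariant or not) is of the form $\alpha H+R$ with $\alpha\in\mathbb C$ and $R$ at most one-local. -/

import Mathlib

namespace SpinChain

/-- Operators on the sites of a finite set `A` of the chain `ℤ`, each site carrying `ℂ^d`:
matrices indexed by the basis configurations `A → Fin d`. -/
abbrev LocOp (d : ℕ) (A : Finset ℤ) : Type := Matrix (A → Fin d) (A → Fin d) ℂ

/-- Membership in `𝓑₀^{⊗A}`: the partial trace over every site of `A` vanishes.
For `A = ∅` this holds for every (scalar) operator. -/
def IsTraceless {d : ℕ} {A : Finset ℤ} (X : LocOp d A) : Prop :=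
  ∀ (a : A) (s t : A → Fin d),
    ∑ k : Fin d, X (Function.update s a k) (Function.update t a k) = 0

/-- The natural embedding `X ↦ X ⊗ I` of operators on `A` into operators on `B ⊇ A`. -/
def embed {d : ℕ} {A B : Finset ℤ} (h : A ⊆ B) (X : LocOp d A) : LocOp d B :=
  fun s t =>
    if ∀ i : B, i.1 ∉ A → s i = t i then
      X (fun a => s ⟨a.1, h a.2⟩) (fun a => t ⟨a.1, h a.2⟩)
    else 0

/-- The configuration on `B` that is `s` at the sites of `C ∩ A` and `u` elsewhere. -/
def glue {d : ℕ} {A B : Finset ℤ} (C : Finset ℤ) (s : A → Fin d) (u : B → Fin d) :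
    B → Fin d :=
  fun b => if h : b.1 ∈ C ∧ b.1 ∈ A then s ⟨b.1, h.2⟩ else u b

/-- For `C ⊆ A ⊆ B` and `Y` an operator on `B`: the normalized partial trace of `Y` over `B \ C`,
tensored with the identity so as to be an operator on `A`.  Averaging over the configurations `u`
of all of `B` is the normalized trace over `B \ C`, as `glue` discards `u` on `C`. -/
noncomputable def reduce {d : ℕ} {B : Finset ℤ} (A C : Finset ℤ) (Y : LocOp d B) : LocOp d A :=
  fun s t =>
    if ∀ i : A, i.1 ∉ C → s i = t i then
      ((d : ℂ) ^ B.card)⁻¹ * ∑ u : B → Fin d, Y (glue C s u) (glue C t u)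
    else 0

/-- For `A ⊆ B`, the component `Y_A ∈ 𝓑₀^{⊗A}` of an operator `Y` on `B` in the decomposition
`𝓑^{⊗B} = ⨁_{A ⊆ B} 𝓑₀^{⊗A}`, obtained from the partial traces by inclusion-exclusion. -/
noncomputable def component {d : ℕ} {B : Finset ℤ} (A : Finset ℤ) (Y : LocOp d B) : LocOp d A :=
  ∑ C ∈ A.powerset, (-1 : ℂ) ^ (A \ C).card • reduce A C Y

/-- Formal operators `Φ = ∑_A Φ(A)` on the infinite chain: families `A ↦ Φ(A) ∈ 𝓑₀^{⊗A}`
indexed by the finite subsets `A` of `ℤ`. -/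
def formalOps (d : ℕ) : Submodule ℂ ((A : Finset ℤ) → LocOp d A) where
  carrier := {Φ | ∀ A, IsTraceless (Φ A)}
  add_mem' := by
    intro Φ Ψ hΦ hΨ A a s t
    simp [Finset.sum_add_distrib, hΦ A a s t, hΨ A a s t]
  zero_mem' := by
    intro A a s t
    simp
  smul_mem' := by
    intro c Φ hΦ A a s t
    simp [← Finset.mul_sum, hΦ A a s t]

abbrev FormalOp (d : ℕ) : Type := formalOps d

/-- The range `max A - min A + 1` of a finite set of sites, with value `0` for `∅`. -/
noncomputable def setRange (A : Finset ℤ) : ℕ :=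
  if h : A.Nonempty then (A.max' h - A.min' h + 1).toNat else 0

/-- The range of a formal operator. `Φ` is local if it is finite, `n`-local if it is equal to `n`,
and at most `n`-local if it is at most `n`. -/
noncomputable def opRange {d : ℕ} (Φ : FormalOp d) : ℕ∞ :=
  ⨆ (A : Finset ℤ) (_ : Φ.1 A ≠ 0), (setRange A : ℕ∞)

/-- The restriction `Φ|_B = ∑_{A ⊆ B} Φ(A)`, an operator on `B`. -/
noncomputable def restrict {d : ℕ} (Φ : FormalOp d) (B : Finset ℤ) : LocOp d B :=
  ∑ A ∈ B.powerset.attach, embed (Finset.mem_powerset.1 A.2) (Φ.1 A.1)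

/-- The sites at distance at most `n` from `A`. -/
noncomputable def nbhd (A : Finset ℤ) (n : ℕ) : Finset ℤ :=
  A.biUnion fun a => Finset.Icc (a - n) (a + n)

theorem subset_nbhd (A : Finset ℤ) (n : ℕ) : A ⊆ nbhd A n := by
  intro a ha
  simp only [nbhd, Finset.mem_biUnion, Finset.mem_Icc]
  exact ⟨a, ha, by omega, by omega⟩

theorem sum_sum_update {d : ℕ} {B : Finset ℤ} (b : B) (f : (B → Fin d) → ℂ) :
    ∑ k : Fin d, ∑ u : B → Fin d, f (Function.update u b k) = d * ∑ u, f u := by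
  have hinv : Function.Involutive
      (fun p : Fin d × (B → Fin d) => (p.2 b, Function.update p.2 b p.1)) := by
    rintro ⟨k, u⟩
    simp
  have h := Equiv.sum_comp hinv.toPerm (fun p : Fin d × (B → Fin d) => f p.2)
  simp only [Function.Involutive.coe_toPerm, Fintype.sum_prod_type] at h
  rw [h]
  simp

theorem component_isTraceless {d : ℕ} {A B : Finset ℤ} (hAB : A ⊆ B) (Y : LocOp d B) :
    IsTraceless (component A Y) := by
  classical
  intro a s t
  obtain ⟨A', haA', hA⟩ : ∃ A', a.1 ∉ A' ∧ A = insert a.1 A' :=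
    ⟨A.erase a.1, by simp, (Finset.insert_erase a.2).symm⟩
  have key : ∀ C ∈ A'.powerset,
      ∑ k : Fin d, reduce A (insert a.1 C) Y (Function.update s a k) (Function.update t a k)
        = ∑ k : Fin d, reduce A C Y (Function.update s a k) (Function.update t a k) := by
    intro C hC
    have haC : a.1 ∉ C := fun h => haA' (Finset.mem_powerset.1 hC h)
    have hglue : ∀ (w : A → Fin d) (k : Fin d) (u : B → Fin d),
        glue (insert a.1 C) (Function.update w a k) u
          = glue C w (Function.update u ⟨a.1, hAB a.2⟩ k) := by
      intro w k u
      funext b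
      by_cases hb : b.1 = a.1
      · have hb' : b = ⟨a.1, hAB a.2⟩ := Subtype.ext hb
        subst hb'
        simp [glue, haC]
      · have hb' : b ≠ ⟨a.1, hAB a.2⟩ := fun h => hb (congrArg Subtype.val h)
        simp only [glue, Finset.mem_insert, hb, false_or, Function.update_of_ne hb']
        split_ifs with h
        · rw [Function.update_of_ne]
          exact fun h' => hb (congrArg Subtype.val h')
        · rfl
    have hglue' : ∀ (w : A → Fin d) (k : Fin d) (u : B → Fin d),
        glue C (Function.update w a k) u = glue C w u := by
      intro w k u
      funext b
      simp only [glue]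
      split_ifs with h
      · rw [Function.update_of_ne]
        exact fun h' => haC (congrArg Subtype.val h' ▸ h.1)
      · rfl
    have hcond : ∀ k : Fin d,
        (∀ i : A, i.1 ∉ insert a.1 C → Function.update s a k i = Function.update t a k i) ↔
          (∀ i : A, i.1 ∉ C → s i = t i ∨ i = a) := by
      intro k
      refine forall_congr' fun i => ?_
      by_cases hi : i = a
      · subst hi; simp
      · have : i.1 ≠ a.1 := fun h => hi (Subtype.ext h)
        simp [hi, this]
    have hcond' : ∀ k : Fin d,
        (∀ i : A, i.1 ∉ C → Function.update s a k i = Function.update t a k i) ↔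
          (∀ i : A, i.1 ∉ C → s i = t i ∨ i = a) := by
      intro k
      refine forall_congr' fun i => ?_
      by_cases hi : i = a
      · subst hi; simp
      · simp [hi]
    simp only [reduce, hcond, hcond', hglue, hglue']
    split_ifs
    · rw [← Finset.mul_sum,
        sum_sum_update ⟨a.1, hAB a.2⟩ (fun u => Y (glue C s u) (glue C t u))]
      simp
      ring
    · rfl
  have hsum : component A Y
      = ∑ C ∈ A'.powerset, (-1 : ℂ) ^ (A' \ C).card • (reduce A (insert a.1 C) Y
          - reduce A C Y) := by
    unfold component
    conv_lhs => rw [show A.powerset = (insert a.1 A').powerset by rw [← hA]]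
    rw [Finset.sum_powerset_insert haA', ← Finset.sum_add_distrib]
    refine Finset.sum_congr rfl fun C hC => ?_
    have haC : a.1 ∉ C := fun h => haA' (Finset.mem_powerset.1 hC h)
    have h1 : (A \ C).card = (A' \ C).card + 1 := by
      rw [hA, Finset.insert_sdiff_of_notMem _ haC, Finset.card_insert_of_notMem]
      simp [haA']
    have h2 : A \ insert a.1 C = A' \ C := by
      ext x
      have hx : x ∈ A ↔ x = a.1 ∨ x ∈ A' := by rw [← Finset.mem_insert, ← hA]
      simp only [Finset.mem_sdiff, Finset.mem_insert, hx]
      constructor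
      · rintro ⟨h | h, h'⟩ <;> simp_all
      · rintro ⟨h, h'⟩
        refine ⟨Or.inr h, ?_⟩
        rintro (h'' | h'')
        · exact haA' (h'' ▸ h)
        · exact h' h''
    rw [h1, h2, pow_succ, smul_sub]
    simp only [mul_neg, mul_one, neg_smul]
    abel
  rw [hsum]
  simp only [Matrix.sum_apply, Matrix.smul_apply, Matrix.sub_apply, smul_eq_mul]
  rw [Finset.sum_comm]
  refine Finset.sum_eq_zero fun C hC => ?_
  rw [← Finset.mul_sum, Finset.sum_sub_distrib, key C hC, sub_self, mul_zero]

/-- The commutator `[Φ, Ψ]` of formal operators, `Φ` being local: its value at `A` is the component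
`[Φ|_B, Ψ|_B]_A` for any sufficiently large finite `B ⊇ A`.  A term `[Φ(C), Ψ(C')]` has an
`A`-component only if `C` meets `A` and `C' ⊆ A ∪ C`, so the sites within distance `opRange Φ` of `A`
are enough. -/
noncomputable def comm {d : ℕ} (Φ Ψ : FormalOp d) : FormalOp d :=
  ⟨fun A =>
    component A ⁅restrict Φ (nbhd A (opRange Φ).toNat), restrict Ψ (nbhd A (opRange Φ).toNat)⁆,
   fun A => component_isTraceless (subset_nbhd A _) _⟩

/-- Self-adjointness: every component is Hermitian. -/
def IsSelfAdjointOp {d : ℕ} (Φ : FormalOp d) : Prop :=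
  ∀ A, (Φ.1 A).IsHermitian

/-- Translation invariance: the component at `A + x` is the translate of the component at `A`. -/
def IsTranslationInvariant {d : ℕ} (Φ : FormalOp d) : Prop :=
  ∀ (A : Finset ℤ) (x : ℤ) (s t : A.map (addRightEmbedding x) → Fin d),
    Φ.1 (A.map (addRightEmbedding x)) s t =
      Φ.1 A (fun a => s ⟨a.1 + x, Finset.mem_map_of_mem (addRightEmbedding x) a.2⟩)
        (fun a => t ⟨a.1 + x, Finset.mem_map_of_mem (addRightEmbedding x) a.2⟩)

/-- `Φ = ∑ᵢ h⁽²⁾ᵢ + ∑ᵢ h⁽¹⁾ᵢ` with `h⁽²⁾ᵢ = Φ({i,i+1})` and `h⁽¹⁾ᵢ = Φ({i})`: there are only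
nearest-neighbour interactions and on-site potentials. -/
def IsNearestNeighbour {d : ℕ} (Φ : FormalOp d) : Prop :=
  ∀ A, Φ.1 A ≠ 0 → ∃ i : ℤ, A = {i, i + 1} ∨ A = {i}

/-- The sum `∑ⱼ j (h⁽²⁾ⱼ + h⁽¹⁾ⱼ)`: the component at a nonempty `A` is multiplied by `min A`. -/
noncomputable def moment {d : ℕ} (H : FormalOp d) : FormalOp d :=
  ⟨fun A => if h : A.Nonempty then ((A.min' h : ℤ) : ℂ) • H.1 A else 0, by
    intro A
    by_cases h : A.Nonempty
    · simp only [h, dif_pos]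
      exact (formalOps d).smul_mem _ H.2 A
    · simp only [h, dif_neg, not_false_eq_true]
      exact (formalOps d).zero_mem A⟩

/-- The boost operator `∑ⱼ j (h⁽²⁾ⱼ + h⁽¹⁾ⱼ) + C`. -/
noncomputable def boost {d : ℕ} (H C : FormalOp d) : FormalOp d := moment H + C

/-- The operator `Q⁽³⁾ = [B_H, H]`. -/
noncomputable def Q3 {d : ℕ} (H C : FormalOp d) : FormalOp d := comm (boost H C) H

/-- A traceless one-site operator that commutes, when placed on the right or on the left site,
with the two-site interaction `h⁽²⁾₁` vanishes. -/
def InjectiveInteraction {d : ℕ} (H : FormalOp d) : Prop :=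
  (∀ a : LocOp d {2}, IsTraceless a →
    ⁅embed (B := {1, 2}) (by decide) a, H.1 {1, 2}⁆ = 0 → a = 0) ∧
  (∀ a : LocOp d {1}, IsTraceless a →
    ⁅embed (B := {1, 2}) (by decide) a, H.1 {1, 2}⁆ = 0 → a = 0)

/-- If `aᵢ ∈ 𝓑₀ ⊗ 𝓑₀` on the sites `i, i+1` satisfy `[h⁽²⁾ᵢ, aᵢ₊₁] = [aᵢ, h⁽²⁾ᵢ₊₁]` for all `i`,
as operators on the sites `i, i+1, i+2`, then `aᵢ = α h⁽²⁾ᵢ` for all `i`, with `α` independent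
of `i`. -/
def UniqueTwoLocalCharge {d : ℕ} (H : FormalOp d) : Prop :=
  ∀ a : (i : ℤ) → LocOp d {i, i + 1}, (∀ i, IsTraceless (a i)) →
    (∀ i : ℤ,
      ⁅embed (B := {i, i + 1, i + 1 + 1}) (by grind) (H.1 {i, i + 1}),
        embed (B := {i, i + 1, i + 1 + 1}) (by grind) (a (i + 1))⁆ =
      ⁅embed (B := {i, i + 1, i + 1 + 1}) (by grind) (a i),
        embed (B := {i, i + 1, i + 1 + 1}) (by grind) (H.1 {i + 1, i + 1 + 1})⁆) →
    ∃ α : ℂ, ∀ i, a i = α • H.1 {i, i + 1}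

/-- There are mutually commuting `k`-local conserved quantities for all `k ≥ 2`. -/
def IsIntegrable {d : ℕ} (H : FormalOp d) : Prop :=
  ∃ Q : ℕ → FormalOp d,
    (∀ k, 2 ≤ k → opRange (Q k) = k ∧ comm H (Q k) = 0) ∧
    ∀ k l, 2 ≤ k → 2 ≤ l → comm (Q k) (Q l) = 0

/-- The only local conserved quantities are the Hamiltonian, up to a scalar factor, and operators
that are at most one-local, and sums of these. -/
def IsNonintegrable {d : ℕ} (H : FormalOp d) : Prop :=
  ∀ Ψ : FormalOp d, opRange Ψ < ⊤ → comm H Ψ = 0 →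
    ∃ (α : ℂ) (R : FormalOp d), opRange R ≤ 1 ∧ Ψ = α • H + R

end SpinChain

/-! Everything is decided by whether `Q3` is conserved.

Suppose it is. Then the boost B generates charges: `tower` starts at H and iterates Q ↦ [B, Q]. If Q
is a translation-invariant local charge, the Jacobi identity turns [H, [H, [B, Q]]] into -[H, [Q3,
Q]] = 0. For Hermitian H a vanishing double commutator forces the single one to vanish
(`comm_eq_zero_of_comm_comm`): with Y = [H, X] and [H, Y] = 0, the trace per site satisfies tr(Y* Y)
= tr(Y* [H, X]) = tr([Y*, H] X) = 0. This needs translation invariance of X = [B, Q], which holds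
because translating B by x only subtracts xH. Mutual commutation is again Jacobi. The range grows by
exactly one, since the leading part of [B, Q] is a nonzero multiple of the commutator of a bond with
the leading part of Q, and this does not vanish by (i).

Suppose it is not. Let Ψ be a charge of range at most n + 3, with leading part ψ on the intervals of
n + 3 sites and next part χ on those of n + 2 sites. On n + 4 sites, [H, Ψ] = 0 reads [h_i, ψ_{i+1}]
= [ψ_i, h_{i+n+2}]. Hypothesis (i) allows one bond to be peeled off at a time
(`InjectiveBonds.peel_family`), (ii) ends the recursion, and ψ is α times a nested commutator of
bonds (`eq_smul_nest`). On n + 3 sites the equation becomes ∂χ = α corr_{n+1}, where ∂ is `bdry`.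
Recursions for `corr` (`corr_add_two`, `exists_corr_two`) let `corr_descent` peel this down to ∂ω =
c corr_1 with c a nonzero multiple of α. A solution with c ≠ 0 is precisely a two-local correction
of `Q3` of the kind in (A) (`exists_correction`), so (A) would make `Q3` conserved. Hence α = 0, the
range drops step by step to two, and (ii) identifies the two-site part with a multiple of that of H.
-/

namespace SpinChain

/-! ### The common operator algebra, its matrix units and operator-valued matrix entries -/

/-- Linear operators on the functions of a configuration of the chain; all local operators embed
here. -/
abbrev Obs (d : ℕ) : Type := Module.End ℂ ((ℤ → Fin d) → ℂ)

noncomputable instance (d : ℕ) : LieRing (Obs d) := LieRing.ofAssociativeRing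

noncomputable instance (d : ℕ) : LieAlgebra ℂ (Obs d) := LieAlgebra.ofAssociativeAlgebra

/-- The matrix unit `|k⟩⟨l|` at the site `i`. -/
def siteUnit {d : ℕ} (i : ℤ) (k l : Fin d) : Obs d where
  toFun f x := if x i = k then f (Function.update x i l) else 0
  map_add' f g := by ext x; by_cases h : x i = k <;> simp [h]
  map_smul' c f := by ext x; by_cases h : x i = k <;> simp [h]

theorem siteUnit_apply {d : ℕ} (i : ℤ) (k l : Fin d) (f : (ℤ → Fin d) → ℂ) (x : ℤ → Fin d) :
    siteUnit i k l f x = if x i = k then f (Function.update x i l) else 0 := rfl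

theorem siteUnit_mul_same {d : ℕ} (i : ℤ) (k l m n : Fin d) :
    (siteUnit i k l * siteUnit i m n : Obs d) = if l = m then siteUnit i k n else 0 := by
  ext f x
  by_cases h : l = m
  · subst h
    simp [siteUnit_apply, Module.End.mul_apply]
  · simp [siteUnit_apply, Module.End.mul_apply, h]

theorem sum_siteUnit {d : ℕ} (i : ℤ) : ∑ k, (siteUnit i k k : Obs d) = 1 := by
  refine LinearMap.ext fun f => funext fun x => ?_
  simp [siteUnit_apply, LinearMap.sum_apply, Finset.sum_apply]

theorem siteUnit_commute {d : ℕ} {i j : ℤ} (h : i ≠ j) (k l m n : Fin d) :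
    Commute (siteUnit i k l : Obs d) (siteUnit j m n) := by
  refine LinearMap.ext fun f => funext fun x => ?_
  simp only [Module.End.mul_apply, siteUnit_apply, Function.update_of_ne h.symm,
    Function.update_of_ne h, Function.update_comm h]
  split_ifs <;> rfl

/-- `X` acts trivially at the site `i`: it commutes with the matrix units there. -/
def Off {d : ℕ} (i : ℤ) (X : Obs d) : Prop := ∀ k l, Commute (siteUnit i k l) X

theorem off_siteUnit {d : ℕ} {i j : ℤ} (h : i ≠ j) (k l : Fin d) : Off i (siteUnit j k l) :=
  fun _ _ => siteUnit_commute h _ _ _ _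

theorem Off.mul {d : ℕ} {i : ℤ} {X Y : Obs d} (hX : Off i X) (hY : Off i Y) : Off i (X * Y) :=
  fun k l => (hX k l).mul_right (hY k l)

theorem Off.add {d : ℕ} {i : ℤ} {X Y : Obs d} (hX : Off i X) (hY : Off i Y) : Off i (X + Y) :=
  fun k l => (hX k l).add_right (hY k l)

theorem Off.sub {d : ℕ} {i : ℤ} {X Y : Obs d} (hX : Off i X) (hY : Off i Y) : Off i (X - Y) :=
  fun k l => (hX k l).sub_right (hY k l)

theorem Off.smul {d : ℕ} {i : ℤ} {X : Obs d} (c : ℂ) (hX : Off i X) : Off i (c • X) :=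
  fun k l => (hX k l).smul_right c

theorem Off.lie {d : ℕ} {i : ℤ} {X Y : Obs d} (hX : Off i X) (hY : Off i Y) : Off i ⁅X, Y⁆ := by
  rw [LieRing.of_associative_ring_bracket]; exact (hX.mul hY).sub (hY.mul hX)

theorem Off.sum {d : ℕ} {i : ℤ} {ι : Type*} {s : Finset ι} {X : ι → Obs d}
    (hX : ∀ j ∈ s, Off i (X j)) : Off i (∑ j ∈ s, X j) :=
  fun k l => Commute.sum_right s X _ fun j hj => hX j hj k l

/-- The operator coefficient of the matrix unit `|k⟩⟨l|` at `i` in `X`. -/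
def slice {d : ℕ} (i : ℤ) (k l : Fin d) : Obs d →ₗ[ℂ] Obs d where
  toFun X := ∑ m, siteUnit i m k * X * siteUnit i l m
  map_add' X Y := by simp [mul_add, add_mul, Finset.sum_add_distrib]
  map_smul' c X := by simp [Finset.smul_sum]

theorem slice_apply {d : ℕ} (i : ℤ) (k l : Fin d) (X : Obs d) :
    slice i k l X = ∑ m, siteUnit i m k * X * siteUnit i l m := rfl

/-- At the site `i` an operator is a `d × d` matrix whose entries, the slices, commute with the
matrix units there; this is the product rule for such matrices. -/
theorem slice_mul {d : ℕ} (i : ℤ) (k l : Fin d) (X Y : Obs d) :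
    slice i k l (X * Y) = ∑ r, slice i k r X * slice i r l Y := by
  simp only [slice_apply, Finset.sum_mul_sum]
  have : ∀ r m n, siteUnit i m k * X * siteUnit i r m * (siteUnit i n r * Y * siteUnit i l n)
      = if m = n then siteUnit i m k * X * siteUnit i r r * Y * siteUnit i l m else 0 := by
    intro r m n
    have h : siteUnit i m k * X * siteUnit i r m * (siteUnit i n r * Y * siteUnit i l n)
      = siteUnit i m k * X * (siteUnit i r m * siteUnit i n r) * Y * siteUnit i l n := by
      simp only [mul_assoc]
    rw [h, siteUnit_mul_same]
    by_cases hmn : m = n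
    · subst hmn; simp
    · simp [hmn]
  simp only [this, Finset.sum_ite_eq, Finset.mem_univ, if_true]
  rw [Finset.sum_comm]
  refine Finset.sum_congr rfl fun m _ => ?_
  rw [← Finset.sum_mul, ← Finset.sum_mul, ← Finset.mul_sum, sum_siteUnit]
  simp [mul_assoc]

theorem slice_of_off {d : ℕ} {i : ℤ} {X : Obs d} (hX : Off i X) (k l : Fin d) :
    slice i k l X = if k = l then X else 0 := by
  have : ∀ m, siteUnit i m k * X * siteUnit i l m = if k = l then siteUnit i m m * X else 0 := by
    intro m
    rw [mul_assoc, ← (hX l m).eq, ← mul_assoc, siteUnit_mul_same]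
    split_ifs <;> simp
  rw [slice_apply, Finset.sum_congr rfl fun m _ => this m]
  split_ifs
  · rw [← Finset.sum_mul, sum_siteUnit, one_mul]
  · simp

theorem slice_siteUnit {d : ℕ} (i : ℤ) (k l m n : Fin d) :
    slice i k l (siteUnit i m n : Obs d) = if k = m ∧ l = n then 1 else 0 := by
  simp only [slice_apply, siteUnit_mul_same, ite_mul, zero_mul]
  by_cases h : k = m
  · by_cases h' : l = n
    · simp [h, h', sum_siteUnit]
    · simp [h, h', Ne.symm h']
  · simp [h]

theorem eq_sum_slice {d : ℕ} (i : ℤ) (X : Obs d) :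
    X = ∑ k, ∑ l, siteUnit i k l * slice i k l X := by
  have : ∀ k l, siteUnit i k l * slice i k l X = siteUnit i k k * X * siteUnit i l l := by
    intro k l
    rw [slice_apply, Finset.mul_sum]
    rw [Finset.sum_eq_single l]
    · rw [← mul_assoc, ← mul_assoc, siteUnit_mul_same, if_pos rfl]
    · intro m _ hm
      rw [← mul_assoc, ← mul_assoc, siteUnit_mul_same, if_neg (Ne.symm hm), zero_mul, zero_mul]
    · simp
  simp only [this, ← Finset.mul_sum, sum_siteUnit, mul_one, ← Finset.sum_mul, one_mul]

theorem off_slice {d : ℕ} (i : ℤ) (k l : Fin d) (X : Obs d) : Off i (slice i k l X) := by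
  intro m n
  rw [commute_iff_eq, slice_apply, Finset.mul_sum, Finset.sum_mul]
  rw [Finset.sum_eq_single n, Finset.sum_eq_single m]
  · rw [← mul_assoc, ← mul_assoc, siteUnit_mul_same, if_pos rfl, mul_assoc _ _ (siteUnit i m n),
      siteUnit_mul_same, if_pos rfl]
  · intro r _ hr
    rw [mul_assoc, siteUnit_mul_same, if_neg hr, mul_zero]
  · simp
  · intro r _ hr
    rw [← mul_assoc, ← mul_assoc, siteUnit_mul_same, if_neg (Ne.symm hr), zero_mul, zero_mul]
  · simp

theorem Off.slice {d : ℕ} {i : ℤ} {X : Obs d} (hX : Off i X) (j : ℤ) (k l : Fin d) :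
    Off i (slice j k l X) := by
  by_cases h : i = j
  · subst h; exact off_slice _ _ _ _
  · exact Off.sum fun m _ => ((off_siteUnit h _ _).mul hX).mul (off_siteUnit h _ _)

theorem slice_mul_of_off_left {d : ℕ} {i : ℤ} {X : Obs d} (hX : Off i X) (k l : Fin d)
    (Y : Obs d) : slice i k l (X * Y) = X * slice i k l Y := by
  simp [slice_mul, slice_of_off hX]

theorem slice_mul_of_off_right {d : ℕ} {i : ℤ} {Y : Obs d} (hY : Off i Y) (k l : Fin d)
    (X : Obs d) : slice i k l (X * Y) = slice i k l X * Y := by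
  simp [slice_mul, slice_of_off hY]

theorem slice_slice_comm {d : ℕ} {i j : ℤ} (h : i ≠ j) (k l m n : Fin d) (X : Obs d) :
    slice i k l (slice j m n X) = slice j m n (slice i k l X) := by
  conv_lhs => rw [slice_apply j, map_sum]
  conv_rhs => rw [slice_apply j]
  refine Finset.sum_congr rfl fun r _ => ?_
  rw [slice_mul_of_off_right (off_siteUnit h _ _), slice_mul_of_off_left (off_siteUnit h _ _)]

/-! ### Subalgebras of local operators -/

/-- The algebra of operators on the sites of `S`. -/
def opsOn {d : ℕ} (S : Finset ℤ) : Subalgebra ℂ (Obs d) :=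
  Algebra.adjoin ℂ {X | ∃ i ∈ S, ∃ k l, X = siteUnit i k l}

theorem siteUnit_mem {d : ℕ} {S : Finset ℤ} {i : ℤ} (h : i ∈ S) (k l : Fin d) :
    siteUnit i k l ∈ opsOn (d := d) S :=
  Algebra.subset_adjoin ⟨i, h, k, l, rfl⟩

theorem opsOn_mono {d : ℕ} {S T : Finset ℤ} (h : S ⊆ T) : opsOn (d := d) S ≤ opsOn T :=
  Algebra.adjoin_mono fun _ ⟨i, hi, k, l, hx⟩ => ⟨i, h hi, k, l, hx⟩

theorem lie_mem_opsOn {d : ℕ} {S : Finset ℤ} {X Y : Obs d} (hX : X ∈ opsOn S) (hY : Y ∈ opsOn S) :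
    ⁅X, Y⁆ ∈ opsOn S := by
  rw [LieRing.of_associative_ring_bracket]; exact sub_mem (mul_mem hX hY) (mul_mem hY hX)

theorem off_of_mem {d : ℕ} {S : Finset ℤ} {X : Obs d} (hX : X ∈ opsOn S) {i : ℤ} (hi : i ∉ S) :
    Off i X := by
  induction hX using Algebra.adjoin_induction with
  | mem x hx =>
    obtain ⟨j, hj, k, l, rfl⟩ := hx
    exact off_siteUnit (fun h => hi (by rwa [h])) _ _
  | algebraMap r => exact fun k l => (Algebra.commutes r _).symm
  | add x y _ _ hx hy => exact hx.add hy
  | mul x y _ _ hx hy => exact hx.mul hy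

theorem commute_of_off {d : ℕ} {S : Finset ℤ} {X Y : Obs d} (hX : X ∈ opsOn S)
    (hY : ∀ i ∈ S, Off i Y) : Commute X Y := by
  induction hX using Algebra.adjoin_induction with
  | mem x hx =>
    obtain ⟨j, hj, k, l, rfl⟩ := hx
    exact hY j hj k l
  | algebraMap r => exact Algebra.commutes r _
  | add x y _ _ hx hy => exact hx.add_left hy
  | mul x y _ _ hx hy => exact hx.mul_left hy

theorem commute_of_disjoint {d : ℕ} {S T : Finset ℤ} {X Y : Obs d} (hX : X ∈ opsOn S)
    (hY : Y ∈ opsOn T) (h : Disjoint S T) : Commute X Y :=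
  commute_of_off hX fun _ hi => off_of_mem hY (Finset.disjoint_left.1 h hi)

theorem lie_eq_zero_of_off {d : ℕ} {S : Finset ℤ} {X Y : Obs d} (hX : X ∈ opsOn S)
    (hY : ∀ i ∈ S, Off i Y) : ⁅X, Y⁆ = 0 :=
  commute_iff_lie_eq.1 (commute_of_off hX hY)

theorem lie_eq_zero_of_disjoint {d : ℕ} {S T : Finset ℤ} {X Y : Obs d} (hX : X ∈ opsOn S)
    (hY : Y ∈ opsOn T) (h : Disjoint S T) : ⁅X, Y⁆ = 0 :=
  commute_iff_lie_eq.1 (commute_of_disjoint hX hY h)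

theorem slice_mem {d : ℕ} {S : Finset ℤ} {X : Obs d} (hX : X ∈ opsOn S) (i : ℤ) (k l : Fin d) :
    slice i k l X ∈ opsOn (S.erase i) := by
  induction hX using Algebra.adjoin_induction generalizing k l with
  | mem x hx =>
    obtain ⟨j, hj, m, n, rfl⟩ := hx
    by_cases h : i = j
    · subst h
      rw [slice_siteUnit]
      split_ifs
      exacts [one_mem _, zero_mem _]
    · rw [slice_of_off (off_siteUnit h _ _)]
      split_ifs
      exacts [siteUnit_mem (Finset.mem_erase.2 ⟨Ne.symm h, hj⟩) _ _, zero_mem _]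
  | algebraMap r =>
    rw [slice_of_off fun _ _ => (Algebra.commutes r _).symm]
    split_ifs
    exacts [Subalgebra.algebraMap_mem _ _, zero_mem _]
  | add x y _ _ hx hy => rw [map_add]; exact add_mem (hx _ _) (hy _ _)
  | mul x y _ _ hx hy =>
    rw [slice_mul]; exact sum_mem fun r _ => mul_mem (hx _ _) (hy _ _)

/-! ### Partial traces -/

/-- The normalized partial trace over the site `i`, tensored with the identity. -/
noncomputable def siteAvg {d : ℕ} (i : ℤ) : Module.End ℂ (Obs d) :=
  (d : ℂ)⁻¹ • ∑ k, slice i k k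

theorem siteAvg_apply {d : ℕ} (i : ℤ) (X : Obs d) :
    siteAvg i X = (d : ℂ)⁻¹ • ∑ k, slice i k k X := by
  simp [siteAvg, LinearMap.sum_apply]

theorem siteAvg_of_off {d : ℕ} [NeZero d] {i : ℤ} {X : Obs d} (hX : Off i X) : siteAvg i X = X := by
  have : (d : ℂ) ≠ 0 := Nat.cast_ne_zero.2 (NeZero.ne d)
  simp [siteAvg_apply, slice_of_off hX, ← Nat.cast_smul_eq_nsmul ℂ, smul_smul, this]

theorem siteAvg_mem {d : ℕ} {S : Finset ℤ} {X : Obs d} (hX : X ∈ opsOn S) (i : ℤ) :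
    siteAvg i X ∈ opsOn (S.erase i) := by
  rw [siteAvg_apply]
  exact Subalgebra.smul_mem _ (sum_mem fun k _ => slice_mem hX i k k) _

theorem off_siteAvg {d : ℕ} (i : ℤ) (X : Obs d) : Off i (siteAvg i X) := by
  rw [siteAvg_apply]
  exact (Off.sum fun k _ => off_slice i k k X).smul _

theorem Off.siteAvg {d : ℕ} {i : ℤ} {X : Obs d} (hX : Off i X) (j : ℤ) : Off i (siteAvg j X) := by
  rw [siteAvg_apply]
  exact (Off.sum fun k _ => hX.slice j k k).smul _

theorem siteAvg_mul_left {d : ℕ} {i : ℤ} {X : Obs d} (hX : Off i X) (Y : Obs d) :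
    siteAvg i (X * Y) = X * siteAvg i Y := by
  simp [siteAvg_apply, slice_mul_of_off_left hX, Finset.mul_sum]

theorem siteAvg_mul_right {d : ℕ} {i : ℤ} {Y : Obs d} (hY : Off i Y) (X : Obs d) :
    siteAvg i (X * Y) = siteAvg i X * Y := by
  simp [siteAvg_apply, slice_mul_of_off_right hY, Finset.sum_mul]

theorem siteAvg_lie_left {d : ℕ} {i : ℤ} {X : Obs d} (hX : Off i X) (Y : Obs d) :
    siteAvg i ⁅X, Y⁆ = ⁅X, siteAvg i Y⁆ := by
  simp [LieRing.of_associative_ring_bracket, siteAvg_mul_left hX, siteAvg_mul_right hX]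

theorem siteAvg_lie_right {d : ℕ} {i : ℤ} {Y : Obs d} (hY : Off i Y) (X : Obs d) :
    siteAvg i ⁅X, Y⁆ = ⁅siteAvg i X, Y⁆ := by
  simp [LieRing.of_associative_ring_bracket, siteAvg_mul_left hY, siteAvg_mul_right hY]

theorem siteAvg_comm {d : ℕ} (i j : ℤ) (X : Obs d) :
    siteAvg i (siteAvg j X) = siteAvg j (siteAvg i X) := by
  by_cases h : i = j
  · rw [h]
  · simp only [siteAvg_apply, map_smul, map_sum, slice_slice_comm h]
    simp only [← Finset.smul_sum]
    rw [Finset.sum_comm]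

theorem siteAvg_idem {d : ℕ} [NeZero d] (i : ℤ) (X : Obs d) :
    siteAvg i (siteAvg i X) = siteAvg i X := siteAvg_of_off (off_siteAvg i X)

theorem siteAvg_cyc {d : ℕ} (i : ℤ) (k l : Fin d) (Y : Obs d) :
    siteAvg i (siteUnit i k l * Y) = siteAvg i (Y * siteUnit i k l) := by
  simp [siteAvg_apply, slice_mul, slice_siteUnit, ite_and]

theorem siteAvg_commute {d : ℕ} (i j : ℤ) :
    Commute (siteAvg i : Module.End ℂ (Obs d)) (siteAvg j) :=
  LinearMap.ext (siteAvg_comm i j)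

theorem siteAvg_pairwise {d : ℕ} (S : Finset ℤ) :
    (S : Set ℤ).Pairwise (Function.onFun Commute (siteAvg : ℤ → Module.End ℂ (Obs d))) :=
  fun i _ j _ _ => siteAvg_commute i j

/-- The normalized partial trace over the sites of `S`, tensored with the identity. -/
noncomputable def avg {d : ℕ} (S : Finset ℤ) : Module.End ℂ (Obs d) :=
  S.noncommProd siteAvg (siteAvg_pairwise S)

@[simp] theorem avg_empty {d : ℕ} (X : Obs d) : avg ∅ X = X := by
  simp [avg]

theorem avg_insert {d : ℕ} {S : Finset ℤ} {i : ℤ} (h : i ∉ S) (X : Obs d) :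
    avg (insert i S) X = siteAvg i (avg S X) := by
  rw [avg, Finset.noncommProd_insert_of_notMem _ _ _ _ h]; rfl

theorem avg_singleton {d : ℕ} (i : ℤ) (X : Obs d) : avg {i} X = siteAvg i X := by
  simp [avg]

theorem avg_siteAvg {d : ℕ} (S : Finset ℤ) (i : ℤ) (X : Obs d) :
    avg S (siteAvg i X) = siteAvg i (avg S X) := by
  induction S using Finset.induction_on with
  | empty => simp
  | insert j S h ih => rw [avg_insert h, avg_insert h, ih, siteAvg_comm]

theorem avg_union {d : ℕ} {S T : Finset ℤ} (h : Disjoint S T) (X : Obs d) :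
    avg (S ∪ T) X = avg S (avg T X) := by
  induction S using Finset.induction_on with
  | empty => simp
  | insert i S hi ih =>
    rw [Finset.disjoint_insert_left] at h
    rw [Finset.insert_union, avg_insert (by simp [hi, h.1]), ih h.2, avg_insert hi]

theorem avg_mem {d : ℕ} {T : Finset ℤ} {X : Obs d} (hX : X ∈ opsOn T) (S : Finset ℤ) :
    avg S X ∈ opsOn (T \ S) := by
  induction S using Finset.induction_on with
  | empty => simpa
  | insert i S hi ih =>
    rw [avg_insert hi]
    have := siteAvg_mem ih i
    rwa [← Finset.sdiff_insert] at this

theorem avg_of_off {d : ℕ} [NeZero d] {S : Finset ℤ} {X : Obs d} (hX : ∀ i ∈ S, Off i X) :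
    avg S X = X := by
  induction S using Finset.induction_on with
  | empty => simp
  | insert j S hj ih =>
    rw [avg_insert hj, ih fun i hi => hX i (Finset.mem_insert_of_mem hi),
      siteAvg_of_off (hX j (Finset.mem_insert_self _ _))]

theorem avg_of_mem {d : ℕ} [NeZero d] {S T : Finset ℤ} {X : Obs d} (hX : X ∈ opsOn T)
    (h : Disjoint S T) : avg S X = X :=
  avg_of_off fun _ hi => off_of_mem hX (Finset.disjoint_left.1 h hi)

theorem avg_lie_left {d : ℕ} {S : Finset ℤ} {X : Obs d} (hX : ∀ i ∈ S, Off i X) (Y : Obs d) :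
    avg S ⁅X, Y⁆ = ⁅X, avg S Y⁆ := by
  induction S using Finset.induction_on with
  | empty => simp
  | insert j S hj ih =>
    rw [avg_insert hj, avg_insert hj, ih fun i hi => hX i (Finset.mem_insert_of_mem hi),
      siteAvg_lie_left (hX j (Finset.mem_insert_self _ _))]

theorem avg_eq_siteAvg_erase {d : ℕ} {S : Finset ℤ} {i : ℤ} (h : i ∈ S) (X : Obs d) :
    avg S X = avg (S.erase i) (siteAvg i X) := by
  conv_lhs => rw [← Finset.insert_erase h]
  rw [avg_insert (by simp), avg_siteAvg]

theorem avg_eq_zero {d : ℕ} {S : Finset ℤ} {i : ℤ} (h : i ∈ S) {X : Obs d}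
    (hX : siteAvg i X = 0) : avg S X = 0 := by
  rw [avg_eq_siteAvg_erase h, hX, map_zero]

/-- Only one factor has to live on the traced sites: its generating matrix units can be moved around
one at a time, whatever the other factor is. The resulting vanishing of traced commutators is what
makes windows immaterial later. -/
theorem avg_cyc {d : ℕ} {S : Finset ℤ} {X : Obs d} (hX : X ∈ opsOn S) (Y : Obs d) :
    avg S (X * Y) = avg S (Y * X) := by
  induction hX using Algebra.adjoin_induction generalizing Y with
  | mem x hx =>
    obtain ⟨j, hj, k, l, rfl⟩ := hx
    rw [avg_eq_siteAvg_erase hj, siteAvg_cyc, ← avg_eq_siteAvg_erase hj]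
  | algebraMap r => rw [Algebra.commutes]
  | add x y _ _ hx hy => rw [add_mul, mul_add, map_add, map_add, hx, hy]
  | mul x y _ _ hx hy => rw [mul_assoc, hx, mul_assoc, hy, mul_assoc]

theorem avg_lie_eq_zero {d : ℕ} {S : Finset ℤ} {X : Obs d} (hX : X ∈ opsOn S) (Y : Obs d) :
    avg S ⁅X, Y⁆ = 0 := by
  rw [LieRing.of_associative_ring_bracket, map_sub, avg_cyc hX, sub_self]

theorem avg_lie_eq_zero_of_subset {d : ℕ} {S T : Finset ℤ} {X : Obs d} (hX : X ∈ opsOn S)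
    (h : S ⊆ T) (Y : Obs d) : avg T ⁅X, Y⁆ = 0 :=
  avg_lie_eq_zero (opsOn_mono h hX) Y

theorem avg_avg_of_subset {d : ℕ} {S T : Finset ℤ} (h : S ⊆ T) (X : Obs d) :
    avg T X = avg S (avg (T \ S) X) := by
  rw [← avg_union Finset.disjoint_sdiff, Finset.union_sdiff_of_subset h]


/-! ### Matrices on a finite set of sites as elements of the common algebra -/

/-- The configuration that is `t` on `S` and `x` elsewhere. -/
def patch {d : ℕ} (S : Finset ℤ) (x : ℤ → Fin d) (t : S → Fin d) : ℤ → Fin d :=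
  fun i => if h : i ∈ S then t ⟨i, h⟩ else x i

theorem patch_mem {d : ℕ} {S : Finset ℤ} (x : ℤ → Fin d) (t : S → Fin d) {i : ℤ} (h : i ∈ S) :
    patch S x t i = t ⟨i, h⟩ := dif_pos h

@[simp] theorem patch_coe {d : ℕ} {S : Finset ℤ} (x : ℤ → Fin d) (t : S → Fin d) (i : S) :
    patch S x t i = t i := patch_mem x t i.2

theorem patch_notMem {d : ℕ} {S : Finset ℤ} (x : ℤ → Fin d) (t : S → Fin d) {i : ℤ} (h : i ∉ S) :
    patch S x t i = x i := dif_neg h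

@[simp] theorem patch_patch {d : ℕ} {S : Finset ℤ} (x : ℤ → Fin d) (r t : S → Fin d) :
    patch S (patch S x r) t = patch S x t := by
  funext i; by_cases h : i ∈ S <;> simp [patch, h]

@[simp] theorem patch_self {d : ℕ} {S : Finset ℤ} (x : ℤ → Fin d) :
    patch S x (fun a => x a) = x := by
  funext i; by_cases h : i ∈ S <;> simp [patch, h]

/-- The action of an operator on the sites of `S`. -/
def loc {d : ℕ} (S : Finset ℤ) : LocOp d S →ₐ[ℂ] Obs d :=
  AlgHom.ofLinearMap
    { toFun X :=
        { toFun f x := ∑ t, X (fun a => x a) t * f (patch S x t)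
          map_add' f g := by ext x; simp [mul_add, Finset.sum_add_distrib]
          map_smul' c f := by ext x; simp [Finset.mul_sum, mul_left_comm] }
      map_add' X Y := by
        refine LinearMap.ext fun f => funext fun x => ?_
        simp [add_mul, Finset.sum_add_distrib]
      map_smul' c X := by
        refine LinearMap.ext fun f => funext fun x => ?_
        simp [Finset.mul_sum, mul_assoc] }
    (by
      refine LinearMap.ext fun f => funext fun x => ?_
      simp [Matrix.one_apply])
    (by
      intro X Y
      refine LinearMap.ext fun f => funext fun x => ?_
      simp only [Matrix.mul_apply, LinearMap.coe_mk, AddHom.coe_mk, Module.End.mul_apply,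
        patch_coe, patch_patch, Finset.sum_mul, Finset.mul_sum]
      rw [Finset.sum_comm]
      simp only [mul_assoc])

theorem loc_apply {d : ℕ} {S : Finset ℤ} (X : LocOp d S) (f : (ℤ → Fin d) → ℂ) (x : ℤ → Fin d) :
    loc S X f x = ∑ t, X (fun a => x a) t * f (patch S x t) := rfl

theorem loc_injective {d : ℕ} [NeZero d] (S : Finset ℤ) : Function.Injective (loc (d := d) S) := by
  classical
  rw [injective_iff_map_eq_zero]
  intro X hX
  ext s t
  have h := congrFun (LinearMap.congr_fun hX (fun y => if (fun a : S => y a) = t then 1 else 0))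
    (patch S (fun _ => 0) s)
  rw [loc_apply] at h
  simpa using h

theorem loc_lie {d : ℕ} {S : Finset ℤ} (X Y : LocOp d S) : loc S ⁅X, Y⁆ = ⁅loc S X, loc S Y⁆ := by
  simp [Ring.lie_def]

/-- The reason for working in a common algebra: embeddings between different sets of sites become
invisible. -/
theorem loc_embed {d : ℕ} {A B : Finset ℤ} (h : A ⊆ B) (X : LocOp d A) :
    loc B (embed h X) = loc A X := by
  classical
  refine LinearMap.ext fun f => funext fun x => ?_
  simp only [loc_apply, embed, ite_mul, zero_mul]
  rw [← Finset.sum_filter]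
  refine Finset.sum_bij' (fun t _ => fun a : A => t ⟨a.1, h a.2⟩) (fun t _ => fun b => patch A x t b)
    ?_ ?_ ?_ ?_ ?_
  · simp
  · intro t _
    simp only [Finset.mem_filter, Finset.mem_univ, true_and]
    intro i hi
    rw [patch_notMem _ _ hi]
  · intro t ht
    simp only [Finset.mem_filter, Finset.mem_univ, true_and] at ht
    funext b
    by_cases hb : b.1 ∈ A
    · rw [patch_mem _ _ hb]
    · rw [patch_notMem _ _ hb, ht b hb]
  · intro t _
    funext a
    simp
  · intro t ht
    simp only [Finset.mem_filter, Finset.mem_univ, true_and] at ht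
    congr 2
    funext i
    by_cases hA : i ∈ A
    · rw [patch_mem _ _ hA, patch_mem _ _ (h hA)]
    · by_cases hB : i ∈ B
      · rw [patch_notMem _ _ hA, patch_mem _ _ hB, ht ⟨i, hB⟩ hA]
      · rw [patch_notMem _ _ hA, patch_notMem _ _ hB]

theorem opsOn_le_range {d : ℕ} (S : Finset ℤ) : opsOn (d := d) S ≤ (loc S).range := by
  classical
  refine Algebra.adjoin_le ?_
  rintro _ ⟨i, hi, k, l, rfl⟩
  refine ⟨Matrix.of fun s t =>
    if s ⟨i, hi⟩ = k ∧ t = Function.update s ⟨i, hi⟩ l then 1 else 0, ?_⟩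
  refine LinearMap.ext fun f => funext fun x => ?_
  change loc S _ f x = _
  rw [loc_apply, siteUnit_apply]
  by_cases h : x i = k
  · simp only [Matrix.of_apply, h, true_and, ite_mul, one_mul, zero_mul, Finset.sum_ite_eq', Finset.mem_univ,
      if_true]
    congr 1
    funext j
    by_cases hj : j ∈ S
    · rw [patch_mem _ _ hj]
      by_cases hji : j = i
      · subst hji; simp
      · rw [Function.update_of_ne hji, Function.update_of_ne (by simpa using hji)]
    · rw [patch_notMem _ _ hj, Function.update_of_ne (fun h => hj (by rwa [h]))]
  · simp [h]

theorem exists_loc_eq {d : ℕ} {S : Finset ℤ} {X : Obs d} (hX : X ∈ opsOn S) :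
    ∃ Y : LocOp d S, loc S Y = X := opsOn_le_range S hX

/-- A product of one-site matrix units over `S` is a matrix unit of the full matrix algebra on `S`;
`loc_mem` expands a matrix in these. -/
theorem loc_single_mem {d : ℕ} (S : Finset ℤ) (s t : ℤ → Fin d) :
    ∃ W ∈ opsOn (d := d) S, ∀ f x, W f x =
      if ∀ i ∈ S, x i = s i then f (S.piecewise t x) else 0 := by
  classical
  induction S using Finset.induction_on with
  | empty => exact ⟨1, one_mem _, by simp⟩
  | insert i S hi ih =>
    obtain ⟨W, hW, hWf⟩ := ih
    refine ⟨siteUnit i (s i) (t i) * W, mul_mem (siteUnit_mem (Finset.mem_insert_self _ _) _ _)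
      (opsOn_mono (Finset.subset_insert _ _) hW), fun f x => ?_⟩
    rw [Module.End.mul_apply, siteUnit_apply, hWf]
    have h1 : (∀ j ∈ S, Function.update x i (t i) j = s j) ↔ ∀ j ∈ S, x j = s j := by
      refine forall₂_congr fun j hj => ?_
      rw [Function.update_of_ne (fun h => hi (by rwa [← h]))]
    have h2 : S.piecewise t (Function.update x i (t i)) = (insert i S).piecewise t x := by
      rw [Finset.piecewise_insert]
      funext j
      by_cases hj : j = i
      · subst hj; simp [hi]
      · by_cases hjS : j ∈ S <;> simp [hj, hjS]
    simp only [h1, h2, Finset.forall_mem_insert, ite_and]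

theorem loc_mem {d : ℕ} [NeZero d] {S : Finset ℤ} (X : LocOp d S) : loc S X ∈ opsOn S := by
  classical
  have hX : X = ∑ s, ∑ t, X s t • Matrix.single s t 1 := by
    conv_lhs => rw [Matrix.matrix_eq_sum_single X]
    simp [Matrix.smul_single]
  rw [hX]
  simp only [map_sum, map_smul]
  refine sum_mem fun s _ => sum_mem fun t _ => Subalgebra.smul_mem _ ?_ _
  obtain ⟨W, hW, hWf⟩ := loc_single_mem S (patch S (fun _ => 0) s) (patch S (fun _ => 0) t)
  convert hW using 1
  refine LinearMap.ext fun f => funext fun x => ?_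
  rw [hWf, loc_apply]
  have h1 : (∀ i ∈ S, x i = patch S (fun _ => 0) s i) ↔ s = fun a : S => x a := by
    constructor
    · intro h; funext a; rw [h a a.2, patch_coe]
    · rintro rfl i hi; rw [patch_mem _ _ hi]
  have h2 : S.piecewise (patch S (fun _ => 0) t) x = patch S x t := by
    funext i
    by_cases hi : i ∈ S
    · rw [Finset.piecewise_eq_of_mem _ _ _ hi, patch_mem _ _ hi, patch_mem _ _ hi]
    · rw [Finset.piecewise_eq_of_notMem _ _ _ hi, patch_notMem _ _ hi]
  simp [h1, h2, Matrix.single_apply, ite_and]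

theorem siteAvg_loc {d : ℕ} {S : Finset ℤ} (a : S) (X : LocOp d S) :
    siteAvg a.1 (loc S X) = loc S (Matrix.of fun s t => if s a = t a then
      (d : ℂ)⁻¹ * ∑ k, X (Function.update s a k) (Function.update t a k) else 0) := by
  classical
  refine LinearMap.ext fun f => funext fun x => ?_
  have hupd : ∀ k, (fun b : S => Function.update x a.1 k b) =
      Function.update (fun b : S => x b) a k := by
    intro k; funext b
    by_cases hb : b = a
    · subst hb; simp
    · rw [Function.update_of_ne hb, Function.update_of_ne fun h => hb (Subtype.ext h)]
  have hpatch : ∀ k (t : S → Fin d), Function.update (patch S (Function.update x a.1 k) t) a.1 (x a)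
      = patch S x (Function.update t a (x a)) := by
    intro k t; funext i
    by_cases hi : i ∈ S
    · rw [patch_mem _ _ hi]
      by_cases hb : (⟨i, hi⟩ : S) = a
      · subst hb; simp
      · rw [Function.update_of_ne hb, Function.update_of_ne fun h => hb (Subtype.ext h),
          patch_mem _ _ hi]
    · have : i ≠ a.1 := fun h => hi (h ▸ a.2)
      rw [patch_notMem _ _ hi, Function.update_of_ne this, patch_notMem _ _ hi,
        Function.update_of_ne this]
  have hslice : ∀ k, slice a.1 k k (loc S X) f x = ∑ t : S → Fin d, if t a = x a then
      X (Function.update (fun b : S => x b) a k) (Function.update t a k) * f (patch S x t)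
      else 0 := by
    intro k
    simp only [slice_apply, LinearMap.sum_apply, Finset.sum_apply, Module.End.mul_apply,
      siteUnit_apply, Finset.sum_ite_eq, Finset.mem_univ, if_true, loc_apply, patch_coe, hpatch,
      hupd, mul_ite, mul_zero]
    rw [← Finset.sum_filter, ← Finset.sum_filter]
    refine Finset.sum_bij' (fun t _ => Function.update t a (x a)) (fun t _ => Function.update t a k)
      ?_ ?_ ?_ ?_ ?_
    · simp
    · simp
    · intro t ht
      simp only [Finset.mem_filter, Finset.mem_univ, true_and] at ht
      simp [← ht]
    · intro t ht
      simp only [Finset.mem_filter, Finset.mem_univ, true_and] at ht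
      simp [← ht]
    · intro t ht
      simp only [Finset.mem_filter, Finset.mem_univ, true_and] at ht
      simp [← ht]
  rw [siteAvg_apply]
  simp only [LinearMap.smul_apply, LinearMap.sum_apply, Pi.smul_apply, Finset.sum_apply, hslice,
    smul_eq_mul]
  rw [loc_apply]
  simp only [Matrix.of_apply]
  rw [Finset.sum_comm, Finset.mul_sum]
  refine Finset.sum_congr rfl fun t _ => ?_
  by_cases h : t a = x a
  · simp [h, Finset.mul_sum, Finset.sum_mul, mul_assoc]
  · simp [h, Ne.symm h]

theorem isTraceless_iff {d : ℕ} [NeZero d] {S : Finset ℤ} (X : LocOp d S) :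
    IsTraceless X ↔ ∀ a ∈ S, siteAvg a (loc S X) = 0 := by
  have hd : (d : ℂ)⁻¹ ≠ 0 := inv_ne_zero (Nat.cast_ne_zero.2 (NeZero.ne d))
  constructor
  · intro h a ha
    rw [siteAvg_loc ⟨a, ha⟩]
    convert map_zero (loc S) using 2
    ext s t
    simp only [Matrix.of_apply, Matrix.zero_apply, h ⟨a, ha⟩ s t, mul_zero, ite_self]
  · intro h a s t
    have h1 := h a a.2
    rw [siteAvg_loc, ← map_zero (loc S)] at h1
    have h2 := congrFun (congrFun (loc_injective S h1) s) (Function.update t a (s a))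
    simpa [hd] using h2

/-! ### Decomposition into traceless components -/

theorem embed_reduce {d : ℕ} {A B C : Finset ℤ} (hCA : C ⊆ A) (hAB : A ⊆ B) (Y : LocOp d B) :
    embed hAB (reduce A C Y) = reduce B C Y := by
  ext s t
  have hglue : ∀ (w : B → Fin d) (u : B → Fin d),
      glue C (fun a : A => w ⟨a.1, hAB a.2⟩) u = glue C w u := by
    intro w u; funext b
    by_cases hb : b.1 ∈ C
    · simp [glue, hb, hCA hb]
    · simp [glue, hb]
  simp only [embed, reduce, hglue, ← ite_and]
  refine if_congr ⟨?_, ?_⟩ rfl rfl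
  · rintro ⟨h1, h2⟩ i hi
    by_cases hA : i.1 ∈ A
    · exact h2 ⟨i.1, hA⟩ hi
    · exact h1 i hA
  · exact fun h => ⟨fun i hi => h i fun hC => hi (hCA hC), fun i hi => h ⟨i.1, hAB i.2⟩ hi⟩

theorem reduce_self {d : ℕ} [NeZero d] {B : Finset ℤ} (Y : LocOp d B) : reduce B B Y = Y := by
  have hd : (d : ℂ) ≠ 0 := Nat.cast_ne_zero.2 (NeZero.ne d)
  ext s t
  have hglue : ∀ (w : B → Fin d) (u : B → Fin d), glue B w u = w := by
    intro w u; funext b; simp [glue]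
  simp [reduce, hglue, hd]

/-- Möbius inversion on the lattice of subsets: after exchanging the sums, the coefficient of `r C`
is an alternating sum over the subsets of `B \ C`, which is zero unless `C = B`. -/
theorem sum_powerset_sdiff {R : Type*} [AddCommGroup R] [Module ℂ R] (B : Finset ℤ)
    (r : Finset ℤ → R) :
    ∑ A ∈ B.powerset, ∑ C ∈ A.powerset, (-1 : ℂ) ^ (A \ C).card • r C = r B := by
  have h1 : ∑ A ∈ B.powerset, ∑ C ∈ A.powerset, (-1 : ℂ) ^ (A \ C).card • r C
      = ∑ C ∈ B.powerset, ∑ D ∈ (B \ C).powerset, (-1 : ℂ) ^ D.card • r C := by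
    rw [Finset.sum_sigma', Finset.sum_sigma']
    refine Finset.sum_bij' (fun p _ => ⟨p.2, p.1 \ p.2⟩) (fun p _ => ⟨p.1 ∪ p.2, p.1⟩) ?_ ?_ ?_ ?_ ?_
    · rintro ⟨A, C⟩ h
      simp only [Finset.mem_sigma, Finset.mem_powerset] at h ⊢
      exact ⟨h.2.trans h.1, Finset.sdiff_subset_sdiff h.1 le_rfl⟩
    · rintro ⟨C, D⟩ h
      simp only [Finset.mem_sigma, Finset.mem_powerset] at h ⊢
      exact ⟨Finset.union_subset h.1 (h.2.trans Finset.sdiff_subset), Finset.subset_union_left⟩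
    · rintro ⟨A, C⟩ h
      simp only [Finset.mem_sigma, Finset.mem_powerset] at h ⊢
      simp [Finset.union_sdiff_of_subset h.2]
    · rintro ⟨C, D⟩ h
      simp only [Finset.mem_sigma, Finset.mem_powerset] at h ⊢
      have hdisj : Disjoint C D :=
        Finset.disjoint_left.2 fun x hx hx' => (Finset.mem_sdiff.1 (h.2 hx')).2 hx
      simp [Finset.union_sdiff_cancel_left hdisj]
    · rintro ⟨A, C⟩ _
      rfl
  have h2 : ∀ P : Finset ℤ, ∑ D ∈ P.powerset, (-1 : ℂ) ^ D.card = if P = ∅ then 1 else 0 := by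
    intro P
    have := congrArg (Int.cast : ℤ → ℂ) (Finset.sum_powerset_neg_one_pow_card (x := P))
    push_cast at this
    simpa using this
  rw [h1]
  simp only [← Finset.sum_smul, h2, Finset.sdiff_eq_empty_iff_subset]
  rw [Finset.sum_eq_single B]
  · simp
  · intro C hC hne
    rw [if_neg, zero_smul]
    exact fun h => hne (Finset.Subset.antisymm (Finset.mem_powerset.1 hC) h)
  · simp

theorem sum_loc_component {d : ℕ} [NeZero d] (B : Finset ℤ) (Y : LocOp d B) :
    ∑ A ∈ B.powerset, loc A (component A Y) = loc B Y := by
  have : ∀ A ∈ B.powerset, loc A (component A Y)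
      = ∑ C ∈ A.powerset, (-1 : ℂ) ^ (A \ C).card • loc B (reduce B C Y) := by
    intro A hA
    rw [component, map_sum]
    refine Finset.sum_congr rfl fun C hC => ?_
    rw [map_smul, ← embed_reduce (Finset.mem_powerset.1 hC) (Finset.mem_powerset.1 hA), loc_embed]
  rw [Finset.sum_congr rfl this, sum_powerset_sdiff B fun C => loc B (reduce B C Y), reduce_self]

/-! ### Translations -/

/-- Translation of configurations by `x` sites. -/
def shiftConfig (d : ℕ) (x : ℤ) : (ℤ → Fin d) ≃ (ℤ → Fin d) where
  toFun c i := c (i + x)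
  invFun c i := c (i - x)
  left_inv c := by simp
  right_inv c := by simp

/-- Translation of operators by `x` sites. -/
def shift {d : ℕ} (x : ℤ) : Obs d ≃ₐ[ℂ] Obs d :=
  (LinearEquiv.funCongrLeft ℂ ℂ (shiftConfig d x)).conjAlgEquiv ℂ

theorem shift_apply {d : ℕ} (x : ℤ) (X : Obs d) (f : (ℤ → Fin d) → ℂ) (c : ℤ → Fin d) :
    shift x X f c = X (fun y => f fun i => y (i - x)) (fun i => c (i + x)) := rfl

theorem shift_siteUnit {d : ℕ} (x i : ℤ) (k l : Fin d) :
    shift x (siteUnit i k l) = siteUnit (i + x) k l := by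
  refine LinearMap.ext fun f => funext fun c => ?_
  rw [shift_apply, siteUnit_apply, siteUnit_apply]
  congr 2
  funext j
  by_cases h : j = i + x
  · subst h; simp
  · rw [Function.update_of_ne h, Function.update_of_ne (by omega)]
    simp

theorem shift_slice {d : ℕ} (x i : ℤ) (k l : Fin d) (X : Obs d) :
    shift x (slice i k l X) = slice (i + x) k l (shift x X) := by
  simp [slice_apply, shift_siteUnit]

theorem shift_siteAvg {d : ℕ} (x i : ℤ) (X : Obs d) :
    shift x (siteAvg i X) = siteAvg (i + x) (shift x X) := by
  simp [siteAvg_apply, shift_slice]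

/-- Translation of a set of sites. -/
def shiftSet (x : ℤ) (S : Finset ℤ) : Finset ℤ := S.map (addRightEmbedding x)

@[simp] theorem mem_shiftSet {x i : ℤ} {S : Finset ℤ} : i ∈ shiftSet x S ↔ i - x ∈ S := by
  simp only [shiftSet, Finset.mem_map, addRightEmbedding_apply]
  exact ⟨by rintro ⟨a, ha, rfl⟩; simpa, fun h => ⟨_, h, by omega⟩⟩

theorem shift_avg {d : ℕ} (x : ℤ) (S : Finset ℤ) (X : Obs d) :
    shift x (avg S X) = avg (shiftSet x S) (shift x X) := by
  induction S using Finset.induction_on with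
  | empty => simp [shiftSet]
  | insert i S hi ih =>
    have : shiftSet x (insert i S) = insert (i + x) (shiftSet x S) := by
      ext j; simp [sub_eq_iff_eq_add]
    rw [this, avg_insert hi, shift_siteAvg, ih, avg_insert (by simpa)]

theorem shift_mem {d : ℕ} {S : Finset ℤ} {X : Obs d} (hX : X ∈ opsOn S) (x : ℤ) :
    shift x X ∈ opsOn (shiftSet x S) := by
  induction hX using Algebra.adjoin_induction with
  | mem y hy =>
    obtain ⟨i, hi, k, l, rfl⟩ := hy
    rw [shift_siteUnit]
    exact siteUnit_mem (by simpa) _ _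
  | algebraMap r => rw [AlgEquiv.commutes]; exact Subalgebra.algebraMap_mem _ _
  | add y z _ _ hy hz => rw [map_add]; exact add_mem hy hz
  | mul y z _ _ hy hz => rw [map_mul]; exact mul_mem hy hz

theorem shift_lie {d : ℕ} (x : ℤ) (X Y : Obs d) : shift x ⁅X, Y⁆ = ⁅shift x X, shift x Y⁆ := by
  simp [Ring.lie_def]

theorem shift_loc {d : ℕ} (x : ℤ) (A : Finset ℤ) (X : LocOp d A) :
    shift x (loc A X) = loc (A.map (addRightEmbedding x)) (Matrix.of fun s t =>
      X (fun a => s ⟨a.1 + x, Finset.mem_map_of_mem (addRightEmbedding x) a.2⟩)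
        (fun a => t ⟨a.1 + x, Finset.mem_map_of_mem (addRightEmbedding x) a.2⟩)) := by
  refine LinearMap.ext fun f => funext fun c => ?_
  rw [shift_apply, loc_apply, loc_apply]
  have hm : ∀ b : (A.map (addRightEmbedding x) : Finset ℤ), b.1 - x ∈ A := fun b =>
    mem_shiftSet.1 b.2
  refine Finset.sum_bij' (fun t _ => fun b => t ⟨b.1 - x, hm b⟩)
    (fun t _ => fun a => t ⟨a.1 + x, Finset.mem_map_of_mem (addRightEmbedding x) a.2⟩) ?_ ?_ ?_ ?_ ?_
  · simp
  · simp
  · intro t _; funext a; simp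
  · intro t _; funext a; simp
  · intro t _
    simp only [Matrix.of_apply, add_sub_cancel_right]
    congr 2
    funext i
    by_cases h : i - x ∈ A
    · rw [patch_mem _ _ h, patch_mem _ _ (show i ∈ A.map _ from mem_shiftSet.2 h)]
    · rw [patch_notMem _ _ h, patch_notMem _ _ (show i ∉ A.map _ from fun h' => h (mem_shiftSet.1 h'))]
      simp


/-! ### Formal operators: components, restrictions and range -/

/-- The component `Φ(A)` as an element of the common operator algebra. -/
def op {d : ℕ} (Φ : FormalOp d) (A : Finset ℤ) : Obs d := loc A (Φ.1 A)

/-- The restriction of `Φ` to `B` as an element of the common operator algebra. -/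
def rs {d : ℕ} (Φ : FormalOp d) (B : Finset ℤ) : Obs d := ∑ A ∈ B.powerset, op Φ A

theorem loc_restrict {d : ℕ} (Φ : FormalOp d) (B : Finset ℤ) : loc B (restrict Φ B) = rs Φ B := by
  rw [restrict, map_sum, rs, ← Finset.sum_attach B.powerset]
  exact Finset.sum_congr rfl fun A _ => loc_embed _ _

@[simp] theorem op_add {d : ℕ} (Φ Ψ : FormalOp d) (A : Finset ℤ) :
    op (Φ + Ψ) A = op Φ A + op Ψ A := map_add (loc A) _ _

@[simp] theorem op_smul {d : ℕ} (c : ℂ) (Φ : FormalOp d) (A : Finset ℤ) :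
    op (c • Φ) A = c • op Φ A := by
  rw [op, op, ← map_smul]; rfl

@[simp] theorem op_zero {d : ℕ} (A : Finset ℤ) : op (0 : FormalOp d) A = 0 := map_zero (loc A)

@[simp] theorem op_neg {d : ℕ} (Φ : FormalOp d) (A : Finset ℤ) : op (-Φ) A = -op Φ A :=
  map_neg (loc A) _

@[simp] theorem op_sub {d : ℕ} (Φ Ψ : FormalOp d) (A : Finset ℤ) :
    op (Φ - Ψ) A = op Φ A - op Ψ A := map_sub (loc A) _ _

@[simp] theorem rs_add {d : ℕ} (Φ Ψ : FormalOp d) (B : Finset ℤ) :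
    rs (Φ + Ψ) B = rs Φ B + rs Ψ B := by simp [rs, Finset.sum_add_distrib]

@[simp] theorem rs_smul {d : ℕ} (c : ℂ) (Φ : FormalOp d) (B : Finset ℤ) :
    rs (c • Φ) B = c • rs Φ B := by simp [rs, Finset.smul_sum]

@[simp] theorem rs_zero {d : ℕ} (B : Finset ℤ) : rs (0 : FormalOp d) B = 0 := by simp [rs]

@[simp] theorem rs_neg {d : ℕ} (Φ : FormalOp d) (B : Finset ℤ) :
    rs (-Φ) B = -rs Φ B := by simp [rs]

@[simp] theorem rs_sub {d : ℕ} (Φ Ψ : FormalOp d) (B : Finset ℤ) :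
    rs (Φ - Ψ) B = rs Φ B - rs Ψ B := by simp [rs]

theorem eq_zero_of_sum_powerset {M : Type*} [AddCommMonoid M] {f : Finset ℤ → M} {B : Finset ℤ}
    (h : ∀ A ⊆ B, ∑ C ∈ A.powerset, f C = 0) : f B = 0 := by
  induction B using Finset.strongInduction with
  | H B ih =>
    have h1 := h B le_rfl
    rwa [Finset.sum_eq_single_of_mem B (Finset.mem_powerset_self B)] at h1
    intro C hC hne
    have hC' := Finset.mem_powerset.1 hC
    exact ih C (hC'.ssubset_of_ne hne) fun A hA => h A (hA.trans hC')

theorem eq_of_sum_powerset {M : Type*} [AddCommGroup M] {f g : Finset ℤ → M} {B : Finset ℤ}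
    (h : ∀ A ⊆ B, ∑ C ∈ A.powerset, f C = ∑ C ∈ A.powerset, g C) : f B = g B := by
  refine sub_eq_zero.1 (eq_zero_of_sum_powerset (f := fun A => f A - g A) fun A hA => ?_)
  rw [Finset.sum_sub_distrib, h A hA, sub_self]

theorem setRange_le_iff {A : Finset ℤ} {n : ℕ} :
    setRange A ≤ n ↔ ∀ a ∈ A, ∀ b ∈ A, b - a < n := by
  unfold setRange
  split_ifs with h
  · constructor
    · intro h' a ha b hb
      have h1 := A.min'_le a ha
      have h2 := A.le_max' b hb
      omega
    · intro h'
      have := h' _ (A.min'_mem h) _ (A.max'_mem h)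
      omega
  · rw [Finset.not_nonempty_iff_eq_empty] at h
    subst h
    simp

theorem mem_nbhd {A : Finset ℤ} {n : ℕ} {c : ℤ} : c ∈ nbhd A n ↔ ∃ a ∈ A, a - n ≤ c ∧ c ≤ a + n := by
  simp [nbhd]

theorem nbhd_mono {A B : Finset ℤ} {m n : ℕ} (h : A ⊆ B) (hmn : m ≤ n) : nbhd A m ⊆ nbhd B n := by
  intro c hc
  obtain ⟨a, ha, h1, h2⟩ := mem_nbhd.1 hc
  exact mem_nbhd.2 ⟨a, h ha, by omega, by omega⟩

section
set_option linter.unusedSectionVars false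
variable {d : ℕ}

/-- All nonzero components of `Φ` have diameter less than `n`. -/
def HasRange (Φ : FormalOp d) (n : ℕ) : Prop :=
  ∀ A, op Φ A ≠ 0 → ∀ a ∈ A, ∀ b ∈ A, b - a < n

theorem HasRange.mono {Φ : FormalOp d} {m n : ℕ} (h : HasRange Φ m) (hmn : m ≤ n) :
    HasRange Φ n := fun A hA a ha b hb => (h A hA a ha b hb).trans_le (by exact_mod_cast hmn)

theorem HasRange.add {Φ Ψ : FormalOp d} {n : ℕ} (hΦ : HasRange Φ n) (hΨ : HasRange Ψ n) :
    HasRange (Φ + Ψ) n := by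
  intro A hA
  by_cases h : op Φ A = 0
  · exact hΨ A fun h' => hA (by simp [h, h'])
  · exact hΦ A h

theorem HasRange.smul {Φ : FormalOp d} {n : ℕ} (hΦ : HasRange Φ n) (c : ℂ) :
    HasRange (c • Φ) n := fun A hA => hΦ A fun h => hA (by simp [h])

theorem HasRange.neg {Φ : FormalOp d} {n : ℕ} (hΦ : HasRange Φ n) :
    HasRange (-Φ) n := fun A hA => hΦ A fun h => hA (by simp [h])

theorem HasRange.sub {Φ Ψ : FormalOp d} {n : ℕ} (hΦ : HasRange Φ n) (hΨ : HasRange Ψ n) :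
    HasRange (Φ - Ψ) n := sub_eq_add_neg Φ Ψ ▸ hΦ.add hΨ.neg

theorem hasRange_zero (n : ℕ) : HasRange (0 : FormalOp d) n := fun A hA => absurd (op_zero A) hA

variable [NeZero d]

theorem op_mem (Φ : FormalOp d) (A : Finset ℤ) : op Φ A ∈ opsOn A := loc_mem _

theorem siteAvg_op (Φ : FormalOp d) {A : Finset ℤ} {a : ℤ} (ha : a ∈ A) :
    siteAvg a (op Φ A) = 0 := (isTraceless_iff _).1 (Φ.2 A) a ha

theorem ext_op {Φ Ψ : FormalOp d} (h : ∀ A, op Φ A = op Ψ A) : Φ = Ψ :=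
  Subtype.ext (funext fun A => loc_injective A (h A))

theorem op_eq_zero_iff {Φ : FormalOp d} {A : Finset ℤ} : op Φ A = 0 ↔ Φ.1 A = 0 :=
  map_eq_zero_iff (loc A) (loc_injective A)

theorem ext_rs {Φ Ψ : FormalOp d} (h : ∀ B, rs Φ B = rs Ψ B) : Φ = Ψ :=
  ext_op fun _ => eq_of_sum_powerset fun A _ => h A

theorem exists_formalOp (f : Finset ℤ → Obs d) (hf : ∀ A, f A ∈ opsOn A)
    (h0 : ∀ A, ∀ a ∈ A, siteAvg a (f A) = 0) : ∃ Φ : FormalOp d, ∀ A, op Φ A = f A := by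
  choose g hg using fun A => exists_loc_eq (hf A)
  refine ⟨⟨g, fun A => (isTraceless_iff _).2 fun a ha => ?_⟩, hg⟩
  rw [hg, h0 A a ha]

/-- Tracing over `S` kills every term that meets `S`, by tracelessness, and fixes the others. Thus
partial traces of restrictions are again restrictions. -/
theorem avg_sum_powerset {f : Finset ℤ → Obs d} {B : Finset ℤ} (hf : ∀ A ⊆ B, f A ∈ opsOn A)
    (h0 : ∀ A ⊆ B, ∀ a ∈ A, siteAvg a (f A) = 0) (S : Finset ℤ) :
    avg S (∑ A ∈ B.powerset, f A) = ∑ A ∈ (B \ S).powerset, f A := by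
  rw [map_sum]
  symm
  have hsub : (B \ S).powerset ⊆ B.powerset := Finset.powerset_mono.2 Finset.sdiff_subset
  rw [← Finset.sum_subset_zero_on_sdiff hsub (f := f) (g := fun A => avg S (f A))]
  · intro A hA
    simp only [Finset.mem_sdiff, Finset.mem_powerset] at hA
    obtain ⟨a, ha, haS⟩ := Finset.not_subset.1 hA.2
    have : a ∈ S := by
      by_contra h
      exact haS (Finset.mem_sdiff.2 ⟨hA.1 ha, h⟩)
    exact avg_eq_zero this (h0 A hA.1 a ha)
  · intro A hA
    rw [Finset.mem_powerset] at hA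
    exact (avg_of_mem (hf A (hA.trans Finset.sdiff_subset))
      (Finset.disjoint_left.2 fun x hx hxA => (Finset.mem_sdiff.1 (hA hxA)).2 hx)).symm

theorem avg_rs (Φ : FormalOp d) (B S : Finset ℤ) : avg S (rs Φ B) = rs Φ (B \ S) :=
  avg_sum_powerset (fun A _ => op_mem Φ A) (fun _ _ _ ha => siteAvg_op Φ ha) S

theorem siteAvg_rs (Φ : FormalOp d) (B : Finset ℤ) (i : ℤ) :
    siteAvg i (rs Φ B) = rs Φ (B.erase i) := by
  rw [← avg_singleton, avg_rs, Finset.sdiff_singleton_eq_erase]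

theorem rs_mem (Φ : FormalOp d) (B : Finset ℤ) : rs Φ B ∈ opsOn B :=
  sum_mem fun A hA => opsOn_mono (Finset.mem_powerset.1 hA) (op_mem Φ A)

theorem opRange_le_iff {Φ : FormalOp d} {n : ℕ} : opRange Φ ≤ n ↔ HasRange Φ n := by
  simp only [opRange, iSup_le_iff, Nat.cast_le, setRange_le_iff, HasRange, Ne, op_eq_zero_iff]

theorem exists_hasRange {Φ : FormalOp d} (h : opRange Φ < ⊤) : ∃ n, HasRange Φ n :=
  ⟨(opRange Φ).toNat, opRange_le_iff.1 (ENat.natCast_toNat h.ne).ge⟩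

/-! ### The commutator of formal operators -/

/-- Enlarging the window of the first operator in a commutator. -/
theorem avg_lie_rs {Φ : FormalOp d} {r : ℕ} (hΦ : HasRange Φ r) {D N B : Finset ℤ}
    (hN : nbhd D r ⊆ N) (hB : N ⊆ B) (Y : Obs d) :
    avg (B \ D) ⁅rs Φ B, Y⁆ = avg (N \ D) ⁅rs Φ N, avg (B \ N) Y⁆ := by
  have hDN : D ⊆ N := (subset_nbhd D r).trans hN
  -- A term of `Φ` that leaves `N` is too short to meet `D`, so it lives entirely on traced sites
  -- and its commutator is killed by cyclicity.
  have h1 : avg (B \ D) ⁅rs Φ B, Y⁆ = avg (B \ D) ⁅rs Φ N, Y⁆ := by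
    rw [← sub_eq_zero, ← map_sub, ← sub_lie]
    have : rs Φ B - rs Φ N = ∑ C ∈ B.powerset \ N.powerset, op Φ C := by
      rw [rs, rs, ← Finset.sum_sdiff (Finset.powerset_mono.2 hB), add_sub_cancel_right]
    rw [this, sum_lie, map_sum]
    refine Finset.sum_eq_zero fun C hC => ?_
    simp only [Finset.mem_sdiff, Finset.mem_powerset] at hC
    by_cases h0 : op Φ C = 0
    · simp [h0]
    by_cases hCD : Disjoint C D
    · exact avg_lie_eq_zero_of_subset (op_mem Φ C)
        (fun c hc => Finset.mem_sdiff.2 ⟨hC.1 hc, Finset.disjoint_left.1 hCD hc⟩) Y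
    · obtain ⟨c, hc, hcD⟩ := Finset.not_disjoint_iff.1 hCD
      refine absurd (fun x hx => hN (mem_nbhd.2 ⟨c, hcD, ?_, ?_⟩)) hC.2
      · have := hΦ C h0 x hx c hc; omega
      · have := hΦ C h0 c hc x hx; omega
  have h2 : B \ D = (N \ D) ∪ (B \ N) := by
    ext x
    simp only [Finset.mem_union, Finset.mem_sdiff]
    have := @hB x
    have := @hDN x
    tauto
  have h3 : Disjoint (N \ D) (B \ N) :=
    Finset.disjoint_left.2 fun x hx hx' => (Finset.mem_sdiff.1 hx').2 (Finset.mem_sdiff.1 hx).1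
  rw [h1, h2, avg_union h3, avg_lie_left]
  exact fun i hi => off_of_mem (rs_mem Φ N) (Finset.mem_sdiff.1 hi).2


theorem avg_loc {B : Finset ℤ} (Y : LocOp d B) {D : Finset ℤ} (h : D ⊆ B) :
    avg (B \ D) (loc B Y) = ∑ A ∈ D.powerset, loc A (component A Y) := by
  rw [← sum_loc_component, avg_sum_powerset, Finset.sdiff_sdiff_eq_self h]
  · exact fun _ _ => loc_mem _
  · exact fun A hA => (isTraceless_iff _).1 (component_isTraceless hA Y)

theorem avg_lie_rs_rs {Φ Ψ : FormalOp d} {r : ℕ} (hΦ : HasRange Φ r) {D N B : Finset ℤ}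
    (hN : nbhd D r ⊆ N) (hB : N ⊆ B) :
    avg (B \ D) ⁅rs Φ B, rs Ψ B⁆ = avg (N \ D) ⁅rs Φ N, rs Ψ N⁆ := by
  rw [avg_lie_rs hΦ hN hB, avg_rs, Finset.sdiff_sdiff_eq_self hB]

/-- Independence of the window in the definition of `comm`: the sums of components over subsets are
partial traces of the commutator, and these do not change when the window grows. -/
theorem loc_component_lie {Φ Ψ : FormalOp d} {r : ℕ} (hΦ : HasRange Φ r) {A N B : Finset ℤ}
    (hN : nbhd A r ⊆ N) (hB : N ⊆ B) :
    loc A (component A ⁅restrict Φ N, restrict Ψ N⁆)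
      = loc A (component A ⁅restrict Φ B, restrict Ψ B⁆) := by
  refine eq_of_sum_powerset
    (f := fun A => loc A (component A ⁅restrict Φ N, restrict Ψ N⁆))
    (g := fun A => loc A (component A ⁅restrict Φ B, restrict Ψ B⁆)) fun D hD => ?_
  have hDN : nbhd D r ⊆ N := (nbhd_mono hD le_rfl).trans hN
  have hD' := (subset_nbhd D r).trans hDN
  rw [← avg_loc _ hD', ← avg_loc _ (hD'.trans hB), loc_lie, loc_lie, loc_restrict, loc_restrict,
    loc_restrict, loc_restrict, avg_lie_rs_rs hΦ hDN hB]

/-- The working description of `comm`: identities between ordinary commutators in one large window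
pass to formal operators by tracing. -/
theorem rs_comm {Φ Ψ : FormalOp d} {r : ℕ} (hΦ : HasRange Φ r) {D B : Finset ℤ}
    (hB : nbhd D r ⊆ B) : rs (comm Φ Ψ) D = avg (B \ D) ⁅rs Φ B, rs Ψ B⁆ := by
  have hr : opRange Φ ≤ r := opRange_le_iff.2 hΦ
  have hr' : (opRange Φ).toNat ≤ r := by
    have := ENat.toNat_le_toNat hr (ENat.natCast_ne_top r)
    simpa using this
  have hΦ' : HasRange Φ (opRange Φ).toNat :=
    opRange_le_iff.1 (ENat.natCast_toNat (hr.trans_lt (ENat.natCast_lt_top r)).ne).ge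
  rw [← loc_restrict Φ, ← loc_restrict Ψ, ← loc_lie, avg_loc _ ((subset_nbhd D r).trans hB), rs]
  refine Finset.sum_congr rfl fun A hA => ?_
  exact loc_component_lie hΦ' le_rfl
    ((nbhd_mono (Finset.mem_powerset.1 hA) hr').trans hB)

theorem rs_comm_comm {Φ Ψ Θ : FormalOp d} {r s : ℕ} (hΦ : HasRange Φ r) (hΨ : HasRange Ψ s)
    {D B : Finset ℤ} (hB : nbhd (nbhd D r) s ⊆ B) :
    rs (comm Φ (comm Ψ Θ)) D = avg (B \ D) ⁅rs Φ B, ⁅rs Ψ B, rs Θ B⁆⁆ := by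
  rw [rs_comm hΦ le_rfl, rs_comm hΨ hB, avg_lie_rs hΦ le_rfl ((subset_nbhd _ s).trans hB)]

theorem comm_antisymm {Φ Ψ : FormalOp d} {r s : ℕ} (hΦ : HasRange Φ r) (hΨ : HasRange Ψ s) :
    comm Φ Ψ = -comm Ψ Φ := by
  refine ext_rs fun D => ?_
  rw [rs_neg, rs_comm hΦ (nbhd_mono le_rfl (le_max_left r s)),
    rs_comm hΨ (nbhd_mono le_rfl (le_max_right r s)), ← map_neg, lie_skew]

theorem comm_smul_right {Φ : FormalOp d} {r : ℕ} (hΦ : HasRange Φ r) (c : ℂ) (Ψ : FormalOp d) :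
    comm Φ (c • Ψ) = c • comm Φ Ψ := by
  refine ext_rs fun D => ?_
  rw [rs_smul, rs_comm hΦ le_rfl, rs_comm hΦ le_rfl, rs_smul, lie_smul, map_smul]

theorem comm_zero_right {Φ : FormalOp d} {r : ℕ} (hΦ : HasRange Φ r) : comm Φ 0 = 0 := by
  simpa using comm_smul_right hΦ 0 0

theorem comm_sub_right {Φ : FormalOp d} {r : ℕ} (hΦ : HasRange Φ r) (Ψ Θ : FormalOp d) :
    comm Φ (Ψ - Θ) = comm Φ Ψ - comm Φ Θ := by
  refine ext_rs fun D => ?_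
  rw [rs_sub, rs_comm hΦ le_rfl, rs_comm hΦ le_rfl, rs_comm hΦ le_rfl, rs_sub, lie_sub, map_sub]

theorem comm_self {Φ : FormalOp d} {r : ℕ} (hΦ : HasRange Φ r) : comm Φ Φ = 0 := by
  refine ext_rs fun D => ?_
  rw [rs_comm hΦ le_rfl, lie_self, map_zero, rs_zero]

/-! ### Extremal components and the leading parts of a commutator -/

/-- The projection onto the operators that are traceless at both sites `i` and `j`. -/
noncomputable def ends (i j : ℤ) : Module.End ℂ (Obs d) := (1 - siteAvg i) * (1 - siteAvg j)

theorem ends_apply (i j : ℤ) (X : Obs d) :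
    ends i j X = X - siteAvg j X - siteAvg i (X - siteAvg j X) := rfl

theorem ends_comm (i j : ℤ) (X : Obs d) : ends i j X = ends j i X := by
  simp only [ends_apply, map_sub, siteAvg_comm i j]; abel

theorem ends_of_off_right {i j : ℤ} {X : Obs d} (h : Off j X) : ends i j X = 0 := by
  simp [ends_apply, siteAvg_of_off h]

theorem ends_of_off_left {i j : ℤ} {X : Obs d} (h : Off i X) : ends i j X = 0 := by
  rw [ends_comm, ends_of_off_right h]

theorem ends_of_traceless {i j : ℤ} {X : Obs d} (hi : siteAvg i X = 0) (hj : siteAvg j X = 0) :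
    ends i j X = X := by
  simp [ends_apply, hi, hj]

theorem siteAvg_ends_left (i j : ℤ) (X : Obs d) : siteAvg i (ends i j X) = 0 := by
  simp [ends_apply, siteAvg_idem]

theorem siteAvg_ends_right (i j : ℤ) (X : Obs d) : siteAvg j (ends i j X) = 0 := by
  rw [ends_comm, siteAvg_ends_left]

theorem avg_ends (S : Finset ℤ) (i j : ℤ) (X : Obs d) :
    avg S (ends i j X) = ends i j (avg S X) := by
  simp [ends_apply, avg_siteAvg]

theorem ends_mem {S : Finset ℤ} {X : Obs d} (hX : X ∈ opsOn S) (i j : ℤ) :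
    ends i j X ∈ opsOn S := by
  have h : ∀ k {Y : Obs d}, Y ∈ opsOn S → siteAvg k Y ∈ opsOn S := fun k Y hY =>
    opsOn_mono (Finset.erase_subset _ _) (siteAvg_mem hY k)
  rw [ends_apply]
  exact sub_mem (sub_mem hX (h _ hX)) (h _ (sub_mem hX (h _ hX)))

/-- The sum of the components of `Φ` whose extreme sites are `i` and `j`. -/
noncomputable def top (Φ : FormalOp d) (i j : ℤ) : Obs d := ends i j (rs Φ (Finset.Icc i j))

theorem ends_op (Φ : FormalOp d) (i j : ℤ) (A : Finset ℤ) :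
    ends i j (op Φ A) = if i ∈ A ∧ j ∈ A then op Φ A else 0 := by
  split_ifs with h
  · exact ends_of_traceless (siteAvg_op Φ h.1) (siteAvg_op Φ h.2)
  · by_cases hi : i ∈ A
    · exact ends_of_off_right (off_of_mem (op_mem Φ A) fun hj => h ⟨hi, hj⟩)
    · exact ends_of_off_left (off_of_mem (op_mem Φ A) hi)

theorem top_eq_sum (Φ : FormalOp d) (i j : ℤ) :
    top Φ i j = ∑ A ∈ (Finset.Icc i j).powerset, if i ∈ A ∧ j ∈ A then op Φ A else 0 := by
  simp only [top, rs, map_sum, ends_op]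

theorem op_eq_zero_of_top {Φ : FormalOp d} {i j : ℤ} (h : top Φ i j = 0) {A : Finset ℤ}
    (hA : A ⊆ Finset.Icc i j) (hi : i ∈ A) (hj : j ∈ A) : op Φ A = 0 := by
  have := eq_zero_of_sum_powerset (f := fun A => if i ∈ A ∧ j ∈ A then op Φ A else 0) (B := A)
    fun C hC => by
      have h1 := congrArg (avg (Finset.Icc i j \ C)) h
      rw [map_zero, top_eq_sum, avg_sum_powerset, Finset.sdiff_sdiff_eq_self (hC.trans hA)] at h1
      · exact h1
      · intro A _
        split_ifs
        exacts [op_mem Φ A, zero_mem _]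
      · intro A _ a ha
        split_ifs
        exacts [siteAvg_op Φ ha, map_zero _]
  simpa [hi, hj] using this

theorem hasRange_of_top {Φ : FormalOp d} {n : ℕ}
    (h : ∀ i j : ℤ, i + n ≤ j → top Φ i j = 0) : HasRange Φ n := by
  intro A hA a ha b hb
  by_contra hab
  have hne : A.Nonempty := ⟨a, ha⟩
  refine hA (op_eq_zero_of_top (h (A.min' hne) (A.max' hne) ?_) (fun x hx => ?_) (A.min'_mem hne)
    (A.max'_mem hne))
  · have h1 := A.min'_le a ha
    have h2 := A.le_max' b hb
    omega
  · exact Finset.mem_Icc.2 ⟨A.min'_le x hx, A.le_max' x hx⟩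

theorem HasRange.top_eq_zero {Φ : FormalOp d} {n : ℕ} (hΦ : HasRange Φ n) {i j : ℤ}
    (h : i + n ≤ j) : top Φ i j = 0 := by
  rw [top_eq_sum]
  refine Finset.sum_eq_zero fun A _ => ?_
  split_ifs with hA
  · by_contra h0
    have := hΦ A h0 i hA.1 j hA.2
    omega
  · rfl

@[simp] theorem top_add (Φ Ψ : FormalOp d) (i j : ℤ) :
    top (Φ + Ψ) i j = top Φ i j + top Ψ i j := by simp [top]

@[simp] theorem top_zero (i j : ℤ) : top (0 : FormalOp d) i j = 0 := by simp [top]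

theorem top_comm {Φ : FormalOp d} {r : ℕ} (hΦ : HasRange Φ r) (Ψ : FormalOp d) (i j : ℤ)
    {B : Finset ℤ} (hB : nbhd (Finset.Icc i j) r ⊆ B) :
    top (comm Φ Ψ) i j = avg (B \ Finset.Icc i j) (ends i j ⁅rs Φ B, rs Ψ B⁆) := by
  rw [top, rs_comm hΦ hB, avg_ends]

/-- Disjoint supports commute, and two overlapping ones of ranges at most `r` and `s` span at most
`r + s - 1` sites. -/
theorem HasRange.comm {Φ Ψ : FormalOp d} {r s n : ℕ} (hΦ : HasRange Φ r) (hΨ : HasRange Ψ s)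
    (h : r + s ≤ n + 1) : HasRange (comm Φ Ψ) n := by
  refine hasRange_of_top fun i j hij => ?_
  rw [top_comm hΦ Ψ i j le_rfl]
  suffices hs : ends i j ⁅rs Φ (nbhd (Finset.Icc i j) r), rs Ψ (nbhd (Finset.Icc i j) r)⁆ = 0 by
    rw [hs, map_zero]
  rw [rs, rs, sum_lie_sum, map_sum]
  refine Finset.sum_eq_zero fun C _ => ?_
  rw [map_sum]
  refine Finset.sum_eq_zero fun C' _ => ?_
  by_cases hC : op Φ C = 0
  · simp [hC]
  by_cases hC' : op Ψ C' = 0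
  · simp [hC']
  by_cases hdisj : Disjoint C C'
  · rw [lie_eq_zero_of_disjoint (op_mem _ _) (op_mem _ _) hdisj, map_zero]
  obtain ⟨c, hc, hc'⟩ := Finset.not_disjoint_iff.1 hdisj
  have hΦC := hΦ C hC
  have hΨC := hΨ C' hC'
  by_cases hi : i ∈ C ∨ i ∈ C'
  · by_cases hj : j ∈ C ∨ j ∈ C'
    · exfalso
      have hij' : i + n ≤ j := hij
      rcases hi with hi | hi <;> rcases hj with hj | hj
      · have := hΦC i hi j hj
        have := hΨC c hc' c hc'
        omega
      · have := hΦC i hi c hc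
        have := hΨC c hc' j hj
        omega
      · have := hΦC c hc j hj
        have := hΨC i hi c hc'
        omega
      · have := hΨC i hi j hj
        have := hΦC c hc c hc
        omega
    · rw [not_or] at hj
      exact ends_of_off_right ((off_of_mem (op_mem _ _) hj.1).lie (off_of_mem (op_mem _ _) hj.2))
  · rw [not_or] at hi
    exact ends_of_off_left ((off_of_mem (op_mem _ _) hi.1).lie (off_of_mem (op_mem _ _) hi.2))

theorem comm_jacobi {Φ Ψ Θ : FormalOp d} {r s t : ℕ} (hΦ : HasRange Φ r) (hΨ : HasRange Ψ s)
    (hΘ : HasRange Θ t) :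
    comm Φ (comm Ψ Θ) = comm (comm Φ Ψ) Θ + comm Ψ (comm Φ Θ) := by
  -- Giving all three operators the same range bound lets one window serve all the double
  -- commutators. The first of them on the right is flipped, since `rs_comm_comm` treats
  -- right-nested brackets.
  have hΦ' : HasRange Φ (r + s + t) := hΦ.mono (by omega)
  have hΨ' : HasRange Ψ (r + s + t) := hΨ.mono (by omega)
  have hΘ' : HasRange Θ (r + s + t) := hΘ.mono (by omega)
  rw [comm_antisymm (hΦ'.comm hΨ' (Nat.le_succ_of_le (Nat.le_succ _))) hΘ']
  refine ext_rs fun D => ?_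
  rw [rs_add, rs_neg, rs_comm_comm hΦ' hΨ' le_rfl, rs_comm_comm hΘ' hΦ' le_rfl,
    rs_comm_comm hΨ' hΦ' le_rfl, leibniz_lie, map_add, ← lie_skew, map_neg]

/-- As `b` is traceless at `q` and `Z` trivial there, tracelessness of the bracket at `q` is
automatic. The part of `Z` that is trivial at `p` commutes with `b`, so `Z` may be made traceless at
`p` for free. -/
theorem ends_lie {i p q : ℤ} {b Z : Obs d} (hb : b ∈ opsOn {p, q}) (hbq : siteAvg q b = 0)
    (hi : Off i b) (hZ : Off q Z) : ends i q ⁅b, Z⁆ = ⁅b, ends i p Z⁆ := by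
  have h1 : ∀ W : Obs d, Off q W → ⁅b, siteAvg p W⁆ = 0 := by
    intro W hW
    refine lie_eq_zero_of_off hb fun k hk => ?_
    rcases Finset.mem_insert.1 hk with rfl | hk
    · exact off_siteAvg _ _
    · rw [Finset.mem_singleton.1 hk]; exact hW.siteAvg p
  have h2 : siteAvg q ⁅b, Z⁆ = 0 := by rw [siteAvg_lie_right hZ, hbq, zero_lie]
  rw [ends_apply, ends_apply, h2, sub_zero, siteAvg_lie_left hi, map_sub, siteAvg_comm i p,
    lie_sub, lie_sub, lie_sub, h1 Z hZ, h1 _ (hZ.siteAvg i)]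
  simp

theorem rs_Icc_right {Φ : FormalOp d} (hΦ : HasRange Φ 2) {i j : ℤ} (hij : i < j) :
    rs Φ (Finset.Icc i j) = rs Φ (Finset.Icc i (j - 1)) + (op Φ {j} + op Φ {j - 1, j}) := by
  have h1 : Finset.Icc i j = insert j (Finset.Icc i (j - 1)) := by
    ext x; simp only [Finset.mem_Icc, Finset.mem_insert]; omega
  rw [rs, h1, Finset.sum_powerset_insert (by simp), ← rs]
  congr 1
  have h2 : ({∅, {j - 1}} : Finset (Finset ℤ)) ⊆ (Finset.Icc i (j - 1)).powerset := by
    intro A hA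
    simp only [Finset.mem_insert, Finset.mem_singleton] at hA
    rcases hA with rfl | rfl
    · simp
    · simp; omega
  rw [← Finset.sum_subset h2, Finset.sum_pair]
  · congr 2; rw [Finset.pair_comm]
  · exact (Finset.singleton_ne_empty _).symm
  · intro A hA hA'
    by_contra h0
    rw [Finset.mem_powerset] at hA
    have hsub : A ⊆ {j - 1} := by
      intro a ha
      have := hΦ _ h0 a (Finset.mem_insert_of_mem ha) j (Finset.mem_insert_self _ _)
      have := Finset.mem_Icc.1 (hA ha)
      simp only [Finset.mem_singleton]
      push_cast at *; omega
    rcases Finset.subset_singleton_iff.1 hsub with rfl | rfl <;> simp at hA'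

theorem rs_Icc_left {Φ : FormalOp d} (hΦ : HasRange Φ 2) {i j : ℤ} (hij : i < j) :
    rs Φ (Finset.Icc i j) = rs Φ (Finset.Icc (i + 1) j) + (op Φ {i} + op Φ {i, i + 1}) := by
  have h1 : Finset.Icc i j = insert i (Finset.Icc (i + 1) j) := by
    ext x; simp only [Finset.mem_Icc, Finset.mem_insert]; omega
  rw [rs, h1, Finset.sum_powerset_insert (by simp), ← rs]
  congr 1
  have h2 : ({∅, {i + 1}} : Finset (Finset ℤ)) ⊆ (Finset.Icc (i + 1) j).powerset := by
    intro A hA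
    simp only [Finset.mem_insert, Finset.mem_singleton] at hA
    rcases hA with rfl | rfl
    · simp
    · simp; omega
  rw [← Finset.sum_subset h2, Finset.sum_pair]
  · rfl
  · exact (Finset.singleton_ne_empty _).symm
  · intro A hA hA'
    by_contra h0
    rw [Finset.mem_powerset] at hA
    have hsub : A ⊆ {i + 1} := by
      intro a ha
      have := hΦ _ h0 i (Finset.mem_insert_self _ _) a (Finset.mem_insert_of_mem ha)
      have := Finset.mem_Icc.1 (hA ha)
      simp only [Finset.mem_singleton]
      push_cast at *; omega
    rcases Finset.subset_singleton_iff.1 hsub with rfl | rfl <;> simp at hA'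

theorem ends_lie_rs_right {Φ : FormalOp d} (hΦ : HasRange Φ 2) {i j : ℤ} (hij : i + 1 < j)
    {X : Obs d} (hX : Off j X) :
    ends i j ⁅rs Φ (Finset.Icc i j), X⁆ = ⁅op Φ {j - 1, j}, ends i (j - 1) X⁆ := by
  rw [rs_Icc_right hΦ (by omega), add_lie, add_lie, map_add, map_add, ends_of_off_right,
    lie_eq_zero_of_off (op_mem Φ {j}) (by simpa using hX), map_zero, zero_add, zero_add]
  · refine ends_lie (op_mem _ _) (siteAvg_op _ (by simp)) (off_of_mem (op_mem _ _) ?_) hX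
    simp only [Finset.mem_insert, Finset.mem_singleton]
    omega
  · exact (off_of_mem (rs_mem _ _) (by simp)).lie hX

theorem ends_lie_rs_left {Φ : FormalOp d} (hΦ : HasRange Φ 2) {i j : ℤ} (hij : i + 1 < j)
    {X : Obs d} (hX : Off i X) :
    ends i j ⁅rs Φ (Finset.Icc i j), X⁆ = ⁅op Φ {i, i + 1}, ends (i + 1) j X⁆ := by
  rw [rs_Icc_left hΦ (by omega), add_lie, add_lie, map_add, map_add, ends_of_off_left,
    lie_eq_zero_of_off (op_mem Φ {i}) (by simpa using hX), map_zero, zero_add, zero_add]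
  · rw [ends_comm, ends_comm (i + 1) j]
    refine ends_lie (by rw [Finset.pair_comm]; exact op_mem _ _) (siteAvg_op _ (by simp))
      (off_of_mem (op_mem _ _) ?_) hX
    simp only [Finset.mem_insert, Finset.mem_singleton]
    omega
  · exact (off_of_mem (rs_mem _ _) (by simp)).lie hX

/-- Inclusion–exclusion splits `X` into a part trivial at `j`, a part trivial at `i`, and a part
traceless at both. In the first two the missing end can only be supplied by the end bond of `Φ`. -/
theorem ends_lie_rs {Φ : FormalOp d} (hΦ : HasRange Φ 2) {i j : ℤ} (hij : i + 1 < j)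
    (X : Obs d) :
    ends i j ⁅rs Φ (Finset.Icc i j), X⁆ = ⁅op Φ {j - 1, j}, ends i (j - 1) (siteAvg j X)⁆
      + ⁅op Φ {i, i + 1}, ends (i + 1) j (siteAvg i X)⁆
      + ends i j ⁅rs Φ (Finset.Icc i j), ends i j X⁆ := by
  have hX : X = siteAvg j X + siteAvg i X - siteAvg i (siteAvg j X) + ends i j X := by
    rw [ends_apply, map_sub]; abel
  conv_lhs => rw [hX]
  rw [lie_add, lie_sub, lie_add, map_add, map_sub, map_add,
    ends_lie_rs_right hΦ hij (off_siteAvg j X), ends_lie_rs_left hΦ hij (off_siteAvg i X),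
    ends_lie_rs_left hΦ hij (off_siteAvg i _), ends_of_off_right ((off_siteAvg j X).siteAvg i),
    lie_zero, sub_zero]

/-- Terms of `Φ` sticking out of the interval do not contribute. Such a term is traceless at the
outside site `i - 1` or `j + 1`, so the term of `Ψ` must contain that site too in order to survive
the trace; but then it is too short to reach the opposite end. -/
theorem top_comm_of_range_two {Φ Ψ : FormalOp d} {k : ℕ} (hΦ : HasRange Φ 2) (hΨ : HasRange Ψ k)
    {i j : ℤ} (hij : i < j) (hk : i + k ≤ j + 1) :
    top (comm Φ Ψ) i j = ends i j ⁅rs Φ (Finset.Icc i j), rs Ψ (Finset.Icc i j)⁆ := by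
  set D := Finset.Icc i j with hD
  set B := nbhd D 2 with hB
  have hDB : D ⊆ B := subset_nbhd D 2
  have hk' : ((k : ℕ) : ℤ) ≤ j + 1 - i := by omega
  have h1 : rs Φ B = rs Φ D + ∑ C ∈ B.powerset \ D.powerset, op Φ C := by
    rw [rs, rs, ← Finset.sum_sdiff (Finset.powerset_mono.2 hDB), add_comm]
  have h2 : avg (B \ D) ⁅rs Φ D, rs Ψ B⁆ = ⁅rs Φ D, rs Ψ D⁆ := by
    rw [avg_lie_left fun x hx => off_of_mem (rs_mem Φ D) (Finset.mem_sdiff.1 hx).2, avg_rs,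
      Finset.sdiff_sdiff_eq_self hDB]
  rw [top, rs_comm hΦ le_rfl, h1, add_lie, map_add, map_add, h2, sum_lie, map_sum, map_sum,
    Finset.sum_eq_zero, add_zero]
  intro C hC
  rw [Finset.mem_sdiff, Finset.mem_powerset, Finset.mem_powerset] at hC
  by_cases h0 : op Φ C = 0
  · simp [h0]
  have hΦC := hΦ C h0
  obtain ⟨c, hcC, hcD⟩ := Finset.not_subset.1 hC.2
  by_cases hCD : Disjoint C D
  · rw [avg_lie_eq_zero_of_subset (op_mem Φ C), map_zero]
    exact fun c hc => Finset.mem_sdiff.2 ⟨hC.1 hc, Finset.disjoint_left.1 hCD hc⟩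
  obtain ⟨c', hc'C, hc'D⟩ := Finset.not_disjoint_iff.1 hCD
  rw [rs, lie_sum, map_sum, map_sum]
  refine Finset.sum_eq_zero fun C' _ => ?_
  by_cases h0' : op Ψ C' = 0
  · simp [h0']
  have hΨC := hΨ C' h0'
  by_cases hcC' : c ∈ C'
  · rw [← avg_ends]
    have e1 := hΦC c hcC c' hc'C
    have e2 := hΦC c' hc'C c hcC
    simp only [hD, Finset.mem_Icc] at hcD hc'D
    push_cast at e1 e2
    have hcases : c = i - 1 ∨ c = j + 1 := by omega
    rcases hcases with rfl | rfl
    · rw [ends_of_off_right, map_zero]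
      refine (off_of_mem (op_mem _ _) fun hj => ?_).lie (off_of_mem (op_mem _ _) fun hj => ?_)
      · have := hΦC _ hcC _ hj; push_cast at this; omega
      · have := hΨC _ hcC' _ hj; omega
    · rw [ends_of_off_left, map_zero]
      refine (off_of_mem (op_mem _ _) fun hi => ?_).lie (off_of_mem (op_mem _ _) fun hi => ?_)
      · have := hΦC _ hi _ hcC; push_cast at this; omega
      · have := hΨC _ hi _ hcC'; omega
  · rw [avg_eq_zero (Finset.mem_sdiff.2 ⟨hC.1 hcC, hcD⟩), map_zero]
    rw [siteAvg_lie_right (off_of_mem (op_mem _ _) hcC'), siteAvg_op Φ hcC, zero_lie]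

/-- The extremal components of a commutator with an operator of range at most two. -/
theorem top_comm_eq {Φ Ψ : FormalOp d} {k : ℕ} (hΦ : HasRange Φ 2) (hΨ : HasRange Ψ k)
    {i j : ℤ} (hij : i + 1 < j) (hk : i + k ≤ j + 1) :
    top (comm Φ Ψ) i j = ⁅op Φ {j - 1, j}, top Ψ i (j - 1)⁆ + ⁅op Φ {i, i + 1}, top Ψ (i + 1) j⁆
      + ends i j ⁅rs Φ (Finset.Icc i j), top Ψ i j⁆ := by
  have h1 : (Finset.Icc i j).erase j = Finset.Icc i (j - 1) := by
    ext x; simp only [Finset.mem_erase, Finset.mem_Icc]; omega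
  have h2 : (Finset.Icc i j).erase i = Finset.Icc (i + 1) j := by
    ext x; simp only [Finset.mem_erase, Finset.mem_Icc]; omega
  rw [top_comm_of_range_two hΦ hΨ (by omega) hk, ends_lie_rs hΦ hij, siteAvg_rs, siteAvg_rs, h1, h2]
  rfl

theorem top_comm_eq_of_range {Φ Ψ : FormalOp d} {k : ℕ} (hΦ : HasRange Φ 2) (hΨ : HasRange Ψ k)
    {i j : ℤ} (hij : i + 1 < j) (hk : i + k ≤ j) :
    top (comm Φ Ψ) i j
      = ⁅op Φ {j - 1, j}, top Ψ i (j - 1)⁆ + ⁅op Φ {i, i + 1}, top Ψ (i + 1) j⁆ := by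
  rw [top_comm_eq hΦ hΨ hij (by omega), hΨ.top_eq_zero hk, lie_zero, map_zero, add_zero]

theorem top_succ {Φ : FormalOp d} (i : ℤ) : top Φ i (i + 1) = op Φ {i, i + 1} := by
  have h : Finset.Icc i (i + 1) = {i, i + 1} := by
    ext x; simp only [Finset.mem_Icc, Finset.mem_insert, Finset.mem_singleton]; omega
  rw [top_eq_sum, h, Finset.sum_eq_single {i, i + 1}]
  · simp
  · intro A hA hne
    rw [if_neg]
    rintro ⟨h1, h2⟩
    refine hne (Finset.Subset.antisymm (Finset.mem_powerset.1 hA) ?_)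
    simp [Finset.insert_subset_iff, h1, h2]
  · simp


/-! ### Injectivity of the bonds and peeling -/

/-- By injectivity, `a ↦ ⁅a, b⁆` on traceless one-site operators has a linear left inverse. It is
applied to the `{p, q}` factor of an operator and the identity to all other sites, so that it
commutes with multiplication by operators elsewhere. -/
theorem exists_partial_inverse {p q : ℤ} (hpq : p ≠ q) {b : Obs d} (hb : b ∈ opsOn {p, q})
    (hinj : ∀ a ∈ opsOn (d := d) {p}, siteAvg p a = 0 → ⁅a, b⁆ = 0 → a = 0) :
    ∃ σ : Obs d →ₗ[ℂ] Obs d,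
      (∀ Z, Off q Z → siteAvg p Z = 0 → σ ⁅Z, b⁆ = Z) ∧
      (∀ W, Off p W → Off q W → ∀ Y, σ (W * Y) = W * σ Y) ∧
      (∀ W, Off p W → Off q W → ∀ Y, σ (Y * W) = σ Y * W) ∧
      (∀ Y, siteAvg p (σ Y) = 0) ∧
      (∀ S Y, p ∈ S → Y ∈ opsOn S → σ Y ∈ opsOn (S.erase q)) := by
  let V : Submodule ℂ (Obs d) := Subalgebra.toSubmodule (opsOn {p}) ⊓ LinearMap.ker (siteAvg p)
  let T : V →ₗ[ℂ] Obs d :=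
    { toFun a := ⁅(a : Obs d), b⁆
      map_add' x y := by simp
      map_smul' c x := by simp }
  have hT : LinearMap.ker T = ⊥ := by
    rw [LinearMap.ker_eq_bot']
    rintro ⟨a, ha, ha'⟩ h
    exact Subtype.ext (hinj a ha ha' h)
  obtain ⟨Λ, hΛ⟩ := T.exists_leftInverse_of_injective hT
  have hΛmem : ∀ X, (Λ X : Obs d) ∈ opsOn {p} := fun X => (Λ X).2.1
  have hΛavg : ∀ X, siteAvg p (Λ X : Obs d) = 0 := fun X => (Λ X).2.2
  have hΛV : ∀ a ∈ opsOn {p}, siteAvg p a = 0 → (Λ ⁅a, b⁆ : Obs d) = a := fun a ha ha' =>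
    congrArg Subtype.val (LinearMap.congr_fun hΛ ⟨a, ha, ha'⟩)
  let σ : Obs d →ₗ[ℂ] Obs d := ∑ k, ∑ l, ∑ k', ∑ l',
    LinearMap.mulLeft ℂ (Λ (siteUnit p k l * siteUnit q k' l') : Obs d) ∘ₗ
      slice p k l ∘ₗ slice q k' l'
  have hσ : ∀ Y, σ Y = ∑ k, ∑ l, ∑ k', ∑ l', (Λ (siteUnit p k l * siteUnit q k' l') : Obs d) *
      slice p k l (slice q k' l' Y) := fun Y => by
    simp [σ, LinearMap.sum_apply]
  have hright : ∀ W, Off p W → Off q W → ∀ Y, σ (Y * W) = σ Y * W := by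
    intro W hp hq Y
    simp only [hσ, slice_mul_of_off_right hq, slice_mul_of_off_right hp, Finset.sum_mul, mul_assoc]
  have hX : ∀ X ∈ opsOn {p, q}, σ X = Λ X := by
    intro X hX
    have hs : ∀ k l k' l', ∃ c : ℂ, slice p k l (slice q k' l' X) = algebraMap ℂ (Obs d) c := by
      intro k l k' l'
      have h1 := slice_mem (slice_mem hX q k' l') p k l
      have h2 : (({p, q} : Finset ℤ).erase q).erase p = ∅ := by
        ext x; simp only [Finset.mem_erase, Finset.mem_insert, Finset.mem_singleton,
          Finset.notMem_empty]; tauto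
      rw [h2] at h1
      have h3 : (opsOn ∅ : Subalgebra ℂ (Obs d)) = ⊥ := by simp [opsOn]
      rw [h3] at h1
      obtain ⟨c, hc⟩ := Algebra.mem_bot.1 h1
      exact ⟨c, hc.symm⟩
    choose c hc using hs
    have hXsum : X = ∑ k, ∑ l, ∑ k', ∑ l', c k l k' l' • (siteUnit p k l * siteUnit q k' l') := by
      have e : ∀ k l k' l', c k l k' l' • (siteUnit p k l * siteUnit q k' l' : Obs d)
          = siteUnit p k l * slice p k l (siteUnit q k' l' * slice q k' l' X) := by
        intro k l k' l'
        rw [slice_mul_of_off_left (off_siteUnit hpq _ _), hc, ← mul_assoc, ← Algebra.commutes,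
          Algebra.smul_def]
      simp only [e, ← Finset.mul_sum, ← map_sum, ← eq_sum_slice]
    conv_rhs => rw [hXsum]
    rw [hσ]
    simp only [hc, map_sum, map_smul, Submodule.coe_sum, Submodule.coe_smul]
    simp only [Algebra.smul_def, Algebra.commutes]
  refine ⟨σ, ?_, ?_, hright, ?_, ?_⟩
  · intro Z hZq hZp
    -- Replacing the matrix units by their traceless parts brings their coefficients within reach of
    -- the one-site left inverse; the total change is the average of `Z`, which is zero.
    set e : Fin d → Fin d → Obs d := fun k l => siteUnit p k l - siteAvg p (siteUnit p k l) with he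
    have hemem : ∀ k l, e k l ∈ opsOn {p} := fun k l =>
      sub_mem (siteUnit_mem (Finset.mem_singleton_self p) k l) (opsOn_mono (Finset.erase_subset _ _)
        (siteAvg_mem (siteUnit_mem (Finset.mem_singleton_self p) k l) p))
    have heavg : ∀ k l, siteAvg p (e k l) = 0 := fun k l => by simp [he, siteAvg_idem]
    have hZ : Z = ∑ k, ∑ l, e k l * slice p k l Z := by
      conv_lhs => rw [← sub_zero Z, ← hZp, eq_sum_slice p Z]
      simp only [map_sum, siteAvg_mul_right (off_slice p _ _ Z), he, sub_mul,
        Finset.sum_sub_distrib]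
    have hcomm : ∀ k l, Commute (slice p k l Z) b := fun k l =>
      (commute_of_off hb fun i hi => by
        rcases Finset.mem_insert.1 hi with rfl | hi
        · exact off_slice _ _ _ _
        · rw [Finset.mem_singleton.1 hi]; exact hZq.slice _ _ _).symm
    have hZb : ⁅Z, b⁆ = ∑ k, ∑ l, ⁅e k l, b⁆ * slice p k l Z := by
      conv_lhs => rw [hZ]
      simp only [sum_lie]
      refine Finset.sum_congr rfl fun k _ => Finset.sum_congr rfl fun l _ => ?_
      simp only [LieRing.of_associative_ring_bracket, sub_mul, mul_assoc, (hcomm k l).eq]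
    rw [hZb]
    conv_rhs => rw [hZ]
    simp only [map_sum]
    refine Finset.sum_congr rfl fun k _ => Finset.sum_congr rfl fun l _ => ?_
    rw [hright _ (off_slice _ _ _ _) (hZq.slice _ _ _), hX, hΛV _ (hemem k l) (heavg k l)]
    exact lie_mem_opsOn (opsOn_mono (by simp) (hemem k l)) hb
  · intro W hp hq Y
    have : ∀ X, Commute (Λ X : Obs d) W := fun X =>
      commute_of_off (hΛmem X) (by simpa using hp)
    simp only [hσ, slice_mul_of_off_left hq, slice_mul_of_off_left hp, Finset.mul_sum, ← mul_assoc,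
      (this _).eq]
  · intro Y
    simp only [hσ, map_sum, siteAvg_mul_right (off_slice p _ _ _), hΛavg, zero_mul,
      Finset.sum_const_zero]
  · intro S Y hp hY
    rw [hσ]
    refine sum_mem fun k _ => sum_mem fun l _ => sum_mem fun k' _ => sum_mem fun l' _ =>
      mul_mem (opsOn_mono ?_ (hΛmem _))
        (opsOn_mono (Finset.erase_subset _ _) (slice_mem (slice_mem hY q k' l') p k l))
    simpa using ⟨hpq, hp⟩

theorem eq_zero_of_lie_eq_zero {p q : ℤ} (hpq : p ≠ q) {b : Obs d} (hb : b ∈ opsOn {p, q})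
    (hinj : ∀ a ∈ opsOn (d := d) {p}, siteAvg p a = 0 → ⁅a, b⁆ = 0 → a = 0) {Z : Obs d} (hq : Off q Z)
    (hp : siteAvg p Z = 0) (h : ⁅Z, b⁆ = 0) : Z = 0 := by
  obtain ⟨σ, hσ, -⟩ := exists_partial_inverse hpq hb hinj
  rw [← hσ Z hq hp, h, map_zero]

/-- The two-site interaction on the sites `i, i + 1`. -/
def bond (H : FormalOp d) (i : ℤ) : Obs d := op H {i, i + 1}

/-- The one-site potential at `i`. -/
def pot (H : FormalOp d) (i : ℤ) : Obs d := op H {i}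

/-- No traceless one-site operator commutes with a bond that touches its site. -/
def InjectiveBonds (H : FormalOp d) : Prop :=
  ∀ i, (∀ a ∈ opsOn (d := d) {i + 1}, siteAvg (i + 1) a = 0 → ⁅a, bond H i⁆ = 0 → a = 0) ∧
    (∀ a ∈ opsOn (d := d) {i}, siteAvg i a = 0 → ⁅a, bond H i⁆ = 0 → a = 0)

theorem bond_mem (H : FormalOp d) (i : ℤ) : bond H i ∈ opsOn {i, i + 1} := op_mem _ _

theorem pot_mem (H : FormalOp d) (i : ℤ) : pot H i ∈ opsOn {i} := op_mem _ _

theorem siteAvg_bond_left (H : FormalOp d) (i : ℤ) : siteAvg i (bond H i) = 0 :=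
  siteAvg_op H (by simp)

theorem siteAvg_bond_right (H : FormalOp d) (i : ℤ) : siteAvg (i + 1) (bond H i) = 0 :=
  siteAvg_op H (by simp)

theorem off_bond (H : FormalOp d) {i k : ℤ} (h : k < i ∨ i + 1 < k) : Off k (bond H i) :=
  off_of_mem (bond_mem H i) (by simp only [Finset.mem_insert, Finset.mem_singleton]; omega)

theorem lie_bond_bond (H : FormalOp d) {i j : ℤ} (h : i + 1 < j) : ⁅bond H i, bond H j⁆ = 0 :=
  lie_eq_zero_of_off (bond_mem H i) fun k hk => off_bond H (by
    simp only [Finset.mem_insert, Finset.mem_singleton] at hk; omega)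

theorem lie_pot_bond (H : FormalOp d) {i j : ℤ} (h : i < j ∨ j + 1 < i) :
    ⁅pot H i, bond H j⁆ = 0 :=
  lie_eq_zero_of_off (pot_mem H i) fun k hk => off_bond H (by
    simp only [Finset.mem_singleton] at hk; omega)

theorem InjectiveBonds.eq_zero_left {H : FormalOp d} (hH : InjectiveBonds H) {i : ℤ} {Z : Obs d}
    (h1 : Off i Z) (h2 : siteAvg (i + 1) Z = 0) (h : ⁅bond H i, Z⁆ = 0) : Z = 0 :=
  eq_zero_of_lie_eq_zero (p := i + 1) (q := i) (by omega)
    (by rw [Finset.pair_comm]; exact bond_mem H i) (hH i).1 h1 h2 (by rw [← lie_skew, h, neg_zero])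

theorem InjectiveBonds.eq_zero_right {H : FormalOp d} (hH : InjectiveBonds H) {i : ℤ} {Z : Obs d}
    (h1 : Off (i + 1) Z) (h2 : siteAvg i Z = 0) (h : ⁅Z, bond H i⁆ = 0) : Z = 0 :=
  eq_zero_of_lie_eq_zero (p := i) (q := i + 1) (by omega) (bond_mem H i) (hH i).2 h1 h2 h

/-- Let σ undo the bracket with the bond at `j`. It commutes with the bracket by the distant bond at
`i`, so ψ = σ[ψ, h_j] = σ[h_i, θ] = [h_i, σθ], and ω = σθ. Substituting back, [h_i, θ - [ω, h_j]] =
0, and injectivity on the left gives the other formula. -/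
theorem InjectiveBonds.peel {H : FormalOp d} (hH : InjectiveBonds H) {i j : ℤ} (hij : i + 1 < j)
    {ψ θ : Obs d} (hψ : ψ ∈ opsOn (Finset.Icc i j)) (hψj : siteAvg j ψ = 0)
    (hθ : θ ∈ opsOn (Finset.Icc (i + 1) (j + 1))) (hθi : siteAvg (i + 1) θ = 0)
    (h : ⁅bond H i, θ⁆ = ⁅ψ, bond H j⁆) :
    ∃ ω ∈ opsOn (Finset.Icc (i + 1) j), siteAvg (i + 1) ω = 0 ∧ siteAvg j ω = 0 ∧
      ψ = ⁅bond H i, ω⁆ ∧ θ = ⁅ω, bond H j⁆ := by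
  obtain ⟨σ, hσ1, hσl, hσr, hσp, hσm⟩ :=
    exists_partial_inverse (p := j) (q := j + 1) (by omega) (bond_mem H j) (hH j).2
  have hoff : ∀ r, r ≠ j → r ≠ j + 1 → ∀ Y, siteAvg r (σ Y) = σ (siteAvg r Y) := by
    intro r h1 h2 Y
    have hu : ∀ k l, Off j (siteUnit r k l : Obs d) ∧ Off (j + 1) (siteUnit r k l : Obs d) :=
      fun k l => ⟨off_siteUnit h1.symm _ _, off_siteUnit h2.symm _ _⟩
    simp only [siteAvg_apply, slice_apply, map_smul, map_sum]
    refine congrArg _ (Finset.sum_congr rfl fun k _ => Finset.sum_congr rfl fun l _ => ?_)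
    rw [hσr _ (hu _ _).1 (hu _ _).2, hσl _ (hu _ _).1 (hu _ _).2]
  have hωmem : σ θ ∈ opsOn (Finset.Icc (i + 1) j) := by
    refine opsOn_mono ?_ (hσm _ θ ?_ hθ)
    · intro x; simp only [Finset.mem_erase, Finset.mem_Icc]; omega
    · simp only [Finset.mem_Icc]; omega
  have hωi : siteAvg (i + 1) (σ θ) = 0 := by
    rw [hoff _ (by omega) (by omega), hθi, map_zero]
  have hbj : Off j (bond H i) := off_bond H (by omega)
  have hbj' : Off (j + 1) (bond H i) := off_bond H (by omega)
  have hψω : ψ = ⁅bond H i, σ θ⁆ := by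
    rw [← hσ1 ψ (off_of_mem hψ (by simp)) hψj, ← h]
    simp only [LieRing.of_associative_ring_bracket, map_sub, hσl _ hbj hbj', hσr _ hbj hbj']
  refine ⟨σ θ, hωmem, hωi, hσp θ, hψω, ?_⟩
  rw [← sub_eq_zero]
  refine hH.eq_zero_left (i := i) ?_ ?_ ?_
  · refine (off_of_mem hθ (by simp)).sub ((off_of_mem hωmem (by simp)).lie (off_bond H (by omega)))
  · rw [map_sub, hθi, siteAvg_lie_right (off_bond H (by omega)), hωi, zero_lie, sub_zero]
  · rw [lie_sub, h, sub_eq_zero, leibniz_lie (bond H i), ← hψω, lie_bond_bond H hij, lie_zero,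
      add_zero]

/-! ### Families of leading parts and nested commutators of bonds -/

/-- A family of operators on the intervals of `n + 2` sites, traceless at both extreme sites. -/
def IsTopFamily (n : ℕ) (ψ : ℤ → Obs d) : Prop :=
  ∀ i, ψ i ∈ opsOn (Finset.Icc i (i + n + 1)) ∧ siteAvg i (ψ i) = 0 ∧ siteAvg (i + n + 1) (ψ i) = 0

theorem IsTopFamily.add {n : ℕ} {ψ θ : ℤ → Obs d} (hψ : IsTopFamily n ψ) (hθ : IsTopFamily n θ) :
    IsTopFamily n fun i => ψ i + θ i := fun i =>
  ⟨add_mem (hψ i).1 (hθ i).1, by simp [(hψ i).2.1, (hθ i).2.1], by simp [(hψ i).2.2, (hθ i).2.2]⟩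

theorem IsTopFamily.smul {n : ℕ} {ψ : ℤ → Obs d} (hψ : IsTopFamily n ψ) (c : ℂ) :
    IsTopFamily n fun i => c • ψ i := fun i =>
  ⟨Subalgebra.smul_mem _ (hψ i).1 c, by simp [(hψ i).2.1], by simp [(hψ i).2.2]⟩

theorem IsTopFamily.sub {n : ℕ} {ψ θ : ℤ → Obs d} (hψ : IsTopFamily n ψ) (hθ : IsTopFamily n θ) :
    IsTopFamily n fun i => ψ i - θ i := fun i =>
  ⟨sub_mem (hψ i).1 (hθ i).1, by simp [(hψ i).2.1, (hθ i).2.1], by simp [(hψ i).2.2, (hθ i).2.2]⟩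

theorem isTopFamily_ends {n : ℕ} {X : ℤ → Obs d}
    (hX : ∀ i, X i ∈ opsOn (Finset.Icc i (i + n + 1))) :
    IsTopFamily n fun i => ends i (i + n + 1) (X i) := fun i =>
  ⟨ends_mem (hX i) _ _, siteAvg_ends_left _ _ _, siteAvg_ends_right _ _ _⟩

theorem isTopFamily_top (Φ : FormalOp d) (n : ℕ) : IsTopFamily n fun i => top Φ i (i + n + 1) :=
  isTopFamily_ends fun _ => rs_mem _ _

theorem IsTopFamily.lie_right {H : FormalOp d} {n : ℕ} {ψ : ℤ → Obs d} (hψ : IsTopFamily n ψ) :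
    IsTopFamily (n + 1) fun i => ⁅ψ i, bond H (i + n + 1)⁆ := by
  intro i
  obtain ⟨h1, h2, h3⟩ := hψ i
  refine ⟨lie_mem_opsOn (opsOn_mono ?_ h1) (opsOn_mono ?_ (bond_mem H _)), ?_, ?_⟩
  · intro x; simp only [Finset.mem_Icc]; push_cast; omega
  · intro x; simp only [Finset.mem_Icc, Finset.mem_insert, Finset.mem_singleton]; push_cast; omega
  · rw [siteAvg_lie_right (off_bond H (by omega)), h2, zero_lie]
  · rw [show i + ((n + 1 : ℕ) : ℤ) + 1 = i + n + 1 + 1 by push_cast; ring,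
      siteAvg_lie_left (off_of_mem h1 (by simp)), siteAvg_bond_right, lie_zero]

theorem IsTopFamily.lie_left {H : FormalOp d} {n : ℕ} {ψ : ℤ → Obs d} (hψ : IsTopFamily n ψ) :
    IsTopFamily (n + 1) fun i => ⁅bond H i, ψ (i + 1)⁆ := by
  intro i
  obtain ⟨h1, h2, h3⟩ := hψ (i + 1)
  refine ⟨lie_mem_opsOn (opsOn_mono ?_ (bond_mem H _)) (opsOn_mono ?_ h1), ?_, ?_⟩
  · intro x; simp only [Finset.mem_Icc, Finset.mem_insert, Finset.mem_singleton]; push_cast; omega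
  · intro x; simp only [Finset.mem_Icc]; push_cast; omega
  · rw [siteAvg_lie_right (off_of_mem h1 (by simp)), siteAvg_bond_left, zero_lie]
  · rw [show i + ((n + 1 : ℕ) : ℤ) + 1 = i + 1 + n + 1 by push_cast; ring,
      siteAvg_lie_left (off_bond H (by omega)), h3, lie_zero]

theorem InjectiveBonds.peel_family {H : FormalOp d} (hH : InjectiveBonds H) {n : ℕ}
    {ψ θ : ℤ → Obs d} (hψ : IsTopFamily (n + 1) ψ) (hθ : IsTopFamily (n + 1) θ)
    (h : ∀ i, ⁅bond H i, θ (i + 1)⁆ = ⁅ψ i, bond H (i + n + 2)⁆) :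
    ∃ ω, IsTopFamily n ω ∧ (∀ i, ψ i = ⁅bond H i, ω (i + 1)⁆) ∧
      ∀ i, θ i = ⁅ω i, bond H (i + n + 1)⁆ := by
  have key : ∀ i, ∃ ω ∈ opsOn (Finset.Icc (i + 1) (i + n + 2)), siteAvg (i + 1) ω = 0 ∧
      siteAvg (i + n + 2) ω = 0 ∧ ψ i = ⁅bond H i, ω⁆ ∧ θ (i + 1) = ⁅ω, bond H (i + n + 2)⁆ := by
    intro i
    obtain ⟨h1, _, h3⟩ := hψ i
    obtain ⟨h4, h5, _⟩ := hθ (i + 1)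
    have e1 : i + ((n + 1 : ℕ) : ℤ) + 1 = i + n + 2 := by push_cast; ring
    have e2 : i + 1 + ((n + 1 : ℕ) : ℤ) + 1 = i + n + 2 + 1 := by push_cast; ring
    rw [e1] at h1 h3
    rw [e2] at h4
    exact hH.peel (by omega) h1 h3 h4 h5 (h i)
  choose ω hω1 hω2 hω3 hω4 hω5 using key
  -- The operator obtained from the equation at `i` starts at the site `i + 1`, hence the
  -- reindexing.
  refine ⟨fun i => ω (i - 1), fun i => ?_, fun i => ?_, fun i => ?_⟩
  · have e1 : i - 1 + 1 = i := by ring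
    have e2 : i - 1 + n + 2 = i + n + 1 := by ring
    have := hω1 (i - 1)
    have h2 := hω2 (i - 1)
    have h3 := hω3 (i - 1)
    rw [e1, e2] at this
    rw [e1] at h2
    rw [e2] at h3
    exact ⟨this, h2, h3⟩
  · simpa using hω4 i
  · have e1 : i - 1 + 1 = i := by ring
    have e2 : i - 1 + n + 2 = i + n + 1 := by ring
    have := hω5 (i - 1)
    rwa [e1, e2] at this

/-- The nested commutators `[h i, [h (i + 1), …, h (i + n)]]`. -/
noncomputable def nest (H : FormalOp d) : ℕ → ℤ → Obs d
  | 0, i => bond H i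
  | n + 1, i => ⁅bond H i, nest H n (i + 1)⁆

theorem nest_succ (H : FormalOp d) (n : ℕ) (i : ℤ) :
    nest H (n + 1) i = ⁅bond H i, nest H n (i + 1)⁆ := rfl

/-- The first and last bonds commute, so by Jacobi the nesting may be opened from either end. In
particular the nested commutators solve the leading equation. -/
theorem nest_succ_right (H : FormalOp d) (n : ℕ) (i : ℤ) :
    nest H (n + 1) i = ⁅nest H n i, bond H (i + n + 1)⁆ := by
  induction n generalizing i with
  | zero => simp [nest]
  | succ n ih =>
    rw [nest_succ, ih (i + 1), nest_succ, leibniz_lie, lie_bond_bond H (by omega), lie_zero,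
      add_zero]
    congr 2
    push_cast; ring

theorem isTopFamily_nest (H : FormalOp d) (n : ℕ) : IsTopFamily n (nest H n) := by
  induction n with
  | zero =>
    intro i
    refine ⟨opsOn_mono ?_ (bond_mem H i), siteAvg_bond_left H i, ?_⟩
    · intro x; simp only [Finset.mem_Icc, Finset.mem_insert, Finset.mem_singleton]; push_cast; omega
    · simpa [nest] using siteAvg_bond_right H i
  | succ n ih => exact ih.lie_left

/-- Only multiples of the interaction solve the two-site version of the top equation. -/
def UniqueBonds (H : FormalOp d) : Prop :=
  ∀ ψ : ℤ → Obs d, IsTopFamily 0 ψ → (∀ i, ⁅bond H i, ψ (i + 1)⁆ = ⁅ψ i, bond H (i + 1)⁆) →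
    ∃ α : ℂ, ∀ i, ψ i = α • bond H i

/-- Peeling ψ on the left and on the right yields the same shorter family ω; equality of the two
expressions for ψ is the leading equation for ω. Hypothesis (ii) settles the two-site case. -/
theorem eq_smul_nest {H : FormalOp d} (hinj : InjectiveBonds H) (huniq : UniqueBonds H) {n : ℕ}
    {ψ : ℤ → Obs d} (hψ : IsTopFamily n ψ)
    (h : ∀ i, ⁅bond H i, ψ (i + 1)⁆ = ⁅ψ i, bond H (i + n + 1)⁆) :
    ∃ α : ℂ, ∀ i, ψ i = α • nest H n i := by
  induction n generalizing ψ with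
  | zero => exact huniq ψ hψ (by simpa using h)
  | succ n ih =>
    obtain ⟨ω, hω, h1, h2⟩ := hinj.peel_family hψ hψ fun i => by
      rw [h i]; congr 2; push_cast; ring
    obtain ⟨α, hα⟩ := ih hω fun i => by rw [← h1, ← h2]
    exact ⟨α, fun i => by rw [h1, hα, lie_smul, nest_succ]⟩

end

/-! ### Lie algebra identities behind the recursion for `corr` -/

theorem lie_lie_right_of_lie_eq_zero {L : Type*} [LieRing L] {x z : L} (h : ⁅x, z⁆ = 0) (y : L) :
    ⁅x, ⁅y, z⁆⁆ = ⁅⁅x, y⁆, z⁆ := by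
  rw [leibniz_lie, h, lie_zero, add_zero]

theorem lie_lie_left_of_lie_eq_zero {L : Type*} [LieRing L] {x y : L} (h : ⁅x, y⁆ = 0) (z : L) :
    ⁅x, ⁅y, z⁆⁆ = ⁅y, ⁅x, z⁆⁆ := by
  rw [leibniz_lie, h, zero_lie, zero_add]

/-- Here `l` and `r` are the end bonds, `c` the nested commutator between them, `M` the Hamiltonian
on the inner interval, and `a`, `b` the terms added at the two ends. The hypothesis on `M` says that
no term of `M` links `l` to `r`. -/
theorem lie_nested_both_sides {L : Type*} [LieRing L] {M a b l r c : L} (har : ⁅a, r⁆ = 0)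
    (hbl : ⁅b, l⁆ = 0) (hlr : ⁅l, r⁆ = 0) (hM : ⁅⁅M, l⁆, r⁆ = 0) :
    ⁅M + a + b, ⁅l, ⁅c, r⁆⁆⁆
      = ⁅⁅M + a, ⁅l, c⁆⁆, r⁆ + ⁅l, ⁅M + b, ⁅c, r⁆⁆⁆ - ⁅l, ⁅⁅M, c⁆, r⁆⁆ := by
  have e1 : ⁅a, ⁅l, ⁅c, r⁆⁆⁆ = ⁅⁅a, ⁅l, c⁆⁆, r⁆ := by
    rw [lie_lie_right_of_lie_eq_zero hlr, lie_lie_right_of_lie_eq_zero har]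
  have e2 : ⁅b, ⁅l, ⁅c, r⁆⁆⁆ = ⁅l, ⁅b, ⁅c, r⁆⁆⁆ := lie_lie_left_of_lie_eq_zero hbl _
  have e3 : ⁅M, ⁅l, ⁅c, r⁆⁆⁆ = ⁅⁅⁅M, l⁆, c⁆, r⁆ + ⁅l, ⁅M, ⁅c, r⁆⁆⁆ := by
    rw [leibniz_lie, lie_lie_right_of_lie_eq_zero hM]
  have e4 : ⁅⁅M, ⁅l, c⁆⁆, r⁆ = ⁅⁅⁅M, l⁆, c⁆, r⁆ + ⁅l, ⁅⁅M, c⁆, r⁆⁆ := by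
    rw [leibniz_lie M l c, add_lie, ← lie_lie_right_of_lie_eq_zero hlr]
  rw [add_lie, add_lie, add_lie M a, add_lie, e4, add_lie M b, lie_add, e1, e2, e3]
  abel

/-- The shortest case, with bonds `x` and potentials `v`. The middle bond links the outer two, so
`lie_nested_both_sides` is not available; the identity holds only after doubling and up to a
difference of the form of `bdry`. -/
theorem lie_three_bonds {L : Type*} [LieRing L] {x₁ x₂ x₃ v₁ v₂ v₃ v₄ : L} (h13 : ⁅x₁, x₃⁆ = 0)
    (h12' : ⁅v₁, x₂⁆ = 0) (h13' : ⁅v₁, x₃⁆ = 0) (h23 : ⁅v₂, x₃⁆ = 0) (h31 : ⁅v₃, x₁⁆ = 0)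
    (h41 : ⁅v₄, x₁⁆ = 0) (h42 : ⁅v₄, x₂⁆ = 0) :
    (2 : ℤ) • ⁅x₁ + x₂ + x₃ + v₁ + v₂ + v₃ + v₄, ⁅x₁, ⁅x₂, x₃⁆⁆⁆
      = (3 : ℤ) • ⁅⁅x₁ + x₂ + v₁ + v₂ + v₃, ⁅x₁, x₂⁆⁆, x₃⁆
        + ⁅x₁, ⁅x₂, ⁅x₂, x₃⁆⁆ + (2 : ℤ) • ⁅x₃, ⁅x₂, x₃⁆⁆ + ⁅⁅v₂ + v₃, x₂⁆, x₃⁆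
            + (2 : ℤ) • ⁅x₂, ⁅v₃ + v₄, x₃⁆⁆⁆
        - ⁅⁅x₁, ⁅x₁, x₂⁆⁆ + (2 : ℤ) • ⁅x₂, ⁅x₁, x₂⁆⁆ + ⁅⁅v₁ + v₂, x₁⁆, x₂⁆
            + (2 : ℤ) • ⁅x₁, ⁅v₂ + v₃, x₂⁆⁆, x₃⁆ := by
  have hc : ∀ y, ⁅x₁, ⁅y, x₃⁆⁆ = ⁅⁅x₁, y⁆, x₃⁆ := lie_lie_right_of_lie_eq_zero h13
  have h31' : ⁅x₃, x₁⁆ = 0 := by rw [← lie_skew, h13, neg_zero]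
  have e3 : ⁅x₁, ⁅x₃, ⁅x₂, x₃⁆⁆⁆ = ⁅x₃, ⁅⁅x₁, x₂⁆, x₃⁆⁆ := by
    rw [lie_lie_left_of_lie_eq_zero h13, hc]
  have e2 : ⁅x₁, ⁅x₂, ⁅x₂, x₃⁆⁆⁆ = ⁅⁅x₁, x₂⁆, ⁅x₂, x₃⁆⁆ + ⁅x₂, ⁅⁅x₁, x₂⁆, x₃⁆⁆ := by
    rw [leibniz_lie, hc]
  have e2' : ⁅⁅x₂, ⁅x₁, x₂⁆⁆, x₃⁆ = ⁅x₂, ⁅⁅x₁, x₂⁆, x₃⁆⁆ - ⁅⁅x₁, x₂⁆, ⁅x₂, x₃⁆⁆ := lie_lie _ _ _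
  have f1 : ⁅v₁, ⁅⁅x₁, x₂⁆, x₃⁆⁆ = ⁅⁅⁅v₁, x₁⁆, x₂⁆, x₃⁆ := by
    rw [lie_lie_right_of_lie_eq_zero h13', lie_lie_right_of_lie_eq_zero h12']
  have f1' : ⁅v₁, ⁅x₁, x₂⁆⁆ = ⁅⁅v₁, x₁⁆, x₂⁆ := lie_lie_right_of_lie_eq_zero h12' _
  have f2 : ⁅v₂, ⁅x₁, x₂⁆⁆ = ⁅⁅v₂, x₁⁆, x₂⁆ + ⁅x₁, ⁅v₂, x₂⁆⁆ := leibniz_lie _ _ _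
  have f2' : ⁅v₂, ⁅⁅x₁, x₂⁆, x₃⁆⁆ = ⁅⁅⁅v₂, x₁⁆, x₂⁆, x₃⁆ + ⁅⁅x₁, ⁅v₂, x₂⁆⁆, x₃⁆ := by
    rw [lie_lie_right_of_lie_eq_zero h23, f2, add_lie]
  have f3 : ⁅v₃, ⁅x₁, x₂⁆⁆ = ⁅x₁, ⁅v₃, x₂⁆⁆ := lie_lie_left_of_lie_eq_zero h31 _
  have f3' : ⁅v₃, ⁅⁅x₁, x₂⁆, x₃⁆⁆ = ⁅⁅x₁, ⁅v₃, x₂⁆⁆, x₃⁆ + ⁅x₁, ⁅x₂, ⁅v₃, x₃⁆⁆⁆ := by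
    rw [← hc, lie_lie_left_of_lie_eq_zero h31, leibniz_lie v₃, lie_add, hc]
  have f4 : ⁅v₄, ⁅⁅x₁, x₂⁆, x₃⁆⁆ = ⁅x₁, ⁅x₂, ⁅v₄, x₃⁆⁆⁆ := by
    rw [← hc, lie_lie_left_of_lie_eq_zero h41, lie_lie_left_of_lie_eq_zero h42]
  simp only [add_lie, lie_add, lie_smul, smul_lie, hc, f1, f1', f2, f2', f3, f3', f4, e2, e2', e3,
    smul_add, smul_sub]
  abel

section
set_option linter.unusedSectionVars false
variable {d : ℕ} [NeZero d]

/-! ### The next-to-leading equation and its descent to three sites -/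

/-- Minus the extremal components of the commutator of `H` with the nested commutators. -/
noncomputable def corr (H : FormalOp d) (n : ℕ) (i : ℤ) : Obs d :=
  -ends i (i + n + 1) ⁅rs H (Finset.Icc i (i + n + 1)), nest H n i⁆

theorem isTopFamily_corr (H : FormalOp d) (n : ℕ) : IsTopFamily n (corr H n) := by
  have := (isTopFamily_ends (n := n) fun i =>
    lie_mem_opsOn (rs_mem H (Finset.Icc i (i + n + 1))) (isTopFamily_nest H n i).1).smul (-1)
  simp only [neg_one_smul] at this
  exact this

theorem lie_ends_right {H : FormalOp d} {i j : ℤ} (hij : i < j) {Z : Obs d} (hZ : Off (j + 1) Z) :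
    ⁅ends i j Z, bond H j⁆ = ends i (j + 1) ⁅Z, bond H j⁆ := by
  rw [← lie_skew, ← lie_skew Z, map_neg,
    ends_lie (bond_mem H j) (siteAvg_bond_right H j) (off_bond H (by omega)) hZ]

theorem lie_ends_left {H : FormalOp d} {i j : ℤ} (hij : i + 1 < j) {Z : Obs d} (hZ : Off i Z) :
    ⁅bond H i, ends (i + 1) j Z⁆ = ends i j ⁅bond H i, Z⁆ := by
  rw [ends_comm, ends_comm i, ends_lie (by rw [Finset.pair_comm]; exact bond_mem H i)
    (siteAvg_bond_left H i) (off_bond H (by omega)) hZ]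

theorem rs_Icc_succ {H : FormalOp d} (hH : HasRange H 2) {i j : ℤ} (hij : i ≤ j) :
    rs H (Finset.Icc i (j + 1)) = rs H (Finset.Icc i j) + (pot H (j + 1) + bond H j) := by
  rw [rs_Icc_right hH (by omega), add_sub_cancel_right]; rfl

theorem rs_Icc_pred {H : FormalOp d} (hH : HasRange H 2) {i j : ℤ} (hij : i < j) :
    rs H (Finset.Icc i j) = rs H (Finset.Icc (i + 1) j) + (pot H i + bond H i) :=
  rs_Icc_left hH hij

/-- This is `lie_nested_both_sides` under the projection `ends`. The condition `1 ≤ m` makes the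
inner interval at least three sites long, so that none of its bonds touches both end bonds. -/
theorem corr_add_two {H : FormalOp d} (hH : HasRange H 2) {m : ℕ} (hm : 1 ≤ m) (i : ℤ) :
    corr H (m + 2) i = ⁅corr H (m + 1) i, bond H (i + m + 2)⁆ + ⁅bond H i, corr H (m + 1) (i + 1)⁆
      - ⁅bond H i, ⁅corr H m (i + 1), bond H (i + m + 2)⁆⁆ := by
  set J : ℤ := i + m + 2 with hJ
  have hJi : i + 3 ≤ J := by omega
  have e0 : i + ((m + 2 : ℕ) : ℤ) + 1 = J + 1 := by push_cast; ring
  have e1 : i + ((m + 1 : ℕ) : ℤ) + 1 = J := by push_cast; ring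
  have e2 : i + 1 + ((m + 1 : ℕ) : ℤ) + 1 = J + 1 := by push_cast; ring
  have e3 : i + 1 + (m : ℤ) + 1 = J := by ring
  have n1 : nest H (m + 1) (i + 1) = ⁅nest H m (i + 1), bond H J⁆ := by
    rw [nest_succ_right, e3]
  have hc := (isTopFamily_nest H m (i + 1)).1
  rw [e3] at hc
  have hn1 := (isTopFamily_nest H (m + 1) i).1
  rw [e1] at hn1
  have hn2 := (isTopFamily_nest H (m + 1) (i + 1)).1
  rw [e2] at hn2
  set c := nest H m (i + 1) with hcdef
  set M := rs H (Finset.Icc (i + 1) J) with hM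
  have r1 : rs H (Finset.Icc i J) = M + (pot H i + bond H i) := rs_Icc_pred hH (by omega)
  have r2 : rs H (Finset.Icc (i + 1) (J + 1)) = M + (pot H (J + 1) + bond H J) :=
    rs_Icc_succ hH (by omega)
  have r3 : rs H (Finset.Icc i (J + 1)) = M + (pot H i + bond H i) + (pot H (J + 1) + bond H J) := by
    rw [rs_Icc_succ hH (by omega), r1]
  have hlr : ⁅bond H i, bond H J⁆ = 0 := lie_bond_bond H (by omega)
  have hMl : ⁅⁅M, bond H i⁆, bond H J⁆ = 0 := by
    have h1 : M = rs H (Finset.Icc (i + 1 + 1) J) + (pot H (i + 1) + bond H (i + 1)) :=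
      rs_Icc_pred hH (by omega)
    have h2 : ⁅rs H (Finset.Icc (i + 1 + 1) J), bond H i⁆ = 0 :=
      lie_eq_zero_of_off (rs_mem _ _) fun k hk => off_bond H (by
        have := Finset.mem_Icc.1 hk; omega)
    rw [h1, add_lie, h2, zero_add, lie_lie, hlr, lie_zero, add_lie, lie_pot_bond H (by omega),
      lie_bond_bond H (by omega)]
    simp
  have key := lie_nested_both_sides (M := M) (a := pot H i + bond H i)
    (b := pot H (J + 1) + bond H J) (l := bond H i) (r := bond H J) (c := c)
    (by rw [add_lie, lie_pot_bond H (by omega), hlr, add_zero])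
    (by rw [add_lie, lie_pot_bond H (by omega), ← lie_skew, hlr, neg_zero, add_zero]) hlr hMl
  have t1 : ⁅corr H (m + 1) i, bond H J⁆
      = -ends i (J + 1) ⁅⁅M + (pot H i + bond H i), ⁅bond H i, c⁆⁆, bond H J⁆ := by
    rw [corr, e1, neg_lie, lie_ends_right (by omega), r1, nest_succ]
    exact (off_of_mem (rs_mem H _) (by simp)).lie (off_of_mem hn1 (by simp))
  have t2 : ⁅bond H i, corr H (m + 1) (i + 1)⁆
      = -ends i (J + 1) ⁅bond H i, ⁅M + (pot H (J + 1) + bond H J), ⁅c, bond H J⁆⁆⁆ := by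
    rw [corr, e2, lie_neg, lie_ends_left (by omega), r2, n1]
    exact (off_of_mem (rs_mem H _) (by simp)).lie (off_of_mem hn2 (by simp))
  have t3 : ⁅bond H i, ⁅corr H m (i + 1), bond H J⁆⁆
      = -ends i (J + 1) ⁅bond H i, ⁅⁅M, c⁆, bond H J⁆⁆ := by
    have hMc : ⁅M, c⁆ ∈ opsOn (Finset.Icc (i + 1) J) := lie_mem_opsOn (rs_mem _ _) hc
    rw [corr, e3, neg_lie, lie_neg, lie_ends_right (by omega) (off_of_mem hMc (by simp)),
      lie_ends_left (by omega)]
    exact (off_of_mem hMc (by simp)).lie (off_bond H (by omega))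
  rw [corr, e0, r3, nest_succ, n1, key, t1, t2, t3, map_sub, map_add]
  abel

/-- The boundary operation on families of extremal components. -/
noncomputable def bdry (H : FormalOp d) (n : ℕ) (χ : ℤ → Obs d) (i : ℤ) : Obs d :=
  ⁅bond H i, χ (i + 1)⁆ - ⁅χ i, bond H (i + n + 1)⁆

theorem exists_corr_two {H : FormalOp d} (hH : HasRange H 2) :
    ∃ κ, IsTopFamily 1 κ ∧ ∀ i, (2 : ℂ) • corr H 2 i
      = (3 : ℂ) • ⁅corr H 1 i, bond H (i + 2)⁆ - bdry H 1 κ i := by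
  -- Read off from `lie_three_bonds`: the two correction terms there are brackets of the end bonds
  -- with this one expression, taken at `i + 1` and at `i`.
  let K : ℤ → Obs d := fun i =>
    ⁅bond H i, ⁅bond H i, bond H (i + 1)⁆⁆ + (2 : ℤ) • ⁅bond H (i + 1), ⁅bond H i, bond H (i + 1)⁆⁆
      + ⁅⁅pot H i + pot H (i + 1), bond H i⁆, bond H (i + 1)⁆
      + (2 : ℤ) • ⁅bond H i, ⁅pot H (i + 1) + pot H (i + 2), bond H (i + 1)⁆⁆
  have hK : ∀ i, K i ∈ opsOn (Finset.Icc i (i + 2)) := by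
    intro i
    have b1 : bond H i ∈ opsOn (Finset.Icc i (i + 2)) := opsOn_mono (by
      intro x; simp only [Finset.mem_Icc, Finset.mem_insert, Finset.mem_singleton]; omega)
        (bond_mem H i)
    have b2 : bond H (i + 1) ∈ opsOn (Finset.Icc i (i + 2)) := opsOn_mono (by
      intro x; simp only [Finset.mem_Icc, Finset.mem_insert, Finset.mem_singleton]; omega)
        (bond_mem H (i + 1))
    have p : ∀ j, i ≤ j → j ≤ i + 2 → pot H j ∈ opsOn (Finset.Icc i (i + 2)) := fun j h1 h2 =>
      opsOn_mono (by simp [h1, h2]) (pot_mem H j)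
    have b12 := lie_mem_opsOn b1 b2
    refine add_mem (add_mem (add_mem (lie_mem_opsOn b1 b12) (zsmul_mem (lie_mem_opsOn b2 b12) _))
      (lie_mem_opsOn (lie_mem_opsOn (add_mem (p _ (by omega) (by omega))
        (p _ (by omega) (by omega))) b1) b2)) (zsmul_mem (lie_mem_opsOn b1 (lie_mem_opsOn
          (add_mem (p _ (by omega) (by omega)) (p _ (by omega) (by omega))) b2)) _)
  refine ⟨fun i => ends i (i + 2) (K i), ?_, fun i => ?_⟩
  · have := isTopFamily_ends (n := 1) (X := K) fun i => by
      rw [show i + ((1 : ℕ) : ℤ) + 1 = i + 2 by push_cast; ring]; exact hK i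
    have e : ∀ i : ℤ, i + ((1 : ℕ) : ℤ) + 1 = i + 2 := fun i => by push_cast; ring
    simpa only [e] using this
  have a1 : i + 1 + 1 = i + 2 := by ring
  have a2 : i + 1 + 2 = i + 2 + 1 := by ring
  have r3 : rs H (Finset.Icc i (i + 2)) = bond H i + bond H (i + 1) + pot H i + pot H (i + 1)
      + pot H (i + 2) + op H ∅ := by
    rw [← a1, rs_Icc_succ hH (by omega), rs_Icc_succ hH le_rfl, Finset.Icc_self, rs,
      show ({i} : Finset ℤ).powerset = {∅, {i}} from rfl,
      Finset.sum_pair (Finset.singleton_ne_empty i).symm, ← pot, add_assoc i, one_add_one_eq_two]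
    abel
  have r4 : rs H (Finset.Icc i (i + 2 + 1)) = bond H i + bond H (i + 1) + bond H (i + 2) + pot H i
      + pot H (i + 1) + pot H (i + 2) + pot H (i + 2 + 1) + op H ∅ := by
    rw [rs_Icc_succ hH (by omega), r3]
    abel
  have hempty : ∀ X : Obs d, ⁅op H ∅, X⁆ = 0 := fun X =>
    lie_eq_zero_of_off (op_mem H ∅) (by simp)
  have key := lie_three_bonds (x₁ := bond H i) (x₂ := bond H (i + 1)) (x₃ := bond H (i + 2))
    (v₁ := pot H i) (v₂ := pot H (i + 1)) (v₃ := pot H (i + 2)) (v₄ := pot H (i + 2 + 1))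
    (lie_bond_bond H (by omega)) (lie_pot_bond H (by omega)) (lie_pot_bond H (by omega))
    (lie_pot_bond H (by omega)) (lie_pot_bond H (by omega)) (lie_pot_bond H (by omega))
    (lie_pot_bond H (by omega))
  have n1 : nest H 1 i = ⁅bond H i, bond H (i + 1)⁆ := rfl
  have n2 : nest H 2 i = ⁅bond H i, ⁅bond H (i + 1), bond H (i + 2)⁆⁆ := by
    rw [nest_succ, nest_succ, a1]; rfl
  have hn1 := (isTopFamily_nest H 1 i).1
  have c1 : ⁅corr H 1 i, bond H (i + 2)⁆ = -ends i (i + 2 + 1) ⁅⁅bond H i + bond H (i + 1) + pot H i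
      + pot H (i + 1) + pot H (i + 2), ⁅bond H i, bond H (i + 1)⁆⁆, bond H (i + 2)⁆ := by
    have e : i + ((1 : ℕ) : ℤ) + 1 = i + 2 := by push_cast; ring
    rw [e] at hn1
    rw [corr, e, neg_lie, lie_ends_right (by omega), r3, add_lie _ (op H ∅), hempty, add_zero, n1]
    exact (off_of_mem (rs_mem H _) (by simp)).lie (off_of_mem hn1 (by simp))
  have c2 : corr H 2 i = -ends i (i + 2 + 1) ⁅bond H i + bond H (i + 1) + bond H (i + 2) + pot H i
      + pot H (i + 1) + pot H (i + 2) + pot H (i + 2 + 1),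
        ⁅bond H i, ⁅bond H (i + 1), bond H (i + 2)⁆⁆⁆ := by
    rw [corr, show i + ((2 : ℕ) : ℤ) + 1 = i + 2 + 1 by push_cast; ring, r4, add_lie _ (op H ∅),
      hempty, add_zero, n2]
  have c3 : bdry H 1 (fun i => ends i (i + 2) (K i)) i
      = ends i (i + 2 + 1) (⁅bond H i, K (i + 1)⁆ - ⁅K i, bond H (i + 2)⁆) := by
    rw [bdry, show i + ((1 : ℕ) : ℤ) + 1 = i + 2 by push_cast; ring, a2,
      lie_ends_left (by omega) (off_of_mem (hK (i + 1)) (by simp)),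
      lie_ends_right (by omega) (off_of_mem (hK i) (by simp)), map_sub]
  have hK1 : K (i + 1) = ⁅bond H (i + 1), ⁅bond H (i + 1), bond H (i + 2)⁆⁆
      + (2 : ℤ) • ⁅bond H (i + 2), ⁅bond H (i + 1), bond H (i + 2)⁆⁆
      + ⁅⁅pot H (i + 1) + pot H (i + 2), bond H (i + 1)⁆, bond H (i + 2)⁆
      + (2 : ℤ) • ⁅bond H (i + 1), ⁅pot H (i + 2) + pot H (i + 2 + 1), bond H (i + 2)⁆⁆ := by
    simp only [K, a1, a2]
  have z2 : ∀ X : Obs d, (2 : ℂ) • X = (2 : ℤ) • X := fun X => by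
    rw [← Int.cast_smul_eq_zsmul ℂ]; norm_num
  have z3 : ∀ X : Obs d, (3 : ℂ) • X = (3 : ℤ) • X := fun X => by
    rw [← Int.cast_smul_eq_zsmul ℂ]; norm_num
  rw [c1, c2, c3, smul_neg, z2, ← map_zsmul, key, hK1, z3, smul_neg, ← map_zsmul, ← neg_add',
    ← map_add]
  simp only [K, add_sub_assoc]

/-- The recursion for `corr` rewrites the equation as [h_i, θ_{i+1}] = [ψ_i, h_j], j being the left
site of the last bond. Peeling gives ω with ψ_i = [h_i, ω_{i+1}] and θ_i = [ω_i, h_{j-1}], and ∂ω =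
ψ - θ is an equation of the same kind, one site shorter. The coefficient in the conclusion is the
invariant of this process. -/
theorem corr_descent {H : FormalOp d} (hH : HasRange H 2) (hinj : InjectiveBonds H) {n : ℕ}
    {a b : ℂ} {χ : ℤ → Obs d} (hχ : IsTopFamily (n + 1) χ)
    (h : ∀ i, bdry H (n + 1) χ i = a • corr H (n + 2) i
      + b • ⁅corr H (n + 1) i, bond H (i + n + 2)⁆) :
    ∃ ω, IsTopFamily 0 ω ∧ ∀ i, bdry H 0 ω i = (((n + 3) * a + (n + 2) * b) / 2) • corr H 1 i := by
  induction n generalizing a b χ with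
  | zero =>
    obtain ⟨κ, hκ, hκ2⟩ := exists_corr_two hH
    obtain ⟨ω, hω, h1, h2⟩ := hinj.peel_family (n := 0)
      -- Adding `(a / 2) • κ` absorbs the `bdry` term of `exists_corr_two`; the right side becomes
      -- `3 / 2 * a + b` times the bracket of `corr H 1` with the last bond, which is moved into
      -- `ψ`.
      (ψ := fun i => χ i + (a / 2) • κ i + (3 / 2 * a + b) • corr H 1 i)
      (θ := fun i => χ i + (a / 2) • κ i)
      ((hχ.add (hκ.smul _)).add ((isTopFamily_corr H 1).smul _)) (hχ.add (hκ.smul _)) fun i => by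
        have e1 := h i
        have e2 := hκ2 i
        have e3 : corr H 2 i = (3 / 2 : ℂ) • ⁅corr H 1 i, bond H (i + 2)⁆
            - (1 / 2 : ℂ) • bdry H 1 κ i := by
          have := congrArg ((1 / 2 : ℂ) • ·) e2
          simp only [smul_smul, smul_sub] at this
          norm_num at this
          rw [this]
        simp only [bdry, zero_add, e3, Nat.cast_zero, add_zero, Nat.cast_one,
          show i + 1 + 1 = i + 2 by ring] at e1 ⊢
        simp only [lie_add, add_lie, lie_smul, smul_lie, add_smul]
        rw [sub_eq_iff_eq_add] at e1
        rw [e1]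
        module
    refine ⟨ω, hω, fun i => ?_⟩
    have e1 := h1 i
    have e2 := h2 i
    simp only [bdry, Nat.cast_zero, add_zero] at e1 e2 ⊢
    rw [← e1, ← e2]
    module
  | succ n ih =>
    obtain ⟨ω, hω, h1, h2⟩ := hinj.peel_family (n := n + 1)
      (ψ := fun i => χ i + (a + b) • corr H (n + 2) i)
      (θ := fun i => χ i - a • (corr H (n + 2) i - ⁅corr H (n + 1) i, bond H (i + n + 2)⁆))
      (hχ.add ((isTopFamily_corr H (n + 2)).smul _))
      (hχ.sub (((isTopFamily_corr H (n + 2)).sub (by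
        have := (isTopFamily_corr H (n + 1)).lie_right (H := H)
        have e : ∀ i : ℤ, i + ((n + 1 : ℕ) : ℤ) + 1 = i + n + 2 := fun i => by push_cast; ring
        simpa only [e] using this)).smul a)) fun i => by
        have e1 := h i
        have e2 := corr_add_two hH (m := n + 1) (by omega) i
        have s1 : i + 1 + (n : ℤ) + 2 = i + n + 3 := by ring
        have s2 : i + ((n + 1 : ℕ) : ℤ) + 2 = i + n + 3 := by push_cast; ring
        have s3 : i + ((n + 1 + 1 : ℕ) : ℤ) + 1 = i + n + 3 := by push_cast; ring
        rw [s2] at e1 e2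
        rw [bdry, s3, e2, sub_eq_iff_eq_add] at e1
        simp only [lie_sub, add_lie, lie_smul, smul_lie, s1, s2]
        rw [e1]
        module
    -- The difference of the two peeled families changes `(a, b)` into `(2 * a + b, -a)`. Indeed
    -- (n+3)(2a+b) - (n+2)a = (n+4)a + (n+3)b, so the final coefficient is unchanged.
    obtain ⟨ω', hω', h'⟩ := ih (a := 2 * a + b) (b := -a) hω fun i => by
      have e1 := h1 i
      have e2 := h2 i
      have s2 : i + ((n + 1 : ℕ) : ℤ) + 1 = i + n + 2 := by push_cast; ring
      rw [s2] at e2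
      rw [bdry, s2, ← e1, ← e2]
      module
    refine ⟨ω', hω', fun i => ?_⟩
    rw [h' i]
    congr 1
    push_cast
    ring


/-! ### Translates of formal operators -/

theorem shiftSet_shiftSet (x y : ℤ) (S : Finset ℤ) :
    shiftSet x (shiftSet y S) = shiftSet (x + y) S := by
  ext i; simp [sub_sub]

theorem shiftSet_zero (S : Finset ℤ) : shiftSet 0 S = S := by ext i; simp

theorem shiftSet_Icc (x a b : ℤ) : shiftSet x (Finset.Icc a b) = Finset.Icc (a + x) (b + x) := by
  ext i; simp only [mem_shiftSet, Finset.mem_Icc]; omega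

theorem exists_shiftOp (x : ℤ) (Φ : FormalOp d) :
    ∃ Ψ : FormalOp d, ∀ A, op Ψ A = shift x (op Φ (shiftSet (-x) A)) := by
  refine exists_formalOp _ (fun A => ?_) fun A a ha => ?_
  · have := shift_mem (op_mem Φ (shiftSet (-x) A)) x
    rwa [shiftSet_shiftSet, add_neg_cancel, shiftSet_zero] at this
  · have := shift_siteAvg x (a - x) (op Φ (shiftSet (-x) A))
    rw [siteAvg_op Φ (by simpa using ha), map_zero, sub_add_cancel] at this
    exact this.symm

/-- The translate of a formal operator by `x` sites. -/
noncomputable def shiftOp (x : ℤ) (Φ : FormalOp d) : FormalOp d := (exists_shiftOp x Φ).choose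

theorem op_shiftOp (x : ℤ) (Φ : FormalOp d) (A : Finset ℤ) :
    op (shiftOp x Φ) A = shift x (op Φ (shiftSet (-x) A)) := (exists_shiftOp x Φ).choose_spec A

theorem isTranslationInvariant_iff {Φ : FormalOp d} :
    IsTranslationInvariant Φ ↔ ∀ x, shiftOp x Φ = Φ := by
  have h1 : IsTranslationInvariant Φ ↔ ∀ A x, op Φ (shiftSet x A) = shift x (op Φ A) := by
    refine forall₂_congr fun A x => ?_
    rw [op, op, shift_loc]
    constructor
    · intro h; exact congrArg _ (Matrix.ext h)
    · intro h s t; exact congrFun (congrFun (loc_injective _ h) s) t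
  rw [h1]
  constructor
  · intro h x
    refine ext_op fun A => ?_
    rw [op_shiftOp, ← h, shiftSet_shiftSet, add_neg_cancel, shiftSet_zero]
  · intro h A x
    conv_lhs => rw [← h x]
    rw [op_shiftOp, shiftSet_shiftSet, neg_add_cancel, shiftSet_zero]

theorem op_shiftSet {Φ : FormalOp d} (hΦ : IsTranslationInvariant Φ) (x : ℤ) (A : Finset ℤ) :
    op Φ (shiftSet x A) = shift x (op Φ A) := by
  conv_lhs => rw [← isTranslationInvariant_iff.1 hΦ x]
  rw [op_shiftOp, shiftSet_shiftSet, neg_add_cancel, shiftSet_zero]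

theorem rs_shiftOp (x : ℤ) (Φ : FormalOp d) (B : Finset ℤ) :
    rs (shiftOp x Φ) B = shift x (rs Φ (shiftSet (-x) B)) := by
  rw [rs, rs, map_sum]
  refine Finset.sum_bij' (fun A _ => shiftSet (-x) A) (fun A _ => shiftSet x A) ?_ ?_ ?_ ?_ ?_
  · intro A hA
    rw [Finset.mem_powerset] at hA ⊢
    intro i; simpa using @hA (i + x)
  · intro A hA
    rw [Finset.mem_powerset] at hA ⊢
    intro i hi
    simpa using hA (mem_shiftSet.1 hi)
  · intro A _; simp [shiftSet_shiftSet, shiftSet_zero]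
  · intro A _; simp [shiftSet_shiftSet, shiftSet_zero]
  · intro A _; exact op_shiftOp x Φ A

theorem rs_shiftSet {Φ : FormalOp d} (hΦ : IsTranslationInvariant Φ) (x : ℤ) (B : Finset ℤ) :
    rs Φ (shiftSet x B) = shift x (rs Φ B) := by
  conv_lhs => rw [← isTranslationInvariant_iff.1 hΦ x]
  rw [rs_shiftOp, shiftSet_shiftSet, neg_add_cancel, shiftSet_zero]

theorem HasRange.shiftOp {Φ : FormalOp d} {n : ℕ} (hΦ : HasRange Φ n) (x : ℤ) :
    HasRange (shiftOp x Φ) n := by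
  intro A hA a ha b hb
  have := hΦ (shiftSet (-x) A) (fun h => hA (by rw [op_shiftOp, h, map_zero])) (a - x)
    (by simpa using ha) (b - x) (by simpa using hb)
  omega

theorem comm_shiftOp {Φ : FormalOp d} {r : ℕ} (hΦ : HasRange Φ r) (x : ℤ) (Ψ : FormalOp d) :
    comm (shiftOp x Φ) (shiftOp x Ψ) = shiftOp x (comm Φ Ψ) := by
  refine ext_rs fun D => ?_
  have hn : nbhd D r ⊆ shiftSet x (nbhd (shiftSet (-x) D) r) := by
    intro c hc
    obtain ⟨a, ha, h1, h2⟩ := mem_nbhd.1 hc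
    exact mem_shiftSet.2 (mem_nbhd.2 ⟨a - x, by simpa using ha, by omega, by omega⟩)
  have hs : shiftSet x (nbhd (shiftSet (-x) D) r \ shiftSet (-x) D)
      = shiftSet x (nbhd (shiftSet (-x) D) r) \ D := by
    ext i; simp
  rw [rs_comm (hΦ.shiftOp x) hn, rs_shiftOp, rs_shiftOp, rs_shiftOp, rs_comm hΦ le_rfl, shift_avg,
    shift_lie, shiftSet_shiftSet, neg_add_cancel, shiftSet_zero, hs]

theorem IsTranslationInvariant.comm {Φ Ψ : FormalOp d} {r : ℕ} (hr : HasRange Φ r)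
    (hΦ : IsTranslationInvariant Φ) (hΨ : IsTranslationInvariant Ψ) :
    IsTranslationInvariant (comm Φ Ψ) := by
  rw [isTranslationInvariant_iff] at *
  intro x
  rw [← comm_shiftOp hr, hΦ x, hΨ x]

/-! ### Adjoints and positivity of the trace -/

/-- The adjoint of a formal operator. -/
noncomputable def adj (Φ : FormalOp d) : FormalOp d :=
  ⟨fun A => (Φ.1 A).conjTranspose, fun A a s t => by
    have := congrArg star (Φ.2 A a t s)
    simpa [star_sum, Matrix.conjTranspose_apply] using this⟩

theorem opRange_adj (Φ : FormalOp d) : opRange (adj Φ) = opRange Φ := by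
  simp [opRange, adj, Matrix.conjTranspose_eq_zero]

theorem restrict_adj (Φ : FormalOp d) (B : Finset ℤ) :
    restrict (adj Φ) B = (restrict Φ B).conjTranspose := by
  rw [restrict, restrict, Matrix.conjTranspose_sum]
  refine Finset.sum_congr rfl fun A _ => ?_
  ext s t
  simp only [embed, adj, Matrix.conjTranspose_apply, eq_comm (a := s _)]
  split_ifs <;> simp

theorem reduce_conjTranspose {B : Finset ℤ} (A C : Finset ℤ) (Y : LocOp d B) :
    reduce A C Y.conjTranspose = (reduce A C Y).conjTranspose := by
  ext s t
  simp only [reduce, Matrix.conjTranspose_apply, eq_comm (a := s _)]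
  split_ifs <;> simp

theorem component_conjTranspose {B : Finset ℤ} (A : Finset ℤ) (Y : LocOp d B) :
    component A Y.conjTranspose = (component A Y).conjTranspose := by
  simp [component, Matrix.conjTranspose_sum, Matrix.conjTranspose_smul, reduce_conjTranspose]

theorem comm_adj {H : FormalOp d} (hH : IsSelfAdjointOp H) (Ψ : FormalOp d) :
    comm H (adj Ψ) = -adj (comm H Ψ) := by
  refine Subtype.ext (funext fun A => ?_)
  have h1 : adj H = H := Subtype.ext (funext fun A => hH A)
  have h2 : ∀ B, restrict H B = (restrict H B).conjTranspose := fun B => by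
    rw [← restrict_adj, h1]
  change component A _ = -(component A _).conjTranspose
  rw [← component_conjTranspose, restrict_adj, h2]
  have h3 : ∀ {B : Finset ℤ} (X Y : LocOp d B), ⁅X.conjTranspose, Y.conjTranspose⁆
      = (-1 : ℂ) • (⁅X, Y⁆.conjTranspose : LocOp d B) := by
    intro B X Y
    simp [Ring.lie_def, Matrix.conjTranspose_sub, Matrix.conjTranspose_mul]
  have h4 : ∀ {B : Finset ℤ} (Y : LocOp d B), component A ((-1 : ℂ) • Y) = -component A Y := by
    intro B Y
    have : ∀ C, reduce A C ((-1 : ℂ) • Y) = -reduce A C Y := by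
      intro C; ext s t
      simp only [reduce, Matrix.neg_apply]
      split_ifs <;> simp
    simp only [component, this, smul_neg, Finset.sum_neg_distrib]
  rw [h3, h4, ← h2]

theorem isTranslationInvariant_adj {Φ : FormalOp d} (hΦ : IsTranslationInvariant Φ) :
    IsTranslationInvariant (adj Φ) := fun A x s t => congrArg star (hΦ A x t s)

theorem HasRange.adj {Φ : FormalOp d} {n : ℕ} (hΦ : HasRange Φ n) : HasRange (adj Φ) n :=
  opRange_le_iff.1 ((opRange_adj Φ).trans_le (opRange_le_iff.2 hΦ))

theorem avg_loc_self {A : Finset ℤ} (Z : LocOp d A) :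
    avg A (loc A Z) = (((d : ℂ) ^ A.card)⁻¹ * Z.trace) • (1 : Obs d) := by
  have h1 := avg_loc Z (Finset.empty_subset A)
  rw [Finset.sdiff_empty, Finset.powerset_empty, Finset.sum_singleton] at h1
  rw [h1, ← map_one (loc ∅), ← map_smul]
  congr 1
  ext s t
  have hst : s = t := Subsingleton.elim _ _
  subst hst
  have hg : ∀ u : A → Fin d, glue ∅ s u = u := fun u => by funext b; simp [glue]
  simp [component, reduce, hg, Matrix.trace]

/-- Each summand is a positive multiple of tr(X* X), so a vanishing sum kills every X. -/
theorem sum_avg_adj_mul_eq_zero {Φ : FormalOp d} {F : Finset (Finset ℤ)}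
    (h : ∑ A ∈ F, avg A (op (adj Φ) A * op Φ A) = 0) {A : Finset ℤ} (hA : A ∈ F) :
    op Φ A = 0 := by
  open scoped ComplexOrder in
  have h1 : ∀ A, avg A (op (adj Φ) A * op Φ A)
      = (((d : ℂ) ^ A.card)⁻¹ * ((Φ.1 A).conjTranspose * Φ.1 A).trace) • (1 : Obs d) := fun A => by
    rw [op, op, ← map_mul, avg_loc_self]; rfl
  simp only [h1, ← Finset.sum_smul] at h
  have h2 := (smul_eq_zero.1 h).resolve_right one_ne_zero
  have hd : ∀ A : Finset ℤ, (0 : ℂ) < ((d : ℂ) ^ A.card)⁻¹ := fun A =>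
    inv_pos.2 (pow_pos (by exact_mod_cast NeZero.pos d) _)
  rw [Finset.sum_eq_zero_iff_of_nonneg fun A _ => mul_nonneg (hd A).le
    (Matrix.posSemidef_conjTranspose_mul_self _).trace_nonneg] at h2
  have h3 := (mul_eq_zero.1 (h2 A hA)).resolve_left (hd A).ne'
  exact op_eq_zero_iff.2 (Matrix.trace_conjTranspose_mul_self_eq_zero_iff.1 h3)

/-! ### The trace per site and vanishing double commutators -/

theorem shift_avg_self {Λ : Finset ℤ} {W : Obs d} (hW : W ∈ opsOn Λ) (x : ℤ) :
    shift x (avg Λ W) = avg Λ W := by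
  have h1 := avg_mem hW Λ
  rw [Finset.sdiff_self] at h1
  have h3 : (opsOn ∅ : Subalgebra ℂ (Obs d)) = ⊥ := by simp [opsOn]
  rw [h3] at h1
  obtain ⟨c, hc⟩ := Algebra.mem_bot.1 h1
  rw [← hc, AlgEquiv.commutes]

theorem avg_eq_of_mem {N Λ : Finset ℤ} (h : N ⊆ Λ) {W : Obs d} (hW : W ∈ opsOn N) :
    avg Λ W = avg N W := by
  rw [avg_avg_of_subset h, avg_of_mem hW]
  exact Finset.disjoint_left.2 fun x hx => (Finset.mem_sdiff.1 hx).2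

theorem avg_mul_lie {Λ : Finset ℤ} {h : Obs d} (hh : h ∈ opsOn Λ) (p q : Obs d) :
    avg Λ (p * ⁅h, q⁆) = avg Λ (⁅p, h⁆ * q) := by
  have := avg_cyc hh (p * q)
  simp only [LieRing.of_associative_ring_bracket, mul_sub, sub_mul, map_sub, ← mul_assoc] at this ⊢
  rw [this]

theorem avg_mul_left {S : Finset ℤ} {X : Obs d} (hX : ∀ i ∈ S, Off i X) (Y : Obs d) :
    avg S (X * Y) = X * avg S Y := by
  induction S using Finset.induction_on with
  | empty => simp
  | insert j S hj ih =>
    rw [avg_insert hj, avg_insert hj, ih fun i hi => hX i (Finset.mem_insert_of_mem hi),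
      siteAvg_mul_left (hX j (Finset.mem_insert_self _ _))]

theorem avg_mul_right {S : Finset ℤ} {Y : Obs d} (hY : ∀ i ∈ S, Off i Y) (X : Obs d) :
    avg S (X * Y) = avg S X * Y := by
  induction S using Finset.induction_on with
  | empty => simp
  | insert j S hj ih =>
    rw [avg_insert hj, avg_insert hj, ih fun i hi => hY i (Finset.mem_insert_of_mem hi),
      siteAvg_mul_right (hY j (Finset.mem_insert_self _ _))]

theorem off_of_mem_sdiff {N Λ : Finset ℤ} {Z : Obs d} (hZ : Z ∈ opsOn N) :
    ∀ i ∈ Λ \ N, Off i Z := fun _ hi => off_of_mem hZ (Finset.mem_sdiff.1 hi).2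

theorem sdiff_sdiff_eq_inter {B N Λ : Finset ℤ} (hB : B ⊆ Λ) : B \ (Λ \ N) = B ∩ N := by
  ext x
  have := @hB x
  simp only [Finset.mem_sdiff, Finset.mem_inter]
  tauto

theorem avg_mul_rs {Φ : FormalOp d} {B N Λ : Finset ℤ} (hB : B ⊆ Λ) (hN : N ⊆ Λ) {Z : Obs d}
    (hZ : Z ∈ opsOn N) : avg Λ (Z * rs Φ B) = avg N (Z * rs Φ (B ∩ N)) := by
  rw [avg_avg_of_subset hN, avg_mul_left (off_of_mem_sdiff hZ), avg_rs, sdiff_sdiff_eq_inter hB]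

theorem avg_rs_mul {Φ : FormalOp d} {B N Λ : Finset ℤ} (hB : B ⊆ Λ) (hN : N ⊆ Λ) {Z : Obs d}
    (hZ : Z ∈ opsOn N) : avg Λ (rs Φ B * Z) = avg N (rs Φ (B ∩ N) * Z) := by
  rw [avg_avg_of_subset hN, avg_mul_right (off_of_mem_sdiff hZ), avg_rs, sdiff_sdiff_eq_inter hB]

theorem lie_rs_eq {H : FormalOp d} {r : ℕ} (hH : HasRange H r) {S N Λ : Finset ℤ} {X : Obs d}
    (hX : X ∈ opsOn S) (hS : nbhd S r ⊆ N) (hN : N ⊆ Λ) : ⁅rs H Λ, X⁆ = ⁅rs H N, X⁆ := by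
  rw [← sub_eq_zero, ← sub_lie]
  have : rs H Λ - rs H N = ∑ C ∈ Λ.powerset \ N.powerset, op H C := by
    rw [rs, rs, ← Finset.sum_sdiff (Finset.powerset_mono.2 hN), add_sub_cancel_right]
  rw [this, sum_lie]
  refine Finset.sum_eq_zero fun C hC => ?_
  simp only [Finset.mem_sdiff, Finset.mem_powerset] at hC
  by_cases h0 : op H C = 0
  · simp [h0]
  by_cases hCS : Disjoint C S
  · exact lie_eq_zero_of_disjoint (op_mem H C) hX hCS
  · obtain ⟨c, hc, hcS⟩ := Finset.not_disjoint_iff.1 hCS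
    refine absurd (fun x hx => hS (mem_nbhd.2 ⟨c, hcS, ?_, ?_⟩)) hC.2
    · have := hH C h0 x hx c hc; omega
    · have := hH C h0 c hc x hx; omega

/-- The sum of the components of `Φ` whose lowest site is `c`, for `Φ` of range at most `r`. -/
noncomputable def low (r : ℕ) (Φ : FormalOp d) (c : ℤ) : Obs d :=
  rs Φ (Finset.Icc c (c + r)) - rs Φ (Finset.Icc (c + 1) (c + r))

theorem low_mem (r : ℕ) (Φ : FormalOp d) (c : ℤ) : low r Φ c ∈ opsOn (Finset.Icc c (c + r)) :=
  sub_mem (rs_mem _ _) (opsOn_mono (Finset.Icc_subset_Icc (by omega) le_rfl) (rs_mem _ _))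

theorem erase_Icc_left (c L : ℤ) : (Finset.Icc c L).erase c = Finset.Icc (c + 1) L := by
  ext x; simp only [Finset.mem_erase, Finset.mem_Icc]; omega

theorem rs_sub_rs (Φ : FormalOp d) (c L : ℤ) :
    rs Φ (Finset.Icc c L) - rs Φ (Finset.Icc (c + 1) L)
      = ∑ A ∈ (Finset.Icc c L).powerset with c ∈ A, op Φ A := by
  rw [← erase_Icc_left, ← siteAvg_rs, rs, map_sum, ← Finset.sum_sub_distrib, Finset.sum_filter]
  refine Finset.sum_congr rfl fun A _ => ?_
  split_ifs with h
  · rw [siteAvg_op Φ h, sub_zero]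
  · rw [siteAvg_of_off (off_of_mem (op_mem Φ A) h), sub_self]

theorem low_eq {r : ℕ} {Φ : FormalOp d} (hΦ : HasRange Φ r) {c L : ℤ} (h : c + r ≤ L) :
    low r Φ c = rs Φ (Finset.Icc c L) - rs Φ (Finset.Icc (c + 1) L) := by
  rw [low, rs_sub_rs, rs_sub_rs]
  refine Finset.sum_subset (Finset.filter_subset_filter _ (Finset.powerset_mono.2
    (Finset.Icc_subset_Icc le_rfl h))) fun A hA hA' => ?_
  by_contra h0
  rw [Finset.mem_filter, Finset.mem_powerset] at hA hA'
  refine hA' ⟨fun x hx => ?_, hA.2⟩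
  have := hΦ A h0 c hA.2 x hx
  have := Finset.mem_Icc.1 (hA.1 hx)
  exact Finset.mem_Icc.2 (by omega)

theorem sum_low {r : ℕ} {Φ : FormalOp d} (hΦ : HasRange Φ r) (c L : ℤ) (n : ℕ)
    (h : c + n + r ≤ L) : ∑ k ∈ Finset.range n, low r Φ (c + k)
      = rs Φ (Finset.Icc c L) - rs Φ (Finset.Icc (c + n) L) := by
  have : ∀ k ∈ Finset.range n, low r Φ (c + k)
      = rs Φ (Finset.Icc (c + (k : ℕ)) L) - rs Φ (Finset.Icc (c + (k + 1 : ℕ)) L) := by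
    intro k hk
    have := Finset.mem_range.1 hk
    rw [low_eq hΦ (L := L) (by omega)]
    push_cast
    rw [add_assoc]
  rw [Finset.sum_congr rfl this, Finset.sum_range_sub' fun k : ℕ => rs Φ (Finset.Icc (c + k) L)]
  simp

theorem shift_low {Φ : FormalOp d} (hΦ : IsTranslationInvariant Φ) (r : ℕ) (c x : ℤ) :
    shift x (low r Φ c) = low r Φ (c + x) := by
  rw [low, low, map_sub, ← rs_shiftSet hΦ, ← rs_shiftSet hΦ, shiftSet_Icc, shiftSet_Icc]
  congr 3 <;> ring_nf


/-- Components on different sets are orthogonal for the trace. -/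
theorem avg_op_mul_rs (Φ Ψ : FormalOp d) {A D : Finset ℤ} (hA : A ⊆ D) :
    avg D (op Φ A * rs Ψ D) = avg A (op Φ A * op Ψ A) := by
  rw [avg_mul_rs le_rfl hA (op_mem Φ A), Finset.inter_eq_right.2 hA, rs, Finset.mul_sum, map_sum]
  refine Finset.sum_eq_single_of_mem A (Finset.mem_powerset_self A) fun C hC hne => ?_
  obtain ⟨a, haA, haC⟩ := Finset.not_subset.1 fun h =>
    hne (Finset.Subset.antisymm (Finset.mem_powerset.1 hC) h)
  refine avg_eq_zero haA ?_
  rw [siteAvg_mul_right (off_of_mem (op_mem Ψ C) haC), siteAvg_op Φ haA, zero_mul]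

theorem nbhd_Icc_subset {a b a' b' : ℤ} {r : ℕ} (ha : a' + r ≤ a) (hb : b + r ≤ b') :
    nbhd (Finset.Icc a b) r ⊆ Finset.Icc a' b' := by
  intro c hc
  obtain ⟨x, hx, h1, h2⟩ := mem_nbhd.1 hc
  rw [Finset.mem_Icc] at hx ⊢
  omega

/-- The trilinear form `tr (p [H_Λ, q])` does not depend on a sufficiently large window `Λ`. -/
theorem avg_mul_lie_rs_eq {H : FormalOp d} {r : ℕ} (hH : HasRange H r) {S N M Λ : Finset ℤ}
    {p q : Obs d} (hq : q ∈ opsOn S) (hS : nbhd S r ⊆ N) (hN : N ⊆ M) (hp : p ∈ opsOn M)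
    (hM : M ⊆ Λ) : avg Λ (p * ⁅rs H Λ, q⁆) = avg M (p * ⁅rs H N, q⁆) := by
  rw [lie_rs_eq hH hq hS (hN.trans hM)]
  exact avg_eq_of_mem hM (mul_mem hp (lie_mem_opsOn (opsOn_mono hN (rs_mem H N))
    (opsOn_mono (((subset_nbhd S r).trans hS).trans hN) hq)))

/-- Translating by `-x` brings the density of `Q` to the origin. The traced product sits well inside
the window, so the displacement of the window is not felt. -/
theorem avg_low_shift {H P Q : FormalOp d} {R : ℕ} (hH : HasRange H R)
    (hHt : IsTranslationInvariant H) (hPt : IsTranslationInvariant P)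
    (hQt : IsTranslationInvariant Q) {Λ : Finset ℤ} {N : ℤ} (hΛ : Λ = Finset.Icc (-N) N)
    (hN : 6 * R + 1 ≤ N) {x : ℤ} (h1 : -(2 * R : ℤ) ≤ x) (h2 : x ≤ 2 * R) :
    avg Λ (low R P 0 * ⁅rs H Λ, low R Q x⁆) = avg Λ (low R P (-x) * ⁅rs H Λ, low R Q 0⁆) := by
  have hmem : low R P 0 * ⁅rs H Λ, low R Q x⁆ ∈ opsOn Λ := by
    refine mul_mem (opsOn_mono ?_ (low_mem R P 0)) (lie_mem_opsOn (rs_mem H Λ)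
      (opsOn_mono ?_ (low_mem R Q x)))
    · rw [hΛ]; exact Finset.Icc_subset_Icc (by omega) (by omega)
    · rw [hΛ]; exact Finset.Icc_subset_Icc (by omega) (by omega)
  have key : ∀ Λ' : Finset ℤ, Finset.Icc (-(3 * R : ℤ)) (3 * R) ⊆ Λ' →
      avg Λ' (low R P (-x) * ⁅rs H Λ', low R Q 0⁆) = avg (Finset.Icc (-(3 * R : ℤ)) (3 * R))
        (low R P (-x) * ⁅rs H (Finset.Icc (-R : ℤ) (2 * R)), low R Q 0⁆) := fun Λ' hΛ' =>
    avg_mul_lie_rs_eq hH (low_mem R Q 0) (nbhd_Icc_subset (by omega) (by omega))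
      (Finset.Icc_subset_Icc (by omega) (by omega))
      (opsOn_mono (Finset.Icc_subset_Icc (by omega) (by omega)) (low_mem R P (-x))) hΛ'
  rw [← shift_avg_self hmem (-x), shift_avg, map_mul, shift_lie, shift_low hPt, shift_low hQt,
    ← rs_shiftSet hHt, zero_add, add_neg_cancel, key, key]
  · rw [hΛ]; exact Finset.Icc_subset_Icc (by omega) (by omega)
  · rw [hΛ, shiftSet_Icc]; exact Finset.Icc_subset_Icc (by omega) (by omega)

theorem op_comm_empty {Φ Ψ : FormalOp d} {r : ℕ} (hΦ : HasRange Φ r) : op (comm Φ Ψ) ∅ = 0 := by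
  have h : rs (comm Φ Ψ) ∅ = op (comm Φ Ψ) ∅ := by simp [rs]
  rw [← h, rs_comm hΦ le_rfl, Finset.sdiff_empty, avg_lie_eq_zero (rs_mem _ _)]

/-- A translation-invariant local operator whose double commutator with a self-adjoint
translation-invariant `H` vanishes commutes with `H`. -/
theorem comm_eq_zero_of_comm_comm {H Q : FormalOp d} {r s : ℕ} (hHr : HasRange H r)
    (hQr : HasRange Q s) (hHsa : IsSelfAdjointOp H) (hHt : IsTranslationInvariant H)
    (hQt : IsTranslationInvariant Q) (h : comm H (comm H Q) = 0) : comm H Q = 0 := by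
  -- The target is tr(Y* Y) = 0 per site. Fixing the density of Y* at the origin and summing over
  -- translates of the density of `Q` produces this trace; by translation it equals the sum with `Q`
  -- fixed and Y* summed, which contains [H, Y*] = -[H, Y]* = 0.
  set Y := comm H Q with hY
  obtain ⟨R, hR⟩ : ∃ R, R = r + s := ⟨_, rfl⟩
  have hHR : HasRange H R := hHr.mono (by omega)
  have hQR : HasRange Q R := hQr.mono (by omega)
  have hYR : HasRange Y R := hHr.comm hQr (by omega)
  have hYt : IsTranslationInvariant Y := hHt.comm hHr hQt
  set P := adj Y with hP
  have hPR : HasRange P R := hYR.adj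
  have hPt : IsTranslationInvariant P := isTranslationInvariant_adj hYt
  have hHP : comm H P = 0 := by
    rw [comm_adj hHsa, h]
    refine ext_op fun A => ?_
    rw [op_neg, op_zero, neg_eq_zero, op_eq_zero_iff]
    exact Matrix.conjTranspose_zero
  -- A density at the origin lives on `[0, R]` and its commutator with `H` on `[-R, 2 * R]`. The
  -- densities that can meet the latter start between `-2 * R` and `2 * R`, giving `4 * R + 1`
  -- terms; `6 * R + 1` leaves room to translate the window by any of these amounts.
  obtain ⟨N, hN⟩ : ∃ N : ℤ, N = 6 * R + 1 := ⟨_, rfl⟩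
  set Λ := Finset.Icc (-N) N with hΛ
  set D := Finset.Icc (0 : ℤ) (0 + R) with hD
  set N₀ := Finset.Icc (-R : ℤ) (2 * R) with hN₀
  have hDN : nbhd D R ⊆ N₀ := nbhd_Icc_subset (by omega) (by omega)
  have hNΛ : N₀ ⊆ Λ := Finset.Icc_subset_Icc (by omega) (by omega)
  have hDΛ : D ⊆ Λ := Finset.Icc_subset_Icc (by omega) (by omega)
  have hI1 : Finset.Icc (-(2 * R) : ℤ) N ∩ N₀ = N₀ :=
    Finset.inter_eq_right.2 (Finset.Icc_subset_Icc (by omega) (by omega))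
  have hI2 : Finset.Icc (-(2 * R) + (4 * R + 1 : ℕ) : ℤ) N ∩ N₀ = ∅ := by
    refine Finset.eq_empty_of_forall_notMem fun x hx => ?_
    rw [hN₀, Finset.mem_inter, Finset.mem_Icc, Finset.mem_Icc] at hx
    push_cast at hx
    obtain ⟨⟨h1, -⟩, -, h2⟩ := hx
    linarith
  have hB1 : Finset.Icc (-(2 * R) : ℤ) N ⊆ Λ := Finset.Icc_subset_Icc (by omega) (by omega)
  have hB2 : Finset.Icc (-(2 * R) + (4 * R + 1 : ℕ) : ℤ) N ⊆ Λ :=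
    Finset.Icc_subset_Icc (by push_cast; omega) (by omega)
  have hscal : ∀ X : Obs d, ⁅X, rs Q ∅⁆ = 0 := fun X => by
    rw [← lie_skew, lie_eq_zero_of_off (rs_mem Q ∅) (by simp), neg_zero]
  have hscal' : ∀ X : Obs d, ⁅rs P ∅, X⁆ = 0 := fun X =>
    lie_eq_zero_of_off (rs_mem P ∅) (by simp)
  -- The sum over the translates of the components of `Q`.
  have sum1 : ∑ k ∈ Finset.range (4 * R + 1),
      avg Λ (low R P 0 * ⁅rs H Λ, low R Q (-(2 * R) + k)⁆) = avg D (low R P 0 * rs Y D) := by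
    have hp : low R P 0 ∈ opsOn D := low_mem R P 0
    have hZ : ⁅low R P 0, rs H Λ⁆ ∈ opsOn N₀ := by
      rw [← lie_skew, lie_rs_eq hHR hp hDN hNΛ]
      exact neg_mem (lie_mem_opsOn (rs_mem _ _) (opsOn_mono ((subset_nbhd D R).trans hDN) hp))
    rw [← map_sum, ← Finset.mul_sum, ← lie_sum, sum_low hQR (-(2 * R)) N _ (by push_cast; omega),
      avg_mul_lie (rs_mem H Λ), mul_sub, map_sub, avg_mul_rs hB1 hNΛ hZ, avg_mul_rs hB2 hNΛ hZ, hI1,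
      hI2]
    have e1 : avg N₀ (⁅low R P 0, rs H Λ⁆ * rs Q ∅) = 0 := by
      rw [← Finset.empty_inter N₀, ← avg_mul_rs (Finset.empty_subset Λ) hNΛ hZ,
        ← avg_mul_lie (rs_mem H Λ), hscal, mul_zero, map_zero]
    have e2 : avg N₀ (⁅low R P 0, rs H Λ⁆ * rs Q N₀) = avg Λ (⁅low R P 0, rs H Λ⁆ * rs Q Λ) := by
      rw [avg_mul_rs le_rfl hNΛ hZ, Finset.inter_eq_right.2 hNΛ]
    rw [e1, e2, sub_zero, ← avg_mul_lie (rs_mem H Λ), avg_avg_of_subset hDΛ,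
      avg_mul_left (off_of_mem_sdiff hp), ← rs_comm hHR (hDN.trans hNΛ)]
  have sum2 : ∑ k ∈ Finset.range (4 * R + 1),
      avg Λ (low R P (-(2 * R) + k) * ⁅rs H Λ, low R Q 0⁆) = 0 := by
    have hq : low R Q 0 ∈ opsOn D := low_mem R Q 0
    have hZ : ⁅rs H Λ, low R Q 0⁆ ∈ opsOn N₀ := by
      rw [lie_rs_eq hHR hq hDN hNΛ]
      exact lie_mem_opsOn (rs_mem _ _) (opsOn_mono ((subset_nbhd D R).trans hDN) hq)
    rw [← map_sum, ← Finset.sum_mul, sum_low hPR (-(2 * R)) N _ (by push_cast; omega), sub_mul,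
      map_sub, avg_rs_mul hB1 hNΛ hZ, avg_rs_mul hB2 hNΛ hZ, hI1, hI2]
    have e1 : avg N₀ (rs P ∅ * ⁅rs H Λ, low R Q 0⁆) = 0 := by
      rw [← Finset.empty_inter N₀, ← avg_rs_mul (Finset.empty_subset Λ) hNΛ hZ,
        avg_mul_lie (rs_mem H Λ), hscal', zero_mul, map_zero]
    have e2 : avg N₀ (rs P N₀ * ⁅rs H Λ, low R Q 0⁆) = avg Λ (rs P Λ * ⁅rs H Λ, low R Q 0⁆) := by
      rw [avg_rs_mul le_rfl hNΛ hZ, Finset.inter_eq_right.2 hNΛ]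
    rw [e1, e2, sub_zero, avg_mul_lie (rs_mem H Λ), avg_avg_of_subset hDΛ,
      avg_mul_right (off_of_mem_sdiff hq), ← lie_skew, map_neg, ← rs_comm hHR (hDN.trans hNΛ), hHP]
    simp
  have hzero : avg D (low R P 0 * rs Y D) = 0 := by
    -- Translation exchanges displacement `x` of `Q` with displacement `-x` of `P`, hence the
    -- reflected order of summation.
    rw [← sum1, ← sum2, ← Finset.sum_range_reflect]
    refine Finset.sum_congr rfl fun k hk => ?_
    have hk' := Finset.mem_range.1 hk
    rw [avg_low_shift hHR hHt hPt hQt hΛ hN.ge (by omega) (by omega)]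
    congr 4
    omega
  have hlow : ∀ A, A ⊆ D → 0 ∈ A → op Y A = 0 := by
    rw [low, rs_sub_rs, Finset.sum_mul, map_sum] at hzero
    intro A hA h0
    refine sum_avg_adj_mul_eq_zero (F := D.powerset.filter (0 ∈ ·)) ?_
      (Finset.mem_filter.2 ⟨Finset.mem_powerset.2 hA, h0⟩)
    rw [← hzero]
    refine Finset.sum_congr rfl fun C hC => ?_
    exact (avg_op_mul_rs P Y (Finset.mem_powerset.1 (Finset.mem_filter.1 hC).1)).symm
  refine ext_op fun A => ?_
  rw [op_zero]
  by_contra hA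
  rcases A.eq_empty_or_nonempty with rfl | hne
  · exact hA (op_comm_empty hHr)
  · have hshift := op_shiftSet hYt (-A.min' hne) A
    rw [hlow _ (fun x hx => ?_) (by simpa using A.min'_mem hne)] at hshift
    · exact hA ((map_eq_zero_iff _ (shift _).injective).1 hshift.symm)
    · rw [mem_shiftSet, sub_neg_eq_add] at hx
      have h1 := hYR A hA _ (A.min'_mem hne) _ hx
      have h2 := A.min'_le _ hx
      exact Finset.mem_Icc.2 (by omega)


/-! ### The hypotheses on the interaction in the common algebra -/

theorem IsNearestNeighbour.hasRange {H : FormalOp d} (hH : IsNearestNeighbour H) :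
    HasRange H 2 := by
  intro A hA a ha b hb
  obtain ⟨i, rfl | rfl⟩ := hH A (mt op_eq_zero_iff.2 hA)
  · simp only [Finset.mem_insert, Finset.mem_singleton] at ha hb
    push_cast; omega
  · simp only [Finset.mem_singleton] at ha hb
    push_cast; omega

theorem IsNearestNeighbour.op_empty {H : FormalOp d} (hH : IsNearestNeighbour H) :
    op H ∅ = 0 := by
  by_contra h
  obtain ⟨i, h' | h'⟩ := hH ∅ (mt op_eq_zero_iff.2 h)
  · exact (Finset.insert_ne_empty _ _ h'.symm)
  · exact (Finset.singleton_ne_empty _ h'.symm)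

theorem eq_zero_of_lie_bond {H : FormalOp d} (hHt : IsTranslationInvariant H) {p : ℤ}
    (hp : ({p} : Finset ℤ) ⊆ {1, 2})
    (h : ∀ a : LocOp d {p}, IsTraceless a → ⁅embed hp a, H.1 {1, 2}⁆ = 0 → a = 0) (i : ℤ)
    {a : Obs d} (ha : a ∈ opsOn {i + (p - 1)}) (ha0 : siteAvg (i + (p - 1)) a = 0)
    (hab : ⁅a, bond H i⁆ = 0) : a = 0 := by
  have hs1 : shiftSet (1 - i) {i + (p - 1)} = {p} := by
    ext x; simp only [mem_shiftSet, Finset.mem_singleton]; omega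
  have hs2 : shiftSet (1 - i) {i, i + 1} = {1, 2} := by
    ext x; simp only [mem_shiftSet, Finset.mem_singleton, Finset.mem_insert]; omega
  have hm := shift_mem ha (1 - i)
  rw [hs1] at hm
  obtain ⟨a', ha'⟩ := exists_loc_eq hm
  have hb : op H {1, 2} = shift (1 - i) (bond H i) := by rw [← hs2, op_shiftSet hHt, bond]
  have hz : a' = 0 := by
    refine h a' ((isTraceless_iff a').2 fun s hs => ?_) (loc_injective _ ?_)
    · rw [Finset.mem_singleton] at hs
      rw [ha', hs, show p = i + (p - 1) + (1 - i) by ring]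
      have := shift_siteAvg (1 - i) (i + (p - 1)) a
      rw [ha0, map_zero] at this
      convert this.symm using 3
    · rw [loc_lie, loc_embed, ha', map_zero]
      change ⁅shift (1 - i) a, op H {1, 2}⁆ = 0
      rw [hb, ← shift_lie, hab, map_zero]
  rw [hz, map_zero] at ha'
  exact (map_eq_zero_iff _ (shift (1 - i)).injective).1 ha'.symm

theorem InjectiveInteraction.injectiveBonds {H : FormalOp d} (h : InjectiveInteraction H)
    (hHt : IsTranslationInvariant H) : InjectiveBonds H := by
  refine fun i => ⟨fun a ha ha0 hab => ?_, fun a ha ha0 hab => ?_⟩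
  · exact eq_zero_of_lie_bond hHt (p := 2) (by decide) h.1 i (by simpa using ha) (by simpa using ha0)
      hab
  · exact eq_zero_of_lie_bond hHt (p := 1) (by decide) h.2 i (by simpa using ha) (by simpa using ha0)
      hab

theorem Icc_eq_pair (i : ℤ) : Finset.Icc i (i + (0 : ℕ) + 1) = {i, i + 1} := by
  ext x; simp only [Finset.mem_Icc, Finset.mem_insert, Finset.mem_singleton]; push_cast; omega

theorem IsTopFamily.mem_pair {ψ : ℤ → Obs d} (hψ : IsTopFamily 0 ψ) (i : ℤ) :
    ψ i ∈ opsOn {i, i + 1} := Icc_eq_pair i ▸ (hψ i).1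

theorem IsTopFamily.siteAvg_pair {ψ : ℤ → Obs d} (hψ : IsTopFamily 0 ψ) (i : ℤ) {s : ℤ}
    (hs : s ∈ ({i, i + 1} : Finset ℤ)) : siteAvg s (ψ i) = 0 := by
  obtain ⟨-, h1, h2⟩ := hψ i
  rw [Finset.mem_insert, Finset.mem_singleton] at hs
  rcases hs with rfl | rfl
  · exact h1
  · simpa using h2

theorem UniqueTwoLocalCharge.uniqueBonds {H : FormalOp d} (h : UniqueTwoLocalCharge H) :
    UniqueBonds H := by
  intro ψ hψ heq
  choose a ha using fun i => exists_loc_eq (hψ.mem_pair i)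
  obtain ⟨α, hα⟩ := h a (fun i => (isTraceless_iff _).2 fun s hs => by
    rw [ha]; exact hψ.siteAvg_pair i hs) fun i => loc_injective _ (by
      rw [loc_lie, loc_lie, loc_embed, loc_embed, loc_embed, loc_embed, ha, ha]
      exact heq i)
  refine ⟨α, fun i => ?_⟩
  rw [← ha, hα, map_smul]
  rfl

/-! ### The boost operator -/

theorem op_moment {H : FormalOp d} {A : Finset ℤ} {m : ℤ} (hm : m ∈ A) (h : ∀ a ∈ A, m ≤ a) :
    op (moment H) A = (m : ℂ) • op H A := by
  have hA : A.Nonempty := ⟨m, hm⟩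
  have : A.min' hA = m := le_antisymm (A.min'_le m hm) (h _ (A.min'_mem hA))
  simp only [op, moment, dif_pos hA, this, map_smul]

theorem op_moment_empty (H : FormalOp d) : op (moment H) ∅ = 0 := by
  simp [op, moment]

theorem HasRange.moment {H : FormalOp d} {n : ℕ} (hH : HasRange H n) : HasRange (moment H) n := by
  intro A hA a ha
  refine hH A (fun h => hA ?_) a ha
  rw [op_moment (A.min'_mem ⟨a, ha⟩) fun b hb => A.min'_le b hb, h, smul_zero]

/-- Translation lowers the weight `min A` by `x`. The scalar part of `H` must vanish because the
moment discards it, while `x • H` would not. -/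
theorem shiftOp_moment {H : FormalOp d} (hHt : IsTranslationInvariant H) (h0 : op H ∅ = 0) (x : ℤ) :
    shiftOp x (moment H) = moment H - (x : ℂ) • H := by
  refine ext_op fun A => ?_
  rw [op_shiftOp, op_sub, op_smul]
  rcases A.eq_empty_or_nonempty with rfl | hA
  · rw [h0, op_moment_empty, smul_zero, sub_zero]
    convert map_zero (shift x)
    exact op_moment_empty H
  · have h1 : op H A = shift x (op H (shiftSet (-x) A)) := by
      rw [← op_shiftOp, isTranslationInvariant_iff.1 hHt x]
    rw [op_moment (m := A.min' hA - x), op_moment (A.min'_mem hA) fun b hb => A.min'_le b hb,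
      map_smul, ← h1, ← sub_smul, Int.cast_sub]
    · simp [A.min'_mem hA]
    · intro a ha
      have := A.min'_le _ (mem_shiftSet.1 ha)
      omega

theorem shiftOp_add (x : ℤ) (Φ Ψ : FormalOp d) :
    shiftOp x (Φ + Ψ) = shiftOp x Φ + shiftOp x Ψ :=
  ext_op fun A => by simp [op_shiftOp]

theorem shiftOp_boost {H C : FormalOp d} (hHt : IsTranslationInvariant H) (h0 : op H ∅ = 0)
    (hCt : IsTranslationInvariant C) (x : ℤ) :
    shiftOp x (boost H C) = boost H C - (x : ℂ) • H := by
  rw [boost, shiftOp_add, shiftOp_moment hHt h0, isTranslationInvariant_iff.1 hCt]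
  abel

theorem HasRange.boost {H C : FormalOp d} (hH : HasRange H 2) (hC : HasRange C 1) :
    HasRange (boost H C) 2 := hH.moment.add (hC.mono (by norm_num))

theorem op_pair_eq_zero {C : FormalOp d} (hC : HasRange C 1) (i : ℤ) : op C {i, i + 1} = 0 := by
  by_contra h
  have := hC _ h i (by simp) (i + 1) (by simp)
  push_cast at this
  omega

theorem bond_boost (H : FormalOp d) {C : FormalOp d} (hC : HasRange C 1) (i : ℤ) :
    bond (boost H C) i = (i : ℂ) • bond H i := by
  rw [bond, boost, op_add, op_pair_eq_zero hC, add_zero, op_moment (m := i) (by simp) (by simp), bond]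

theorem comm_sub_left {Φ Ψ Θ : FormalOp d} {r s : ℕ} (hΦ : HasRange Φ r) (hΨ : HasRange Ψ r)
    (hΘ : HasRange Θ s) : comm (Φ - Ψ) Θ = comm Φ Θ - comm Ψ Θ := by
  rw [comm_antisymm (hΦ.sub hΨ) hΘ, comm_sub_right hΘ, comm_antisymm hΦ hΘ, comm_antisymm hΨ hΘ]
  abel

theorem comm_smul_left {Φ Θ : FormalOp d} {r s : ℕ} (hΦ : HasRange Φ r) (hΘ : HasRange Θ s)
    (c : ℂ) : comm (c • Φ) Θ = c • comm Φ Θ := by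
  rw [comm_antisymm (hΦ.smul c) hΘ, comm_smul_right hΘ, comm_antisymm hΦ hΘ, smul_neg]

/-- The commutator with the boost maps translation-invariant conserved quantities to
translation-invariant operators. -/
theorem isTranslationInvariant_comm_boost {H C Q : FormalOp d} {r : ℕ} (hHr : HasRange H 2)
    (hHt : IsTranslationInvariant H) (h0 : op H ∅ = 0) (hCr : HasRange C 1)
    (hCt : IsTranslationInvariant C) (hQr : HasRange Q r) (hQt : IsTranslationInvariant Q)
    (hQ : comm H Q = 0) : IsTranslationInvariant (comm (boost H C) Q) := by
  refine isTranslationInvariant_iff.2 fun x => ?_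
  rw [← comm_shiftOp (hHr.boost hCr), shiftOp_boost hHt h0 hCt, isTranslationInvariant_iff.1 hQt,
    comm_sub_left (hHr.boost hCr) (hHr.smul _) hQr, comm_smul_left hHr hQr, hQ, smul_zero, sub_zero]

/-- The leading part of the commutator with the boost. -/
theorem top_comm_boost {H C Q : FormalOp d} {k : ℕ} (hk : 2 ≤ k) (hHr : HasRange H 2)
    (hCr : HasRange C 1) (hQr : HasRange Q k) (hQ : comm H Q = 0) (i : ℤ) :
    top (comm (boost H C) Q) i (i + k)
      = ((k : ℂ) - 1) • ⁅bond H (i + k - 1), top Q i (i + k - 1)⁆ := by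
  have hj : i + k - 1 + 1 = i + k := by ring
  -- The boost weights the two end bonds by `i + k - 1` and `i`. Conservation of `Q` makes the two
  -- unweighted brackets opposite, so only the difference `k - 1` of the weights remains.
  have e1 := top_comm_eq_of_range (hHr.boost hCr) hQr (i := i) (j := i + k) (by omega) le_rfl
  have e2 := top_comm_eq_of_range hHr hQr (i := i) (j := i + k) (by omega) le_rfl
  have b1 : op (boost H C) {i + k - 1, i + k} = ((i + k - 1 : ℤ) : ℂ) • bond H (i + k - 1) := by
    rw [← bond_boost H hCr, bond, hj]
  have b2 : op H {i + k - 1, i + k} = bond H (i + k - 1) := by rw [bond, hj]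
  rw [b1, ← bond, bond_boost H hCr, smul_lie, smul_lie] at e1
  rw [b2, ← bond, hQ, top_zero, eq_comm, add_comm, add_eq_zero_iff_eq_neg] at e2
  rw [e1, e2, smul_neg, ← sub_eq_add_neg, ← sub_smul]
  congr 1
  push_cast; ring


/-! ### Corrections of the three-local operator and nonintegrability -/

theorem op_pred_pair (H : FormalOp d) (j : ℤ) : op H {j - 1, j} = bond H (j - 1) := by
  rw [bond, sub_add_cancel]

theorem isTopFamily_bond (Φ : FormalOp d) : IsTopFamily 0 (bond Φ) := fun i =>
  ⟨by rw [Icc_eq_pair]; exact bond_mem Φ i, siteAvg_bond_left Φ i, by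
    simpa using siteAvg_bond_right Φ i⟩

theorem pair_inj {i j : ℤ} (h : ({i, i + 1} : Finset ℤ) = {j, j + 1}) : i = j := by
  have h1 : i ∈ ({j, j + 1} : Finset ℤ) := h ▸ by simp
  have h2 : j ∈ ({i, i + 1} : Finset ℤ) := h ▸ by simp
  simp only [Finset.mem_insert, Finset.mem_singleton] at h1 h2
  omega

theorem IsTopFamily.exists_bond_eq {θ : ℤ → Obs d} (hθ : IsTopFamily 0 θ) :
    ∃ R : FormalOp d, HasRange R 2 ∧ ∀ i, bond R i = θ i := by
  classical
  obtain ⟨R, hR⟩ := exists_formalOp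
    (fun A => if h : ∃ i : ℤ, A = {i, i + 1} then θ h.choose else 0)
    (fun A => by
      beta_reduce
      split_ifs with h
      · exact (congrArg (θ h.choose ∈ opsOn ·) h.choose_spec).mpr (hθ.mem_pair _)
      · exact zero_mem _)
    (fun A a ha => by
      split_ifs with h
      · rw [h.choose_spec] at ha
        exact hθ.siteAvg_pair _ ha
      · exact map_zero _)
  refine ⟨R, fun A hA a ha b hb => ?_, fun i => ?_⟩
  · rw [hR] at hA
    obtain ⟨i, rfl⟩ : ∃ i : ℤ, A = {i, i + 1} := by
      by_contra h
      exact hA (dif_neg h)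
    simp only [Finset.mem_insert, Finset.mem_singleton] at ha hb
    push_cast; omega
  · have h : ∃ j : ℤ, ({i, i + 1} : Finset ℤ) = {j, j + 1} := ⟨i, rfl⟩
    rw [bond, hR, dif_pos h, ← pair_inj h.choose_spec]

theorem HasRange.Q3 {H C : FormalOp d} (hH : HasRange H 2) (hC : HasRange C 1) :
    HasRange (Q3 H C) 3 := (hH.boost hC).comm hH (by norm_num)

theorem top_Q3 {H C : FormalOp d} (hH : HasRange H 2) (hC : HasRange C 1) (i : ℤ) :
    top (Q3 H C) i (i + 2) = -nest H 1 i := by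
  have := top_comm_boost (k := 2) le_rfl hH hC hH (comm_self hH) i
  push_cast at this
  rw [Q3, this, show i + 2 - 1 = i + 1 by ring, top_succ, show (2 : ℂ) - 1 = 1 by norm_num, one_smul,
    ← lie_skew]
  rfl

/-- A solution of the next-to-leading equation for three-local charges yields a correction of the
boosted Hamiltonian whose commutator with the Hamiltonian is two-local. -/
theorem exists_correction {H C : FormalOp d} (hH : HasRange H 2) (hC : HasRange C 1) {c : ℂ}
    (hc : c ≠ 0) {ω : ℤ → Obs d} (hω : IsTopFamily 0 ω)
    (h : ∀ i, bdry H 0 ω i = c • corr H 1 i) :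
    ∃ R : FormalOp d, HasRange R 2 ∧ HasRange (comm H (Q3 H C + R)) 2 := by
  -- `R` removes the two-site part of `Q3` and puts `-c⁻¹ • ω` in its place; the sign matches the
  -- leading part `-nest H 1` of `Q3`.
  obtain ⟨R, hR, hb⟩ := (((isTopFamily_bond (Q3 H C)).smul (-1)).sub (hω.smul c⁻¹)).exists_bond_eq
  refine ⟨R, hR, ?_⟩
  set Θ := Q3 H C + R with hΘ
  have hΘr : HasRange Θ 3 := (hH.Q3 hC).add (hR.mono (by norm_num))
  have hbΘ : ∀ i, bond Θ i = -(c⁻¹ • ω i) := fun i => by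
    have := hb i
    rw [hΘ, bond, op_add, ← bond, ← bond, this, neg_one_smul]
    abel
  have htΘ : ∀ i, top Θ i (i + 2) = -nest H 1 i := fun i => by
    rw [hΘ, top_add, top_Q3 hH hC, hR.top_eq_zero (by norm_num), add_zero]
  refine hasRange_of_top fun i j hij => ?_
  push_cast at hij
  -- On three sites the equation for `ω` cancels the contribution of the leading part, on four sites
  -- the two forms of the nested commutator cancel, and longer intervals are out of reach.
  obtain rfl | rfl | hj : j = i + 2 ∨ j = i + 3 ∨ i + 4 ≤ j := by omega
  · rw [top_comm_eq hH hΘr (by omega) (by push_cast; omega), op_pred_pair, htΘ,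
      show i + 2 - 1 = i + 1 by ring, show i + 2 = i + 1 + 1 by ring, top_succ, top_succ, ← bond,
      ← bond, ← bond, hbΘ, hbΘ, lie_neg (rs H _) _, map_neg]
    have h1 := h i
    have h2 : corr H 1 i
        = -ends i (i + 1 + 1) ⁅rs H (Finset.Icc i (i + 1 + 1)), nest H 1 i⁆ := by
      rw [corr]; push_cast; rfl
    rw [bdry, Nat.cast_zero, add_zero] at h1
    rw [lie_neg, lie_neg, ← h2, lie_smul, lie_smul, ← lie_skew, smul_neg, neg_neg]
    have h3 : corr H 1 i = c⁻¹ • (⁅bond H i, ω (i + 1)⁆ - ⁅ω i, bond H (i + 1)⁆) := by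
      rw [h1, smul_smul, inv_mul_cancel₀ hc, one_smul]
    rw [h3, smul_sub]
    abel
  · rw [top_comm_eq_of_range hH hΘr (by omega) (by push_cast; omega), op_pred_pair,
      show i + 3 - 1 = i + 2 by ring, show i + 3 = i + 1 + 2 by ring, htΘ, htΘ, ← bond, lie_neg,
      lie_neg, ← nest_succ, nest_succ_right H 1 i, ← lie_skew]
    have h1 : i + ((1 : ℕ) : ℤ) + 1 = i + 2 := by push_cast; ring
    rw [h1, neg_neg, add_neg_cancel]
  · rw [top_comm_eq_of_range hH hΘr (by omega) (by push_cast; omega),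
      hΘr.top_eq_zero (by push_cast; omega), hΘr.top_eq_zero (by push_cast; omega), lie_zero,
      lie_zero, add_zero]

/-- If the next-to-leading equation for three-local charges has no solution, a conserved quantity
of range at least three does not exist. -/
theorem hasRange_pred_of_comm_eq_zero {H : FormalOp d} (hH : HasRange H 2) (hinj : InjectiveBonds H)
    (huniq : UniqueBonds H)
    (hno : ∀ (c : ℂ) (ω : ℤ → Obs d), IsTopFamily 0 ω → (∀ i, bdry H 0 ω i = c • corr H 1 i) → c = 0)
    {Ψ : FormalOp d} (hΨ : comm H Ψ = 0) {n : ℕ} (hr : HasRange Ψ (n + 3)) :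
    HasRange Ψ (n + 2) := by
  have hψ := isTopFamily_top Ψ (n + 1)
  have hχ := isTopFamily_top Ψ n
  -- Conservation on intervals of `n + 4` sites involves only the leading part of `Ψ`.
  obtain ⟨α, hα⟩ := eq_smul_nest hinj huniq hψ fun i => by
    have := top_comm_eq_of_range hH hr (i := i) (j := i + n + 3) (by omega) (by push_cast; omega)
    rw [hΨ, top_zero, op_pred_pair, eq_comm, ← lie_skew, add_comm, ← sub_eq_add_neg, sub_eq_zero,
      ← bond] at this
    convert this using 3 <;> push_cast <;> ring
  -- On `n + 3` sites the next part of `Ψ` enters through `bdry`, and the known leading part through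
  -- `corr`.
  have hb : ∀ i, bdry H n (fun i => top Ψ i (i + n + 1)) i = α • corr H (n + 1) i := fun i => by
    have h1 := top_comm_eq hH hr (i := i) (j := i + n + 2) (by omega) (by push_cast; omega)
    have h2 : top Ψ i (i + n + 2) = α • nest H (n + 1) i := by
      rw [← hα]; congr 1; push_cast; ring
    have h3 : i + ((n + 1 : ℕ) : ℤ) + 1 = i + n + 2 := by push_cast; ring
    have h4 : i + (n : ℤ) + 2 - 1 = i + n + 1 := by ring
    have h5 : i + 1 + (n : ℤ) + 1 = i + n + 2 := by ring
    rw [hΨ, top_zero, op_pred_pair, h2, ← bond, lie_smul, map_smul, h4] at h1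
    rw [bdry, corr, h3, smul_neg, eq_neg_iff_add_eq_zero, h1]
    simp only [h5]
    rw [← lie_skew (top Ψ i _) _]
    abel
  have h0 : α = 0 := by
    cases n with
    | zero => exact hno α _ hχ hb
    | succ m =>
      obtain ⟨ω, hω, h⟩ := corr_descent hH hinj (n := m) hχ (a := α) (b := 0) fun i => by
        rw [hb i, zero_smul, add_zero]
      have := hno _ ω hω h
      -- The descent started from `a = α`, `b = 0` ends with the coefficient `(m + 3) * α / 2`.
      have hm : ((m : ℂ) + 3) ≠ 0 := by exact_mod_cast (by omega : m + 3 ≠ 0)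
      simpa [hm] using this
  refine hasRange_of_top fun i j hij => ?_
  push_cast at hij
  obtain rfl | hj : j = i + n + 2 ∨ i + n + 3 ≤ j := by omega
  · have := hα i
    rw [h0, zero_smul] at this
    rw [← this]
    congr 1; push_cast; ring
  · exact hr.top_eq_zero (by push_cast; omega)

theorem isNonintegrable_of_forall {H : FormalOp d} (hH : HasRange H 2) (hinj : InjectiveBonds H)
    (huniq : UniqueBonds H)
    (hno : ∀ (c : ℂ) (ω : ℤ → Obs d), IsTopFamily 0 ω →
      (∀ i, bdry H 0 ω i = c • corr H 1 i) → c = 0) : IsNonintegrable H := by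
  intro Ψ hloc hΨ
  obtain ⟨n, hn⟩ := exists_hasRange hloc
  have hr : HasRange Ψ 2 := by
    induction n with
    | zero => exact hn.mono (by norm_num)
    | succ m ih =>
      by_cases hm : m + 1 ≤ 2
      · exact hn.mono hm
      · obtain ⟨l, rfl⟩ : ∃ l, m = l + 2 := ⟨m - 2, by omega⟩
        exact ih (hasRange_pred_of_comm_eq_zero hH hinj huniq hno hΨ hn)
  obtain ⟨α, hα⟩ := huniq (bond Ψ) (isTopFamily_bond Ψ) fun i => by
    have := top_comm_eq_of_range hH hr (i := i) (j := i + 1 + 1) (by omega) (by push_cast; omega)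
    rw [hΨ, top_zero, op_pred_pair, eq_comm, ← lie_skew, add_comm, ← sub_eq_add_neg, sub_eq_zero,
      ← bond, add_sub_cancel_right, top_succ, top_succ] at this
    exact this
  refine ⟨α, Ψ - α • H, (opRange_le_iff (n := 1)).2 (hasRange_of_top fun i j hij => ?_), by abel⟩
  push_cast at hij
  obtain rfl | hj : j = i + 1 ∨ i + 2 ≤ j := by omega
  · rw [top_succ, op_sub, op_smul, ← bond, ← bond, hα, sub_self]
  · exact (hr.sub (hH.smul α)).top_eq_zero (by push_cast; omega)

/-! ### The tower of charges and integrability -/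

theorem comm_zero_left {Θ : FormalOp d} {s : ℕ} (hΘ : HasRange Θ s) : comm 0 Θ = 0 := by
  rw [comm_antisymm (hasRange_zero 0) hΘ, comm_zero_right hΘ, neg_zero]

theorem comm_neg_left {Φ Θ : FormalOp d} {r s : ℕ} (hΦ : HasRange Φ r) (hΘ : HasRange Θ s) :
    comm (-Φ) Θ = -comm Φ Θ := by
  rw [← zero_sub, comm_sub_left (hasRange_zero r) hΦ hΘ, comm_zero_left hΘ, zero_sub]

theorem comm_neg_right {Φ : FormalOp d} {r : ℕ} (hΦ : HasRange Φ r) (Ψ : FormalOp d) :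
    comm Φ (-Ψ) = -comm Φ Ψ := by
  rw [← zero_sub, comm_sub_right hΦ, comm_zero_right hΦ, zero_sub]

/-- Local translation-invariant conserved quantities. -/
structure IsCharge (H Q : FormalOp d) : Prop where
  exists_hasRange : ∃ r, HasRange Q r
  invariant : IsTranslationInvariant Q
  conserved : comm H Q = 0

/-- By Jacobi and [H, Q] = 0, [H, [B, Q]] = -[Q3, Q], which commutes with `H` because `Q3` and `Q`
do. So the double commutator of `H` with [B, Q] vanishes, and translation invariance lets one
commutator be removed. -/
theorem IsCharge.comm_boost {H C Q : FormalOp d} (hH : HasRange H 2) (hHsa : IsSelfAdjointOp H)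
    (hHt : IsTranslationInvariant H) (h0 : op H ∅ = 0) (hC : HasRange C 1)
    (hCt : IsTranslationInvariant C) (hQ3 : comm H (Q3 H C) = 0) (hQ : IsCharge H Q) :
    IsCharge H (comm (boost H C) Q) := by
  obtain ⟨⟨r, hr⟩, ht, hc⟩ := hQ
  have hB := hH.boost hC
  have hDr : HasRange (comm (boost H C) Q) (2 + r) := hB.comm hr (by omega)
  have hDt := isTranslationInvariant_comm_boost hH hHt h0 hC hCt hr ht hc
  have hQ3r := hH.Q3 hC
  refine ⟨⟨_, hDr⟩, hDt, comm_eq_zero_of_comm_comm hH hDr hHsa hHt hDt ?_⟩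
  have h1 : comm H (boost H C) = -Q3 H C := comm_antisymm hH hB
  have h2 : HasRange (comm (Q3 H C) Q) (3 + r) := hQ3r.comm hr (by omega)
  rw [comm_jacobi hH hB hr, hc, comm_zero_right hB, add_zero, h1, comm_neg_left hQ3r hr,
    comm_neg_right hH, comm_jacobi hH hQ3r hr, hQ3, hc, comm_zero_left hr, comm_zero_right hQ3r,
    add_zero, neg_zero]

/-- The charges generated from the Hamiltonian by the boost. -/
noncomputable def tower (H C : FormalOp d) : ℕ → FormalOp d
  | 0 => H
  | n + 1 => comm (boost H C) (tower H C n)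

theorem isCharge_tower {H C : FormalOp d} (hH : HasRange H 2) (hHsa : IsSelfAdjointOp H)
    (hHt : IsTranslationInvariant H) (h0 : op H ∅ = 0) (hC : HasRange C 1)
    (hCt : IsTranslationInvariant C) (hQ3 : comm H (Q3 H C) = 0) (n : ℕ) :
    IsCharge H (tower H C n) := by
  induction n with
  | zero => exact ⟨⟨2, hH⟩, hHt, comm_self hH⟩
  | succ n ih => exact ih.comm_boost hH hHsa hHt h0 hC hCt hQ3

/-- By Jacobi, [[B, T], Q] = [B, [T, Q]] - [T, [B, Q]] for `T` in the tower. Both terms vanish by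
induction because [B, Q] is again a charge; this is why the induction runs over all `Q`. -/
theorem comm_tower {H C : FormalOp d} (hH : HasRange H 2) (hHsa : IsSelfAdjointOp H)
    (hHt : IsTranslationInvariant H) (h0 : op H ∅ = 0) (hC : HasRange C 1)
    (hCt : IsTranslationInvariant C) (hQ3 : comm H (Q3 H C) = 0) (n : ℕ) {Q : FormalOp d}
    (hQ : IsCharge H Q) : comm (tower H C n) Q = 0 := by
  induction n generalizing Q with
  | zero => exact hQ.conserved
  | succ n ih =>
    have hB := hH.boost hC
    obtain ⟨r, hr⟩ := hQ.exists_hasRange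
    obtain ⟨s, hs⟩ := (isCharge_tower hH hHsa hHt h0 hC hCt hQ3 n).exists_hasRange
    have := comm_jacobi hB hs hr
    rw [ih hQ, ih (hQ.comm_boost hH hHsa hHt h0 hC hCt hQ3), comm_zero_right hB, add_zero] at this
    exact this.symm

theorem hasRange_tower {H C : FormalOp d} (hH : HasRange H 2) (hC : HasRange C 1) (n : ℕ) :
    HasRange (tower H C n) (n + 2) := by
  induction n with
  | zero => exact hH
  | succ n ih => exact (hH.boost hC).comm ih (by omega)

/-- A boost step brackets the leading part with the next bond, up to a nonzero factor. That part is
traceless at its last site and trivial beyond, so injectivity forbids the bracket to vanish. -/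
theorem top_tower_ne_zero {H C : FormalOp d} (hH : HasRange H 2) (hC : HasRange C 1)
    (hinj : InjectiveBonds H) (hcons : ∀ n, comm H (tower H C n) = 0) {i : ℤ} (hi : bond H i ≠ 0)
    (n : ℕ) : top (tower H C n) i (i + n + 1) ≠ 0 := by
  induction n with
  | zero =>
    rw [Nat.cast_zero, add_zero, top_succ]
    exact hi
  | succ n ih =>
    intro h
    have h1 := top_comm_boost (by omega) hH hC (hasRange_tower hH hC n) (hcons n) i
    have e1 : i + ((n + 2 : ℕ) : ℤ) = i + (n + 1 : ℕ) + 1 := by push_cast; ring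
    have e2 : i + ((n + 1 : ℕ) : ℤ) + 1 - 1 = i + n + 1 := by push_cast; ring
    have hn : ((n + 2 : ℕ) : ℂ) - 1 ≠ 0 := by
      have : ((n + 1 : ℕ) : ℂ) ≠ 0 := Nat.cast_ne_zero.2 n.succ_ne_zero
      convert this using 1
      push_cast; ring
    rw [e1, e2] at h1
    change top (comm (boost H C) (tower H C n)) i _ = 0 at h
    rw [h1, smul_eq_zero, or_iff_right hn] at h
    obtain ⟨hm, -, ht⟩ := isTopFamily_top (tower H C n) n i
    refine ih (hinj.eq_zero_right (off_of_mem hm ?_) ht ?_)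
    · rw [Finset.mem_Icc]; omega
    · rw [← lie_skew, h, neg_zero]

theorem isIntegrable_of_comm_Q3 {H C : FormalOp d} (hH : HasRange H 2) (hHsa : IsSelfAdjointOp H)
    (hHt : IsTranslationInvariant H) (h0 : op H ∅ = 0) (hC : HasRange C 1)
    (hCt : IsTranslationInvariant C) (hinj : InjectiveBonds H) {i : ℤ} (hi : bond H i ≠ 0)
    (hQ3 : comm H (Q3 H C) = 0) : IsIntegrable H := by
  have hch := isCharge_tower hH hHsa hHt h0 hC hCt hQ3
  refine ⟨fun k => tower H C (k - 2), fun k hk => ⟨?_, (hch _).conserved⟩, fun k l _ _ =>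
    comm_tower hH hHsa hHt h0 hC hCt hQ3 _ (hch _)⟩
  obtain ⟨n, rfl⟩ : ∃ n, k = n + 2 := ⟨k - 2, by omega⟩
  beta_reduce
  rw [Nat.add_sub_cancel]
  refine le_antisymm (opRange_le_iff.2 (hasRange_tower hH hC n)) ?_
  have : ¬ opRange (tower H C n) ≤ (n + 1 : ℕ) := fun h =>
    top_tower_ne_zero hH hC hinj (fun m => (hch m).conserved) hi n
      ((opRange_le_iff.1 h).top_eq_zero (by push_cast; omega))
  have := Order.add_one_le_of_lt (not_le.1 this)
  exact_mod_cast this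

/-- With zero bonds, injectivity leaves no nonzero traceless one-site operator, so formal operators
have only a scalar part. -/
theorem isNonintegrable_of_bond_eq_zero {H : FormalOp d} (hinj : InjectiveBonds H)
    (h : ∀ i, bond H i = 0) : IsNonintegrable H := by
  refine fun Ψ _ _ => ⟨0, Ψ, (opRange_le_iff (n := 1)).2 fun A hA a ha => absurd ?_ hA, by simp⟩
  have hne : A.Nonempty := ⟨a, ha⟩
  refine hinj.eq_zero_right (i := A.max' hne) (off_of_mem (op_mem Ψ A) fun hm => ?_)
    (siteAvg_op Ψ (A.max'_mem hne)) (by rw [h, lie_zero])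
  have := A.le_max' _ hm
  omega

/-- A three-local charge cannot be a multiple of `H` plus an at most one-local operator. -/
theorem not_isIntegrable_and_isNonintegrable {H : FormalOp d} (hH : HasRange H 2) :
    ¬ (IsIntegrable H ∧ IsNonintegrable H) := by
  rintro ⟨⟨Q, hQ, -⟩, hN⟩
  obtain ⟨hr, hc⟩ := hQ 3 (by norm_num)
  obtain ⟨α, R, hR, h⟩ := hN (Q 3) (by rw [hr]; exact ENat.natCast_lt_top 3) hc
  have h2 : HasRange (Q 3) 2 := by
    rw [h]
    exact (hH.smul α).add ((opRange_le_iff.1 hR : HasRange R 1).mono (by norm_num))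
  have := opRange_le_iff.2 h2
  rw [hr] at this
  norm_num at this

end
end SpinChain

/-! ### The dichotomy -/

open SpinChain in
theorem proposition1 (d : ℕ) [NeZero d]
    -- The Hamiltonian, Hermitian and translation invariant, and the one-local part of the boost.
    (H C : FormalOp d)
    (hHnn : IsNearestNeighbour H) (hHsa : IsSelfAdjointOp H) (hHinv : IsTranslationInvariant H)
    (hCloc : opRange C ≤ 1) (hCinv : IsTranslationInvariant C)
    (hinj : InjectiveInteraction H) (huniq : UniqueTwoLocalCharge H)
    -- Condition (A).
    (hA : (∃ R : FormalOp d, opRange R ≤ 2 ∧ opRange (comm H (Q3 H C + R)) ≤ 2) →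
      comm H (Q3 H C) = 0) :
    (IsIntegrable H ∨ IsNonintegrable H) ∧ ¬ (IsIntegrable H ∧ IsNonintegrable H) := by
  have hH : HasRange H 2 := hHnn.hasRange
  have hC : HasRange C 1 := opRange_le_iff.1 hCloc
  have hI : InjectiveBonds H := hinj.injectiveBonds hHinv
  refine ⟨?_, not_isIntegrable_and_isNonintegrable hH⟩
  by_cases hQ : comm H (Q3 H C) = 0
  · by_cases hb : ∀ i, bond H i = 0
    · exact Or.inr (isNonintegrable_of_bond_eq_zero hI hb)
    · obtain ⟨i, hi⟩ := not_forall.1 hb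
      exact Or.inl (isIntegrable_of_comm_Q3 hH hHsa hHinv hHnn.op_empty hC hCinv hI hi hQ)
  · refine Or.inr (isNonintegrable_of_forall hH hI huniq.uniqueBonds fun c ω hω h => ?_)
    by_contra hc
    obtain ⟨R, hR, hR'⟩ := exists_correction hH hC hc hω h
    exact hQ (hA ⟨R, opRange_le_iff.2 hR, opRange_le_iff.2 hR'⟩)
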